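/- Let $k$ be a perfect field of characteristic $p>0$ with Frobenius $\sigma$; a $k$-variety is an integral separated $k$-scheme of finite type. Let $S$ be a smooth $k$-variety, $S'=S\times_{k,\sigma}k$ with projection $w:S'\to S$, $F=F_{S/k}:S\to S'$ the relative Frobenius and $F_S=w\circ F$ the absolute one. Let $\tilde S$ be a smooth $W_2(k)$-scheme with reduction $S$ modulo $p$, and $\tilde F:\tilde S\to\tilde S'=\tilde S\times_{W_2(k),W_2(\sigma)}W_2(k)$ a $W_2(k)$-morphism with reduction $F$. Let $\zeta:T_{S/k}\to F^*T_{S'/k}=F_S^*T_{S/k}$ be the linear dual of $\frac{d\tilde F}{p}:F^*\Omega_{S'/k}\to\Omega_{S/k}$. Let $g:Y\to S'$ be a morphism of $k$-varieties, and let $\theta:g^*T_{S'/k}\to T_{Y/S'}$ be a nilpotent Higgs field: an $\mathcal O_Y$-linear map with $[\theta(D_1),\theta(D_2)]=0$ for all local sections $D_1,D_2$ of $T_{S'/k}$, such that for some $n\ge 0$ one has $[p]^n(\theta(D))=0$ for all local sections $D$ of $T_{S'/k}$, where $[p](E)=E^p$ is the $p$-fold composite of a derivation. Let $$X=Y\times_{S'}S,\qquad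 \pi:X\to Y,\qquad f:X\to S$$ be the fibre product along $g$ and $F$ with its projections. Let $\nabla_{can}:f^*T_{S/k}\to T_{X/k}$ be the canonical connection: for $D\in T_{S/k}$, $\nabla_{can}(D)$ is the vector field on $X$ that lifts $D$ and annihilates $\pi^{-1}\mathcal O_Y$. Let $\pi^*\theta:\pi^*g^*T_{S'/k}\to\pi^*T_{Y/S'}=T_{X/S}$ be the pullback of $\theta$. Put $\varphi_0=\pi^*\theta\circ f^*\zeta:f^*T_{S/k}\to T_{X/S}$, and let $\varphi_{n+1}$ be the composite of $f^*\zeta:f^*T_{S/k}\to f^*F_S^*T_{S/k}=F_X^*f^*T_{S/k}$ with the $\mathcal O_X$-linear map $F_X^*f^*T_{S/k}\to T_{X/S}$ that sends the pullback of a local section $D$ of $T_{S/k}$ to $\varphi_n(D)^p$; here $F_X$ is the absolute Frobenius of $X$. Then $$\nabla=\nabla_{can}-\sum_{n\ge0}\varphi_n=\nabla_{can}-\sum_{n\geq 0}[p]^n\circ(\pi^*\theta\circ f^*\zeta)\circ (f^*\zeta)^n$$ (a finite sum) is a well-defined $\mathcal O_X$-linear map $f^*T_{S/k}\to T_{X/k}$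 and a connection on $f$, i.e. a section of $T_{X/k}\to f^*T_{S/k}$. It is integrable, i.e. its image $\mathcal F_\nabla$ is closed under the Lie bracket, and its $p$-curvature $$\psi_\nabla:f^*T_{S/k}\to T_{X/k}/\mathcal F_\nabla\cong T_{X/S},\qquad z\mapsto \nabla(z)^p \bmod \mathcal F_\nabla ,$$ which is $p$-linear, satisfies $$\psi_\nabla=\pi^*\theta$$ as $\mathcal O_X$-linear maps $F_X^*f^*T_{S/k}=\pi^*g^*T_{S'/k}\to T_{X/S}$. Explicitly, for local sections $b_j$ of $\mathcal O_X$ and $D_j$ of $T_{S/k}$ one has $\psi_\nabla\big(\sum_j b_j\otimes D_j\big)=\sum_j b_j^p\,(\pi^*\theta)(w^*D_j)$. -/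

import Mathlib

open AlgebraicGeometry CategoryTheory CategoryTheory.Limits Opposite

universe u

namespace NonlinearHodge

noncomputable section

/-! ### The `p`-th power map of a ring killed by `p`, and `p`-th powers of derivations -/

theorem add_pow_of_natCast_eq_zero {R : Type*} [CommRing R] {p : ℕ} [Fact p.Prime]
    (hp : (p : R) = 0) (a b : R) : (a + b) ^ p = a ^ p + b ^ p := by
  rcases subsingleton_or_nontrivial R with h | h
  · exact Subsingleton.elim _ _
  · have : CharP R p := (CharP.charP_iff_prime_eq_zero Fact.out).mpr hp
    exact add_pow_char a b p

/-- The Frobenius endomorphism `a ↦ a ^ p` of a (possibly zero) ring in which `p = 0`. -/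
def frobRingHom (R : Type*) [CommRing R] (p : ℕ) [Fact p.Prime] (hp : (p : R) = 0) : R →+* R where
  toFun a := a ^ p
  map_one' := one_pow p
  map_mul' a b := mul_pow a b p
  map_zero' := zero_pow (Fact.out : p.Prime).ne_zero
  map_add' a b := add_pow_of_natCast_eq_zero hp a b

theorem iterate_leibniz {R : Type*} [CommRing R] (D : Derivation ℤ R R) (n : ℕ) (a b : R) :
    D^[n] (a * b) =
      ∑ ij ∈ Finset.HasAntidiagonal.antidiagonal n, (n.choose ij.1 : R) * (D^[ij.1] a * D^[ij.2] b) := by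
  induction n with
  | zero => simp
  | succ n ih =>
    rw [Finset.sum_antidiagonal_choose_succ_mul (fun i j => D^[i] a * D^[j] b) n,
      Function.iterate_succ_apply', ih, map_sum, ← Finset.sum_add_distrib]
    refine Finset.sum_congr rfl fun ij hij => ?_
    have hs : (n.choose ij.2 : R) = n.choose ij.1 := by
      rw [← Finset.HasAntidiagonal.mem_antidiagonal.mp hij, Nat.choose_symm_add]
    have hc : D (n.choose ij.1 : R) = 0 := D.map_natCast _
    rw [Derivation.leibniz, hc, Derivation.leibniz]
    simp only [Function.iterate_succ_apply', smul_eq_mul, hs]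
    ring

/-- The `p`-th power (i.e. the `p`-fold composite) `D ∘ ⋯ ∘ D` of a derivation of a ring in which
`p = 0`; it is again a derivation. -/
def derivationPow {R : Type*} [CommRing R] (p : ℕ) [Fact p.Prime] (hp : (p : R) = 0)
    (D : Derivation ℤ R R) : Derivation ℤ R R :=
  Derivation.mk'
    ({ toFun := fun a => D^[p] a
       map_zero' := iterate_map_zero D p
       map_add' := iterate_map_add D p } : R →+ R).toIntLinearMap
    (by
      intro a b
      change D^[p] (a * b) = a • D^[p] b + b • D^[p] a
      have hpp : p.Prime := Fact.out
      obtain ⟨q, rfl⟩ : ∃ q, p = q + 1 := ⟨p - 1, by have := hpp.pos; omega⟩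
      rw [iterate_leibniz, Finset.Nat.sum_antidiagonal_eq_sum_range_succ
        (fun i j => ((q + 1).choose i : R) * (D^[i] a * D^[j] b)), Finset.sum_range_succ,
        Finset.sum_range_succ', Finset.sum_eq_zero]
      · simp only [Nat.choose_zero_right, Nat.choose_self, Nat.sub_self, Nat.sub_zero,
          Function.iterate_zero_apply, smul_eq_mul]
        push_cast
        ring
      · intro i hi
        rw [Finset.mem_range] at hi
        obtain ⟨c, hc⟩ := hpp.dvd_choose_self (k := i + 1) (by omega) (by omega)
        rw [hc, Nat.cast_mul, hp]
        ring)

/-! ### Frobenius morphisms of schemes over a field of characteristic `p` -/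

section Frobenius

variable {k : Type u} [Field k] (p : ℕ)

/-- The ring homomorphism `Γ(Spec k, ⊤) → Γ(X, U)` giving the `k`-algebra structure of `Γ(X, U)`. -/
abbrev constants {X : Scheme.{u}} (h : X ⟶ Spec (.of k)) (U : X.Opens) :
    Γ(Spec (.of k), ⊤) →+* Γ(X, U) :=
  (h.appLE ⊤ U le_top).hom

theorem natCast_eq_zero [CharP k p] {X : Scheme.{u}} (h : X ⟶ Spec (.of k)) (U : X.Opens) :
    (p : Γ(X, U)) = 0 := by
  rw [← map_natCast ((constants h U).comp (Scheme.ΓSpecIso (.of k)).inv.hom) p,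
    show ((p : ℕ) : (CommRingCat.of k : CommRingCat)) = 0 from CharP.cast_eq_zero k p, map_zero]

variable [Fact p.Prime] [CharP k p]

/-- The absolute Frobenius as a morphism of ringed spaces. -/
def absFrobeniusHom {X : Scheme.{u}} (h : X ⟶ Spec (.of k)) :
    X.toPresheafedSpace ⟶ X.toPresheafedSpace where
  base := 𝟙 _
  c := { app := fun U => CommRingCat.ofHom
            (frobRingHom Γ(X, U.unop) p (natCast_eq_zero p h U.unop))
         naturality := by
           intro U V f
           ext a
           exact (map_pow (X.presheaf.map f).hom a p).symm }

/-- The absolute Frobenius of a `k`-scheme: the identity on points, `a ↦ a ^ p` on functions. -/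
def absFrobenius {X : Scheme.{u}} (h : X ⟶ Spec (.of k)) : X ⟶ X where
  toHom := absFrobeniusHom p h
  prop x := by
    refine ⟨fun a ha => ?_⟩
    obtain ⟨U, hxU, s, rfl⟩ := X.presheaf.exists_germ_eq a
    have key : (PresheafedSpace.Hom.stalkMap (absFrobeniusHom p h) x).hom
          ((X.presheaf.germ U x hxU).hom s) = (X.presheaf.germ U x hxU).hom s ^ p := by
      refine (PresheafedSpace.stalkMap_germ_apply (absFrobeniusHom p h) U x hxU s).trans ?_
      exact map_pow (X.presheaf.germ U x hxU).hom s p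
    exact (isUnit_pow_iff (Fact.out : p.Prime).ne_zero).mp (key ▸ ha)

theorem absFrobenius_app {X : Scheme.{u}} (h : X ⟶ Spec (.of k)) (U : X.Opens) (a : Γ(X, U)) :
    ((absFrobenius p h).app U).hom a = a ^ p := rfl

theorem absFrobenius_preimage {X : Scheme.{u}} (h : X ⟶ Spec (.of k)) (U : X.Opens) :
    (absFrobenius p h) ⁻¹ᵁ U = U := rfl

/-- The Frobenius `c ↦ c ^ p` of the field `k`. -/
abbrev sigma (k : Type u) [Field k] (p : ℕ) [Fact p.Prime] [CharP k p] :
    CommRingCat.of k ⟶ CommRingCat.of k :=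
  CommRingCat.ofHom (frobenius k p)

theorem absFrobenius_comp {X : Scheme.{u}} (h : X ⟶ Spec (.of k)) :
    absFrobenius p h ≫ h = h ≫ Spec.map (sigma k p) := by
  refine ext_of_isAffine ?_
  rw [← cancel_epi (Scheme.ΓSpecIso (.of k)).inv]
  ext c
  have h1 := absFrobenius_app p h ⊤ (h.appTop.hom ((Scheme.ΓSpecIso (.of k)).inv.hom c))
  have h2 := Scheme.ΓSpecIso_inv_naturality (sigma k p)
  rw [Scheme.Hom.comp_appTop, Scheme.Hom.comp_appTop, ← reassoc_of% h2]
  refine h1.trans ?_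
  rw [← map_pow, ← map_pow]
  rfl

/-- The Frobenius twist `S' = S ×_{k,σ} k` of a `k`-scheme `S`. -/
def frobTwist {S : Scheme.{u}} (h : S ⟶ Spec (.of k)) : Scheme.{u} :=
  pullback h (Spec.map (sigma k p))

/-- The projection `w : S' = S ×_{k,σ} k → S`. -/
def frobTwistProj {S : Scheme.{u}} (h : S ⟶ Spec (.of k)) : frobTwist p h ⟶ S :=
  pullback.fst h (Spec.map (sigma k p))

/-- The structure morphism of the `k`-scheme `S' = S ×_{k,σ} k`. -/
def frobTwistStr {S : Scheme.{u}} (h : S ⟶ Spec (.of k)) : frobTwist p h ⟶ Spec (.of k) :=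
  pullback.snd h (Spec.map (sigma k p))

/-- The relative Frobenius morphism `F_{S/k} : S → S'`. -/
def relFrobenius {S : Scheme.{u}} (h : S ⟶ Spec (.of k)) : S ⟶ frobTwist p h :=
  pullback.lift (absFrobenius p h) h (absFrobenius_comp p h)

/-! ### Witt vectors of length two -/

/-- The ring `W₂(k)` of Witt vectors of length two. -/
abbrev W2 (k : Type u) [Field k] (p : ℕ) [Fact p.Prime] : Type u := TruncatedWittVector p 2 k

/-- The reduction `W₂(k) → k`. -/
def w2Red (k : Type u) [Field k] (p : ℕ) [Fact p.Prime] : W2 k p →+* k :=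
  RingHom.liftOfSurjective (WittVector.truncate (p := p) 2) (WittVector.truncate_surjective p 2 k)
    ⟨WittVector.constantCoeff (p := p), fun x hx => by
      have hx' := (WittVector.mem_ker_truncate (p := p) 2 x).mp hx
      exact hx' 0 (by norm_num)⟩

/-- The endomorphism `W₂(σ)` of `W₂(k)`. -/
def w2Sigma (k : Type u) [Field k] (p : ℕ) [Fact p.Prime] [CharP k p] : W2 k p →+* W2 k p :=
  RingHom.liftOfSurjective (WittVector.truncate (p := p) 2) (WittVector.truncate_surjective p 2 k)
    ⟨(WittVector.truncate (p := p) 2).comp (WittVector.map (frobenius k p)), fun x hx => by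
      have hx' := (WittVector.mem_ker_truncate (p := p) 2 x).mp hx
      refine (WittVector.mem_ker_truncate (p := p) (R := k) 2
        (WittVector.map (frobenius k p) x)).mpr fun i hi => ?_
      rw [WittVector.map_coeff, hx' i hi, map_zero]⟩

theorem w2Red_truncate (k : Type u) [Field k] (p : ℕ) [Fact p.Prime] (x : WittVector p k) :
    w2Red k p (WittVector.truncate 2 x) = x.coeff 0 :=
  RingHom.liftOfRightInverse_comp_apply _ _ _ _ _

theorem w2Sigma_truncate (x : WittVector p k) :
    w2Sigma k p (WittVector.truncate 2 x) =
      WittVector.truncate 2 (WittVector.map (frobenius k p) x) :=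
  RingHom.liftOfRightInverse_comp_apply _ _ _ _ _

theorem w2Red_surjective (k : Type u) [Field k] (p : ℕ) [Fact p.Prime] :
    Function.Surjective (w2Red k p) := fun c =>
  ⟨WittVector.truncate 2 (WittVector.teichmuller p c), by
    rw [w2Red_truncate, WittVector.teichmuller_coeff_zero]⟩

theorem ker_w2Red_le :
    RingHom.ker (w2Red k p) ≤ nilradical (W2 k p) := by
  intro x hx
  obtain ⟨x, rfl⟩ := WittVector.truncate_surjective p 2 k x
  rw [RingHom.mem_ker, w2Red_truncate] at hx
  refine ⟨2, ?_⟩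
  rw [← map_pow]
  refine (WittVector.mem_ker_truncate (p := p) (R := k) 2 (x ^ 2)).mpr fun i hi => ?_
  obtain ⟨y, rfl⟩ : ∃ y, x = WittVector.verschiebung^[1] y :=
    ⟨_, WittVector.eq_iterate_verschiebung (n := 1) fun i hi => by
      rw [Nat.lt_one_iff.mp hi, hx]⟩
  rw [pow_two, WittVector.iterate_verschiebung_mul]
  exact WittVector.iterate_verschiebung_coeff_eq_zero _ hi

theorem w2Red_comp_w2Sigma : (w2Red k p).comp (w2Sigma k p) = (frobenius k p).comp (w2Red k p) := by
  ext x
  obtain ⟨x, rfl⟩ := WittVector.truncate_surjective p 2 k x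
  rw [RingHom.comp_apply, RingHom.comp_apply, w2Sigma_truncate, w2Red_truncate, w2Red_truncate,
    WittVector.map_coeff]

/-- The closed immersion `Spec k → Spec W₂(k)`. -/
abbrev specRed (k : Type u) [Field k] (p : ℕ) [Fact p.Prime] :
    Spec (.of k) ⟶ Spec (.of (W2 k p)) :=
  Spec.map (CommRingCat.ofHom (w2Red k p))

/-- The twist `S̃' = S̃ ×_{W₂(k), W₂(σ)} W₂(k)` of a `W₂(k)`-scheme `S̃`. -/
def w2Twist {St : Scheme.{u}} (ht : St ⟶ Spec (.of (W2 k p))) : Scheme.{u} :=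
  pullback ht (Spec.map (CommRingCat.ofHom (w2Sigma k p)))

/-- The projection `S̃' → S̃`. -/
def w2TwistProj {St : Scheme.{u}} (ht : St ⟶ Spec (.of (W2 k p))) : w2Twist p ht ⟶ St :=
  pullback.fst ht (Spec.map (CommRingCat.ofHom (w2Sigma k p)))

/-- The structure morphism of the `W₂(k)`-scheme `S̃'`. -/
def w2TwistStr {St : Scheme.{u}} (ht : St ⟶ Spec (.of (W2 k p))) :
    w2Twist p ht ⟶ Spec (.of (W2 k p)) :=
  pullback.snd ht (Spec.map (CommRingCat.ofHom (w2Sigma k p)))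

/-- The morphism `i' : S' → S̃'` obtained from `i : S → S̃` by base change along Frobenius. -/
def twistIncl {S St : Scheme.{u}} {h : S ⟶ Spec (.of k)} {ht : St ⟶ Spec (.of (W2 k p))}
    {i : S ⟶ St} (comm : i ≫ ht = h ≫ specRed k p) : frobTwist p h ⟶ w2Twist p ht :=
  pullback.map _ _ _ _ i (specRed k p) (specRed k p) comm.symm (by
    rw [← Spec.map_comp, ← Spec.map_comp, ← CommRingCat.ofHom_comp, ← CommRingCat.ofHom_comp,
      w2Red_comp_w2Sigma])

/-- A `W₂(k)`-lifting of the pair `(S, F_{S/k})`: a smooth `W₂(k)`-scheme `S̃` whose reduction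
modulo `p` is `S`, and a `W₂(k)`-morphism `F̃ : S̃ → S̃'` whose reduction modulo `p` is `F_{S/k}`. -/
structure FrobeniusLifting {S : Scheme.{u}} (h : S ⟶ Spec (.of k)) where
  /-- the scheme `S̃` -/
  St : Scheme.{u}
  /-- the structure morphism of `S̃` -/
  str : St ⟶ Spec (.of (W2 k p))
  smooth : Smooth str
  /-- the closed immersion of the reduction -/
  i : S ⟶ St
  isPullback : IsPullback i h str (specRed k p)
  /-- the lifting `F̃` of the relative Frobenius -/
  Ft : St ⟶ w2Twist p str
  Ft_str : Ft ≫ w2TwistStr p str = str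
  i_Ft : i ≫ Ft = relFrobenius p h ≫ twistIncl p isPullback.w

end Frobenius

/-! ### Tangent sheaves and `λ`-connections -/

section Connections

variable {k : Type u} [Field k]

/-- The sections of `T_{X/k}` over an affine open `U`: the `k`-linear derivations of `Γ(X, U)`. -/
def tangentSections {X : Scheme.{u}} (h : X ⟶ Spec (.of k)) (U : X.Opens) :
    Submodule Γ(X, U) (Derivation ℤ Γ(X, U) Γ(X, U)) where
  carrier := {D | ∀ c, D (constants h U c) = 0}
  add_mem' h₁ h₂ c := by simp [h₁ c, h₂ c]
  zero_mem' c := by simp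
  smul_mem' a D hD c := by simp [hD c]

/-- Vector fields on the affine open `U`, i.e. sections of `T_{X/k}` over `U`. -/
abbrev Vec {X : Scheme.{u}} (h : X ⟶ Spec (.of k)) (U : X.Opens) : Type u := tangentSections h U

/-- The operation `[p] : D ↦ D ^ p = D ∘ ⋯ ∘ D` on `T_{X/k}`. -/
def Vec.pPow (p : ℕ) [Fact p.Prime] [CharP k p] {X : Scheme.{u}} {h : X ⟶ Spec (.of k)}
    {U : X.Opens} (D : Vec h U) : Vec h U :=
  ⟨derivationPow p (natCast_eq_zero p h U) D.1, fun c => by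
    obtain ⟨q, hq⟩ : ∃ q, p = q + 1 :=
      ⟨p - 1, by have := (Fact.out : p.Prime).pos; omega⟩
    change D.1^[p] (constants h U c) = 0
    rw [hq, Function.iterate_succ_apply, D.2 c]
    exact iterate_map_zero D.1 q⟩

/-- The restriction of functions. -/
abbrev res (X : Scheme.{u}) {U₁ U₂ : X.Opens} (le : U₁ ≤ U₂) : Γ(X, U₂) →+* Γ(X, U₁) :=
  (X.presheaf.map (homOfLE le).op).hom

/-- A `λ`-connection on a morphism `f : X → S` of `k`-schemes, i.e. an `𝒪_X`-linear morphism
`f^*T_{S/k} → T_{X/k}` whose composite with `T_{X/k} → f^*T_{S/k}` is `λ`. It is given through the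
adjoint `𝒪_S`-linear morphism `T_{S/k} → f_*T_{X/k}`: for affine opens `V` of `S` and `U` of `X`
with `f(U) ⊆ V`, a vector field on `V` is sent to one on `U`, linearly and compatibly with
restriction. For `λ = 0` the values annihilate `f^{-1}𝒪_S`, that is, they lie in `T_{X/S}`. -/
@[ext]
structure LambdaConnection {X S : Scheme.{u}} (h : S ⟶ Spec (.of k)) (f : X ⟶ S)
    (lam : Γ(Spec (.of k), ⊤)) where
  toFun : ∀ (V : S.affineOpens) (U : X.affineOpens), U.1 ≤ f ⁻¹ᵁ V.1 → Vec h V.1 → Vec (f ≫ h) U.1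
  map_add : ∀ V U hU D₁ D₂, toFun V U hU (D₁ + D₂) = toFun V U hU D₁ + toFun V U hU D₂
  map_smul : ∀ V U hU (a : Γ(S, V.1)) D,
    toFun V U hU (a • D) = (f.appLE V.1 U.1 hU).hom a • toFun V U hU D
  lifts : ∀ V U hU D (a : Γ(S, V.1)), (toFun V U hU D).1 ((f.appLE V.1 U.1 hU).hom a) =
    constants (f ≫ h) U.1 lam * (f.appLE V.1 U.1 hU).hom (D.1 a)
  map_res : ∀ (V₁ V₂ : S.affineOpens) (U₁ U₂ : X.affineOpens) (hV : V₁.1 ≤ V₂.1)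
    (hU : U₁.1 ≤ U₂.1) (h₁ : U₁.1 ≤ f ⁻¹ᵁ V₁.1) (h₂ : U₂.1 ≤ f ⁻¹ᵁ V₂.1)
    (D₁ : Vec h V₁.1) (D₂ : Vec h V₂.1),
    (∀ a, D₁.1 (res S hV a) = res S hV (D₂.1 a)) →
    ∀ b, (toFun V₁ U₁ h₁ D₁).1 (res X hU b) = res X hU ((toFun V₂ U₂ h₂ D₂).1 b)

namespace LambdaConnection

variable {X S : Scheme.{u}} {h : S ⟶ Spec (.of k)} {f : X ⟶ S}

/-- Integrability of a `0`-connection `θ`: `[θ(D₁), θ(D₂)] = 0` for all `D₁`, `D₂` in `T_{S/k}`.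
An integrable `0`-connection is a Higgs field. -/
def IsHiggsField (θ : LambdaConnection h f 0) : Prop :=
  ∀ V U hU D₁ D₂, ⁅(θ.toFun V U hU D₁).1, (θ.toFun V U hU D₂).1⁆ = 0

/-- Nilpotency of a `0`-connection: `[p]^n ∘ θ = 0` for some `n`. -/
def IsNilpotent (p : ℕ) [Fact p.Prime] [CharP k p] (θ : LambdaConnection h f 0) : Prop :=
  ∃ n : ℕ, ∀ V U hU D, (Vec.pPow p)^[n] (θ.toFun V U hU D) = 0

/-- The sections over `U` of the image `ℱ_∇ ⊆ T_{X/k}` of a `1`-connection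
`∇ : f^*T_{S/k} → T_{X/k}`. -/
def foliation (nabla : LambdaConnection h f 1) (V : S.affineOpens) (U : X.affineOpens)
    (hU : U.1 ≤ f ⁻¹ᵁ V.1) : Submodule Γ(X, U.1) (Vec (f ≫ h) U.1) :=
  Submodule.span _ (Set.range (nabla.toFun V U hU))

/-- Integrability of a `1`-connection: the curvature `[∇, ∇] mod ℱ_∇` vanishes, i.e. `ℱ_∇` is
closed under the Lie bracket. -/
def IsIntegrable (nabla : LambdaConnection h f 1) : Prop :=
  ∀ V U hU, ∀ G₁ ∈ nabla.foliation V U hU, ∀ G₂ ∈ nabla.foliation V U hU,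
    ∃ G ∈ nabla.foliation V U hU, G.1 = ⁅G₁.1, G₂.1⁆

/-- The value of `∇ : f^*T_{S/k} → T_{X/k}` on the section `∑ j, b j ⊗ D j` of `f^*T_{S/k}`. -/
def onPullback (nabla : LambdaConnection h f 1) (V : S.affineOpens) (U : X.affineOpens)
    (hU : U.1 ≤ f ⁻¹ᵁ V.1) {m : ℕ} (b : Fin m → Γ(X, U.1)) (D : Fin m → Vec h V.1) :
    Vec (f ≫ h) U.1 :=
  ∑ j, b j • nabla.toFun V U hU (D j)

/-- The value in `T_{X/k} / ℱ_∇ ≅ T_{X/S}` of the `p`-curvature `ψ_∇` on the section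
`∑ j, b j ⊗ D j` of `f^*T_{S/k}`, namely the class of the `p`-th power of its image under `∇`. -/
def pCurvature (p : ℕ) [Fact p.Prime] [CharP k p] (nabla : LambdaConnection h f 1)
    (V : S.affineOpens) (U : X.affineOpens) (hU : U.1 ≤ f ⁻¹ᵁ V.1) {m : ℕ}
    (b : Fin m → Γ(X, U.1)) (D : Fin m → Vec h V.1) :
    Vec (f ≫ h) U.1 ⧸ nabla.foliation V U hU :=
  Submodule.Quotient.mk (Vec.pPow p (nabla.onPullback V U hU b D))

end LambdaConnection

end Connections

/-! ### The deformed connection -/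

section Deformation

variable {k : Type u} [Field k] (p : ℕ) [Fact p.Prime] [CharP k p]

section Base

variable {S : Scheme.{u}} (h : S ⟶ Spec (.of k))

instance : IsAffineHom (frobTwistProj p h) :=
  have : IsAffineHom (Spec.map (sigma k p)) := inferInstance
  MorphismProperty.of_isPullback (P := @IsAffineHom)
    (IsPullback.of_hasPullback h (Spec.map (sigma k p))).flip this

theorem relFrobenius_proj : relFrobenius p h ≫ frobTwistProj p h = absFrobenius p h :=
  pullback.lift_fst _ _ _

theorem relFrobenius_str : relFrobenius p h ≫ frobTwistStr p h = h :=
  pullback.lift_snd _ _ _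

instance : IsAffineHom (absFrobenius p h) :=
  ⟨fun _ hU => hU⟩

instance : IsAffineHom (relFrobenius p h) := by
  have : IsAffineHom (relFrobenius p h ≫ frobTwistProj p h) := by
    rw [relFrobenius_proj]; infer_instance
  exact IsAffineHom.of_comp _ (frobTwistProj p h)

/-- The open `V' ⊆ S'` obtained from the affine open `V ⊆ S` by base change. -/
def twistOpen (V : S.affineOpens) : (frobTwist p h).affineOpens :=
  ⟨frobTwistProj p h ⁻¹ᵁ V.1, V.2.preimage _⟩

theorem le_relFrobenius_preimage (V : S.affineOpens) :
    V.1 ≤ relFrobenius p h ⁻¹ᵁ (twistOpen p h V).1 := by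
  change V.1 ≤ (relFrobenius p h ≫ frobTwistProj p h) ⁻¹ᵁ V.1
  rw [relFrobenius_proj, absFrobenius_preimage]

/-- The relative Frobenius on functions, `Γ(S', V') → Γ(S, V)`. -/
abbrev frobSharp (V : S.affineOpens) :
    Γ(frobTwist p h, (twistOpen p h V).1) →+* Γ(S, V.1) :=
  ((relFrobenius p h).appLE _ _ (le_relFrobenius_preimage p h V)).hom

/-- The projection `w : S' → S` on functions, `Γ(S, V) → Γ(S', V')`. -/
abbrev projSharp (V : S.affineOpens) :
    Γ(S, V.1) →+* Γ(frobTwist p h, (twistOpen p h V).1) :=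
  ((frobTwistProj p h).app V.1).hom

/-- The base change `w^*D` to `V' ⊆ S'` of a vector field `D` on `V ⊆ S`: the unique `k`-linear
derivation of `Γ(S', V')` that extends `D`. As `w ∘ F_{S/k}` is the absolute Frobenius `F_S`, this
identifies `F_S^* T_{S/k}` with `F_{S/k}^* T_{S'/k}`. -/
def twistVec (V : S.affineOpens) (D : Vec h V.1) :
    Vec (frobTwistStr p h) (twistOpen p h V).1 :=
  Classical.epsilon fun D' => ∀ b, D'.1 (projSharp p h V b) = projSharp p h V (D.1 b)

end Base

namespace FrobeniusLifting

variable {p} {S : Scheme.{u}} {h : S ⟶ Spec (.of k)} (L : FrobeniusLifting p h)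

instance : IsClosedImmersion L.i :=
  have : IsClosedImmersion (specRed k p) :=
    IsClosedImmersion.spec_of_surjective _ (w2Red_surjective k p)
  MorphismProperty.of_isPullback (P := @IsClosedImmersion) L.isPullback.flip this

instance : Surjective L.i :=
  have : Surjective (specRed k p) := 
    ⟨(PrimeSpectrum.isHomeomorph_comap (w2Red k p)
      (fun c => ⟨1, one_pos, (w2Red_surjective k p (c ^ 1)).imp fun _ h => h⟩)
      (ker_w2Red_le p)).surjective⟩
  MorphismProperty.of_isPullback (P := @Surjective) L.isPullback.flip this

/-- The affine open `V = i⁻¹(W)` of `S` that is the reduction of an affine open `W` of `S̃`. -/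
def red (W : L.St.affineOpens) : S.affineOpens :=
  ⟨L.i ⁻¹ᵁ W.1, W.2.preimage _⟩

/-- The reduction modulo `p` of functions, `Γ(S̃, W) → Γ(S, V)` for `V = i⁻¹(W)`. -/
abbrev redSharp (W : L.St.affineOpens) : Γ(L.St, W.1) →+* Γ(S, (L.red W).1) :=
  (L.i.app W.1).hom

/-- The open `W' ⊆ S̃'` obtained from `W ⊆ S̃` by base change. -/
def twistLift (W : L.St.affineOpens) : (w2Twist p L.str).Opens :=
  w2TwistProj p L.str ⁻¹ᵁ W.1

theorem twistIncl_proj :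
    twistIncl p L.isPullback.w ≫ w2TwistProj p L.str = frobTwistProj p h ≫ L.i :=
  pullback.lift_fst _ _ _

theorem twistOpen_le (W : L.St.affineOpens) :
    (twistOpen p h (L.red W)).1 ≤ twistIncl p L.isPullback.w ⁻¹ᵁ L.twistLift W := by
  change _ ≤ (twistIncl p L.isPullback.w ≫ w2TwistProj p L.str) ⁻¹ᵁ W.1
  rw [twistIncl_proj]
  exact le_rfl

theorem le_Ft_preimage (W : L.St.affineOpens) : W.1 ≤ L.Ft ⁻¹ᵁ L.twistLift W := by
  intro x hx
  obtain ⟨s, rfl⟩ := L.i.surjective x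
  have e : L.i ≫ L.Ft ≫ w2TwistProj p L.str = absFrobenius p h ≫ L.i := by
    rw [← Category.assoc, L.i_Ft, Category.assoc, twistIncl_proj, ← Category.assoc,
      relFrobenius_proj]
  change s ∈ (L.i ≫ L.Ft ≫ w2TwistProj p L.str) ⁻¹ᵁ W.1
  rw [e]
  exact hx

/-- The relation `a = ⟨D, (dF̃/p)(db')⟩` for a function `b'` on `V' ⊆ S'`, a vector field `D` on
`V = i⁻¹(W)` and a function `a` on `V`: there are a lift `bt` of `b'` to `S̃'` and a differential
form `ω̃ = ∑ j, x j • d(y j)` on `W` with `d(F̃^♯ bt) = p • ω̃`, and `a` is the pairing of `D` with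
the reduction of `ω̃` modulo `p`. -/
def IsDivFrobPairing (W : L.St.affineOpens) (D : Vec h (L.red W).1)
    (b' : Γ(frobTwist p h, (twistOpen p h (L.red W)).1)) (a : Γ(S, (L.red W).1)) : Prop :=
  letI : Algebra Γ(Spec (.of (W2 k p)), ⊤) Γ(L.St, W.1) :=
    (L.str.appLE ⊤ W.1 le_top).hom.toAlgebra
  ∃ (bt : Γ(w2Twist p L.str, L.twistLift W)) (m : ℕ) (x y : Fin m → Γ(L.St, W.1)),
    ((twistIncl p L.isPullback.w).appLE _ _ (L.twistOpen_le W)).hom bt = b' ∧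
    KaehlerDifferential.D Γ(Spec (.of (W2 k p)), ⊤) Γ(L.St, W.1)
        ((L.Ft.appLE _ _ (L.le_Ft_preimage W)).hom bt) =
      (p : Γ(L.St, W.1)) • ∑ j, x j •
        KaehlerDifferential.D Γ(Spec (.of (W2 k p)), ⊤) Γ(L.St, W.1) (y j) ∧
    a = ∑ j, L.redSharp W (x j) * D.1 (L.redSharp W (y j))

/-- The morphism `ζ : T_S → F^*T_{S'}`, the linear dual of `dF̃/p : F^*Ω_{S'} → Ω_S`, over
`V = i⁻¹(W)`. A section of `F^*T_{S'} = ℋom(F^*Ω_{S'}, 𝒪_S)` is viewed as a derivation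
`𝒪_{S'} → F_*𝒪_S`; thus `ζ(D)` sends `b'` to `⟨D, (dF̃/p)(db')⟩`. -/
def zeta (W : L.St.affineOpens) (D : Vec h (L.red W).1)
    (b' : Γ(frobTwist p h, (twistOpen p h (L.red W)).1)) : Γ(S, (L.red W).1) :=
  Classical.epsilon fun a => L.IsDivFrobPairing W D b' a

end FrobeniusLifting

section Square

variable {p}
variable {S : Scheme.{u}} {h : S ⟶ Spec (.of k)} {Y X : Scheme.{u}} {g : Y ⟶ frobTwist p h}
  {π : X ⟶ Y} {f : X ⟶ S}

/-- The affine open `π⁻¹(U')` of `X = Y ×_{S'} S`. -/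
def preimageOpen (sq : IsPullback π f g (relFrobenius p h)) (U' : Y.affineOpens) : X.affineOpens :=
  have : IsAffineHom (relFrobenius p h) := inferInstance
  have : IsAffineHom π := MorphismProperty.of_isPullback (P := @IsAffineHom) sq.flip this
  ⟨π ⁻¹ᵁ U'.1, U'.2.preimage π⟩

theorem preimageOpen_le (sq : IsPullback π f g (relFrobenius p h)) {V : S.affineOpens}
    {U' : Y.affineOpens} (hU' : U'.1 ≤ g ⁻¹ᵁ (twistOpen p h V).1) :
    (preimageOpen sq U').1 ≤ f ⁻¹ᵁ V.1 := by
  have e : f ⁻¹ᵁ V.1 = π ⁻¹ᵁ g ⁻¹ᵁ (twistOpen p h V).1 := by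
    change (f ≫ absFrobenius p h) ⁻¹ᵁ V.1 = (π ≫ g ≫ frobTwistProj p h) ⁻¹ᵁ V.1
    rw [← relFrobenius_proj, ← Category.assoc, ← Category.assoc, sq.w]
  rw [e]
  exact fun x hx => hU' hx

/-- The vector field on `π⁻¹(U') = U' ×_{V'} V` corresponding under the splitting
`T_{X/k} = f^*T_{S/k} ⊕ π^*T_{Y/S'}` to the pair of a vector field `D` on `V` and a vector field
`v` on `U'` over `V'`: the unique one that is compatible with `D` on functions pulled back from `V`
and with `v` on functions pulled back from `U'`. -/
def fibreVec (sq : IsPullback π f g (relFrobenius p h)) (V : S.affineOpens) (U' : Y.affineOpens)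
    (hU' : U'.1 ≤ g ⁻¹ᵁ (twistOpen p h V).1) (D : Vec h V.1)
    (v : Vec (g ≫ frobTwistStr p h) U'.1) : Vec (f ≫ h) (preimageOpen sq U').1 :=
  Classical.epsilon fun E =>
    (∀ a, E.1 ((f.appLE _ _ (preimageOpen_le sq hU')).hom a) =
      (f.appLE _ _ (preimageOpen_le sq hU')).hom (D.1 a)) ∧
    (∀ b, E.1 ((π.app U'.1).hom b) = (π.app U'.1).hom (v.1 b))

/-- The canonical connection `∇_can` of `X = F_{S/k}^*Y`: the vector field `∇_can(D)` lifts `D` and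
annihilates `π^{-1}𝒪_Y`. -/
def nablaCan (sq : IsPullback π f g (relFrobenius p h)) (V : S.affineOpens) (U' : Y.affineOpens)
    (hU' : U'.1 ≤ g ⁻¹ᵁ (twistOpen p h V).1) (D : Vec h V.1) :
    Vec (f ≫ h) (preimageOpen sq U').1 :=
  fibreVec sq V U' hU' D 0

/-- The pullback `π^*θ : π^*g^*T_{S'} → π^*T_{Y/S'} = T_{X/S}` of a Higgs field `θ`, evaluated at
the pullback of the vector field `w^*D` on `V' ⊆ S'`. -/
def pullbackHiggs (sq : IsPullback π f g (relFrobenius p h))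
    (θ : LambdaConnection (frobTwistStr p h) g 0) (V : S.affineOpens) (U' : Y.affineOpens)
    (hU' : U'.1 ≤ g ⁻¹ᵁ (twistOpen p h V).1) (D : Vec h V.1) :
    Vec (f ≫ h) (preimageOpen sq U').1 :=
  fibreVec sq V U' hU' 0 (θ.toFun (twistOpen p h V) U' hU' (twistVec p h V D))

/-- The `𝒪_X`-linear extension to `f^*F_{S/k}^*T_{S'} = f^*F_S^*T_S` of a map `Φ` given on the
sections of `T_S` (and semilinear with respect to the absolute Frobenius `F_S`), evaluated at a
section `δ` of `F_{S/k}^*T_{S'}`, viewed as a derivation `𝒪_{S'} → F_*𝒪_S`: if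
`δ = ∑ j, a j ⊗ w^*(D j)` then the value is `∑ j, f^♯(a j) • Φ (D j)`. -/
def linearExtension (sq : IsPullback π f g (relFrobenius p h)) (V : S.affineOpens)
    (U' : Y.affineOpens) (hU' : U'.1 ≤ g ⁻¹ᵁ (twistOpen p h V).1)
    (Φ : Vec h V.1 → Vec (f ≫ h) (preimageOpen sq U').1)
    (δ : Γ(frobTwist p h, (twistOpen p h V).1) → Γ(S, V.1)) :
    Vec (f ≫ h) (preimageOpen sq U').1 :=
  Classical.epsilon fun E => ∃ (m : ℕ) (a : Fin m → Γ(S, V.1)) (D : Fin m → Vec h V.1),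
    (∀ b', δ b' = ∑ j, a j * frobSharp p h V ((twistVec p h V (D j)).1 b')) ∧
    E = ∑ j, (f.appLE _ _ (preimageOpen_le sq hU')).hom (a j) • Φ (D j)

/-- The `n`-th summand `[p]^n ∘ (π^*θ ∘ f^*ζ) ∘ (f^*ζ)^n : f^*T_{S/k} → T_{X/S}` of the deformation,
evaluated at `D` in `T_{S/k}`. The summand with `n = 0` is `π^*θ ∘ f^*ζ`. If `φ` is the `n`-th
summand, the next one is `f^*T_{S/k} → F_X^*f^*T_{S/k} → F_X^*T_{X/S} → T_{X/S}`, the composite of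
`f^*ζ`, `F_X^*φ` and `[p]`; here `[p] ∘ F_X^*φ` is the linear extension of `D ↦ φ(D)^p`. -/
def summand (L : FrobeniusLifting p h) (sq : IsPullback π f g (relFrobenius p h))
    (θ : LambdaConnection (frobTwistStr p h) g 0) (W : L.St.affineOpens) (U' : Y.affineOpens)
    (hU' : U'.1 ≤ g ⁻¹ᵁ (twistOpen p h (L.red W)).1) :
    ℕ → Vec h (L.red W).1 → Vec (f ≫ h) (preimageOpen sq U').1
  | 0, D => linearExtension sq (L.red W) U' hU' (pullbackHiggs sq θ (L.red W) U' hU') (L.zeta W D)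
  | n + 1, D => linearExtension sq (L.red W) U' hU'
      (fun D' => Vec.pPow p (summand L sq θ W U' hU' n D')) (L.zeta W D)

/-- The formula `∇ = ∇_can - ∑ n, [p]^n ∘ (π^*θ ∘ f^*ζ) ∘ (f^*ζ)^n`, over the affine opens
`V = i⁻¹(W)` of `S` and `π⁻¹(U')` of `X`, which form bases of the topologies. The sum has only
finitely many nonzero terms when `θ` is nilpotent. -/
def IsDeformation (L : FrobeniusLifting p h) (sq : IsPullback π f g (relFrobenius p h))
    (θ : LambdaConnection (frobTwistStr p h) g 0) (nabla : LambdaConnection h f 1) : Prop :=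
  ∀ (W : L.St.affineOpens) (U' : Y.affineOpens)
    (hU' : U'.1 ≤ g ⁻¹ᵁ (twistOpen p h (L.red W)).1) (D : Vec h (L.red W).1),
    nabla.toFun (L.red W) (preimageOpen sq U') (preimageOpen_le sq hU') D =
      nablaCan sq (L.red W) U' hU' D - ∑ᶠ n : ℕ, summand L sq θ W U' hU' n D

end Square

/-- A `k`-variety: an integral separated scheme of finite type over `k`. -/
structure IsVariety {X : Scheme.{u}} (h : X ⟶ Spec (.of k)) : Prop where
  isIntegral : IsIntegral X
  isSeparated : IsSeparated h
  locallyOfFiniteType : LocallyOfFiniteType h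
  quasiCompact : QuasiCompact h

end Deformation

end

end NonlinearHodge

/-! Over an affine open the lift of Frobenius has the form `x ↦ x ^ p + p * c`, so `dF̃/p` sends the
pullback of `da` to `a ^ (p - 1) da + dc`, where `x` lifts `a`. Let Z_D(a) be the pairing of this
form with `D`. The form is closed, so Z_[D,E](a) = D(Z_E(a)) - E(Z_D(a)); its image under the
Cartier operator is `da`, so Z_{D^p}(a) = D^{p-1}(Z_D(a)) + D(a)^p, which is Katz's formula
`iterate_pow_pred_mul`.

Let Φ be the sum of the φ_n, and let x_i, ∂_i be a finite dual basis of the differentials of S. Each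
φ_n(D) is a combination, with coefficients from 𝒪_S, of iterated p-th powers of values of π^*θ. Such
fields commute and kill 𝒪_S, so taking p-th powers is additive on them, and nilpotency makes the sum
finite. The recursion for φ_n adds up to a fixed point equation (`total_eq`): Φ(D) = ∑ Z_D(x_i) M_i
with M_i = π^*θ(∂_i) + Φ(∂_i)^p. The M_i commute with ∇_can, because π^*θ does and because the
coefficients of a p-th power are p-th powers.

Hence [∇_can(D), Φ(E)] = ∑ D(Z_E(x_i)) M_i, and the first property of Z gives [∇(D), ∇(E)] = ∇([D,
E]) (`nab_lie`). Jacobson's formula gives ∇(D)^p = ∇_can(D^p) - Φ(D)^p - ∑ D^{p-1}(Z_D(x_i)) M_i. By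
the second property of Z and the identity ∑ D(x_i)^p M_i = π^*θ(D) + Φ(D)^p, the right side is
∇(D^p) + π^*θ(D) (`nab_pow`). The formulas of Jacobson and Hochschild make the p-th power additive
and p-linear modulo a foliation (`derivationPow_sum_smul_sub_mem`), which yields the p-curvature on
all sections of f^*T_S.

The local formula does not depend on the dual basis and commutes with restriction. The p-th power of
a function on X descends to Y, so the opens on which the formula is given form a basis of X, and the
local connections glue in a unique way. Perfectness of k makes every derivation k-linear and w : S'
→ S an isomorphism. -/

namespace NonlinearHodge

noncomputable section

/-! ### `p`-th powers in rings killed by `p` -/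

section NoncommutativePowers

variable {R : Type*} [Ring R] {p : ℕ} [hp : Fact p.Prime]

/-- By Pascal's rule and the divisibility of `p.choose (i + 1)` by `p`, consecutive binomial
coefficients of `p - 1` differ by a sign. -/
theorem natCast_choose_mul_neg_one_pow (h0 : (p : R) = 0) {i : ℕ} (hi : i < p) :
    ((p - 1).choose i : R) * (-1) ^ i = 1 := by
  induction i with
  | zero => simp
  | succ i ih =>
    obtain ⟨q, hq⟩ : ∃ q, p = q + 1 := ⟨p - 1, by have := hp.out.pos; omega⟩
    have h1 : (p.choose (i + 1) : R) = 0 := by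
      obtain ⟨c, hc⟩ := hp.out.dvd_choose_self (k := i + 1) (by omega) hi
      rw [hc, Nat.cast_mul, h0, zero_mul]
    have h2 : (((p - 1).choose (i + 1) : ℕ) : R) = -((p - 1).choose i : R) := by
      rw [hq, Nat.choose_succ_succ, Nat.cast_add] at h1
      rw [hq, Nat.add_sub_cancel]
      exact eq_neg_of_add_eq_zero_right h1
    rw [h2, pow_succ, neg_mul, ← mul_assoc, ih (by omega), one_mul, neg_neg]

/-- The signs of the binomial expansion cancel those of the binomial coefficients of `p - 1` modulo
`p`. -/
theorem Commute.sub_pow_pred (h0 : (p : R) = 0) {x y : R} (h : Commute x y) :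
    (x - y) ^ (p - 1) = ∑ i ∈ Finset.range p, x ^ i * y ^ (p - 1 - i) := by
  obtain ⟨q, hq⟩ : ∃ q, p = q + 1 := ⟨p - 1, by have := hp.out.pos; omega⟩
  have h3 : x - y = -y + x := by abel
  have hc : Commute x (-y) := h.neg_right
  rw [sub_eq_add_neg, hc.add_pow, show p - 1 + 1 = p by omega]
  refine Finset.sum_congr rfl fun i hi => ?_
  rw [Finset.mem_range] at hi
  have h4 := natCast_choose_mul_neg_one_pow (R := R) h0 (i := p - 1 - i) (by omega)
  rw [Nat.choose_symm (by omega)] at h4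
  rw [(Nat.cast_commute _ _).eq] at h4
  rw [neg_pow y, mul_assoc, mul_assoc]
  congr 1
  rw [← (Nat.cast_commute _ (y ^ _)).eq, ← mul_assoc, h4, one_mul]

/-- Left and right multiplication by `y` commute, and their difference is the commutator with `y`;
`Commute.sub_pow_pred` applies to this pair. -/
theorem iterate_commutator_pred (h0 : (p : R) = 0) (y z : R) :
    (fun w => ⁅y, w⁆)^[p - 1] z = ∑ i ∈ Finset.range p, y ^ i * z * y ^ (p - 1 - i) := by
  have h1 : (p : Module.End ℤ R) = 0 := by
    ext w
    simp [h0]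
  have h2 := Commute.sub_pow_pred h1 (LinearMap.commute_mulLeft_right (R := ℤ) y y)
  have h3 : (fun w => ⁅y, w⁆) = ⇑(LinearMap.mulLeft ℤ y - LinearMap.mulRight ℤ y) := by
    ext w
    simp [Ring.lie_def]
  rw [h3, ← Module.End.pow_apply, h2]
  simp only [LinearMap.pow_mulLeft, LinearMap.pow_mulRight, LinearMap.sum_apply,
    Module.End.mul_apply, LinearMap.mulLeft_apply, LinearMap.mulRight_apply, mul_assoc]

open Polynomial in
theorem derivative_pow_eq_sum (f : R[X]) (n : ℕ) :
    derivative (f ^ n) = ∑ i ∈ Finset.range n, f ^ i * derivative f * f ^ (n - 1 - i) := by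
  induction n with
  | zero => simp
  | succ n ih =>
    rw [pow_succ, derivative_mul, ih, Finset.sum_range_succ, Finset.sum_mul]
    simp only [Nat.add_sub_cancel, Nat.sub_self, pow_zero, mul_one]
    congr 1
    refine Finset.sum_congr rfl fun i hi => ?_
    rw [Finset.mem_range] at hi
    rw [mul_assoc, ← pow_succ, show n - 1 - i + 1 = n - i by omega]

/-- An inverse of `i` modulo `p` undoes the multiplication. This recovers the coefficients of a
polynomial in degrees `1, …, p - 1` from those of its derivative. -/
theorem mem_of_nsmul_mem (h0 : (p : R) = 0) (H : AddSubgroup R) {i : ℕ} (hi : 0 < i) (hip : i < p)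
    {c : R} (hc : i • c ∈ H) : c ∈ H := by
  have hcop : Nat.Coprime i p := (Nat.coprime_of_lt_prime hi.ne' hip hp.out).symm
  obtain ⟨m, hm⟩ := Nat.exists_mul_mod_eq_one_of_coprime hcop hp.out.one_lt
  have h1 : (i * m) • c = c := by
    rw [← Nat.div_add_mod (i * m) p, hm.2, add_smul, one_smul, mul_smul, nsmul_eq_mul, h0, zero_mul,
      zero_add]
  rw [← h1, mul_comm, mul_smul]
  exact H.nsmul_mem hc m

open Polynomial in
-- The product rule writes the derivative of `f ^ p` as a sum of terms `f ^ i * f' * f ^ (p - 1 -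
-- i)`, which modulo `p` is an iterated commutator. This is how Lie brackets enter Jacobson's
-- formula.
theorem derivative_add_X_mul_pow (h0 : (p : R) = 0) (a b : R) :
    derivative ((C a + X * C b) ^ p) = (fun w => ⁅C a + X * C b, w⁆)^[p - 1] (C b) := by
  have h1 : ((p : ℕ) : R[X]) = 0 := by rw [← map_natCast C, h0, C_0]
  rw [derivative_pow_eq_sum, iterate_commutator_pred h1]
  simp [derivative_mul]

open Polynomial in
/-- The coefficients of `(a + T b) ^ p` sum up to `(a + b) ^ p`. -/
theorem add_pow_eq_add_sum_coeff (a b : R) :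
    (a + b) ^ p = a ^ p + b ^ p +
      ∑ i ∈ Finset.Ico 1 p, ((C a + X * C b) ^ p).coeff i := by
  set y : R[X] := C a + X * C b with hy
  have hd : y.natDegree ≤ 1 := by
    refine natDegree_add_le_of_degree_le (by simp) ?_
    refine natDegree_mul_le.trans ?_
    simpa using natDegree_X_le
  have hdp : (y ^ p).natDegree < p + 1 := by
    have := natDegree_pow_le_of_le p hd
    omega
  -- Evaluation at `T = 1` is multiplicative over a noncommutative ring because `1` is central.
  let e : R[X] →+* R := eval₂RingHom' (RingHom.id R) 1 (fun a => Commute.one_right _)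
  have he : e (y ^ p) = (a + b) ^ p := by
    rw [map_pow]
    congr 1
    change eval₂ (RingHom.id R) 1 y = _
    rw [hy, eval₂_add, X_mul_C, eval₂_C, eval₂_mul_X, eval₂_C]
    simp
  have he' : e (y ^ p) = ∑ i ∈ Finset.range (p + 1), (y ^ p).coeff i := by
    change eval₂ (RingHom.id R) 1 (y ^ p) = _
    rw [eval₂_eq_sum_range' _ hdp]
    simp
  have hc0 : (y ^ p).coeff 0 = a ^ p := by
    have h1 : ∀ n, (y ^ n).coeff 0 = a ^ n := by
      intro n
      induction n with
      | zero => simp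
      | succ n ih => rw [pow_succ, mul_coeff_zero, ih, pow_succ, hy]; simp
    exact h1 p
  have hcp : (y ^ p).coeff p = b ^ p := by
    have h1 := coeff_pow_of_natDegree_le (m := p) hd
    rw [mul_one] at h1
    rw [h1, hy]
    simp [X_mul_C]
  rw [← he, he', Finset.sum_range_succ, hcp, Finset.range_eq_Ico,
    Finset.sum_eq_sum_Ico_succ_bot hp.out.pos, hc0]
  abel

open Polynomial in
theorem succ_nsmul_coeff_pow (h0 : (p : R) = 0) (a b : R) (i : ℕ) :
    (i + 1) • ((C a + X * C b) ^ p).coeff (i + 1) =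
      ((fun w => ⁅C a + X * C b, w⁆)^[p - 1] (C b)).coeff i := by
  rw [← derivative_add_X_mul_pow h0, coeff_derivative, nsmul_eq_mul]
  exact_mod_cast Nat.cast_comm (i + 1) _

open Polynomial in
/-- Jacobson's formula: `(a + b) ^ p - a ^ p - b ^ p` lies in every Lie subring that contains `a`
and `b`. -/
theorem add_pow_sub_mem (h0 : (p : R) = 0) (H : AddSubgroup R)
    (hH : ∀ x ∈ H, ∀ y ∈ H, ⁅x, y⁆ ∈ H) {a b : R} (ha : a ∈ H) (hb : b ∈ H) :
    (a + b) ^ p - (a ^ p + b ^ p) ∈ H := by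
  rw [add_pow_eq_add_sum_coeff, add_sub_cancel_left]
  refine H.sum_mem fun i hi => ?_
  rw [Finset.mem_Ico] at hi
  obtain ⟨j, rfl⟩ : ∃ j, i = j + 1 := ⟨i - 1, by omega⟩
  refine mem_of_nsmul_mem h0 H hi.1 hi.2 ?_
  rw [succ_nsmul_coeff_pow h0]
  -- Bracketing with `a + T b` preserves the polynomials with coefficients in `H`: degree `j + 1` of
  -- the result is the bracket of `a` with degree `j + 1` plus that of `b` with degree `j`.
  have key : ∀ n j, ((fun w => ⁅C a + X * C b, w⁆)^[n] (C b)).coeff j ∈ H := by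
    intro n
    induction n with
    | zero =>
      intro j
      rw [Function.iterate_zero_apply, coeff_C]
      split_ifs
      · exact hb
      · exact H.zero_mem
    | succ n ih =>
      intro j
      rw [Function.iterate_succ_apply']
      generalize (fun w => ⁅C a + X * C b, w⁆)^[n] (C b) = w at ih ⊢
      rw [Ring.lie_def, add_mul, mul_add, X_mul_C, mul_assoc,
        X_mul, ← mul_assoc, mul_assoc _ (C b) X |>.symm]
      rcases j with _ | j
      · simpa [Ring.lie_def] using hH _ ha _ (ih 0)
      · have := H.add_mem (hH _ ha _ (ih (j + 1))) (hH _ hb _ (ih j))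
        rw [Ring.lie_def, Ring.lie_def] at this
        have h2 : ∀ w : R[X], (C a * w + C b * w * X - (w * C a + w * C b * X)).coeff (j + 1) =
            (a * w.coeff (j + 1) - w.coeff (j + 1) * a) + (b * w.coeff j - w.coeff j * b) := by
          intro w
          simp only [coeff_sub, coeff_add, coeff_C_mul, coeff_mul_C, coeff_mul_X]
          abel
        rw [h2]
        exact this
  exact key _ _

open Polynomial in
-- Under the commutation hypothesis the part `T b` never contributes to the iterated brackets of `a
-- + T b` with `b`. The derivative of `(a + T b) ^ p` is therefore constant in `T`, and among the
-- mixed coefficients only the linear one survives.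
theorem add_pow_of_commute_iterate (h0 : (p : R) = 0) {a b : R}
    (h : ∀ n, Commute b ((fun w => ⁅a, w⁆)^[n] b)) :
    (a + b) ^ p = a ^ p + b ^ p + (fun w => ⁅a, w⁆)^[p - 1] b := by
  have key : ∀ n, (fun w => ⁅C a + X * C b, w⁆)^[n] (C b) = C ((fun w => ⁅a, w⁆)^[n] b) := by
    intro n
    induction n with
    | zero => rfl
    | succ n ih =>
      rw [Function.iterate_succ_apply', ih, Function.iterate_succ_apply', Ring.lie_def, add_mul,
        mul_add, X_mul_C, mul_assoc, X_mul_C, ← mul_assoc, ← mul_assoc, ← C_mul, ← C_mul (a := b),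
        ← C_mul, ← C_mul, (h n).eq, Ring.lie_def, C_sub]
      abel
  rw [add_pow_eq_add_sum_coeff]
  congr 1
  rw [Finset.sum_eq_sum_Ico_succ_bot hp.out.one_lt, Finset.sum_eq_zero, add_zero]
  · have h1 := succ_nsmul_coeff_pow h0 a b 0
    rw [key] at h1
    rwa [zero_add, one_smul, coeff_C_zero] at h1
  · intro i hi
    rw [Finset.mem_Ico] at hi
    obtain ⟨j, rfl⟩ : ∃ j, i = j + 1 := ⟨i - 1, by omega⟩
    have h2 : ((C a + X * C b) ^ p).coeff (j + 1) ∈ (⊥ : AddSubgroup R) := by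
      refine mem_of_nsmul_mem h0 ⊥ (by omega) hi.2 ?_
      rw [succ_nsmul_coeff_pow h0, key, coeff_C, if_neg (by omega)]
      exact zero_mem _
    exact h2

theorem add_pow_of_commute (h0 : (p : R) = 0) {a b : R} (h : Commute a b) :
    (a + b) ^ p = a ^ p + b ^ p := by
  obtain ⟨q, hq⟩ : ∃ q, p - 1 = q + 1 := ⟨p - 2, by have := hp.out.two_le; omega⟩
  have h1 : ∀ n, (fun w => ⁅a, w⁆)^[n + 1] b = 0 := by
    intro n
    rw [Function.iterate_succ_apply, h.lie_eq]
    exact Function.iterate_fixed (by simp [Ring.lie_def]) n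
  rw [add_pow_of_commute_iterate h0, hq, h1, add_zero]
  rintro (_ | n)
  · exact Commute.refl b
  · rw [h1]
    exact Commute.zero_right b

end NoncommutativePowers

/-! ### `p`-th powers of derivations -/

section DerivationPowers

variable {R : Type*} [CommRing R] {p : ℕ} [hp : Fact p.Prime]

/-- The additive operator underlying a derivation. -/
abbrev derivOp (D : Derivation ℤ R R) : Module.End ℤ R := D.toLinearMap

theorem natCast_end_eq_zero {q : ℕ} (h0 : (q : R) = 0) : ((q : ℕ) : Module.End ℤ R) = 0 := by
  ext w
  simp [h0]

theorem lie_derivOp_mulLeft (D : Derivation ℤ R R) (c : R) :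
    ⁅derivOp D, LinearMap.mulLeft ℤ c⁆ = LinearMap.mulLeft ℤ (D c) := by
  ext w
  simp [Ring.lie_def, mul_comm]

theorem lie_derivOp (D E : Derivation ℤ R R) : ⁅derivOp D, derivOp E⁆ = derivOp ⁅D, E⁆ := by
  ext w
  simp [Ring.lie_def]

theorem derivOp_pow_apply (D : Derivation ℤ R R) (n : ℕ) (a : R) : (derivOp D ^ n) a = D^[n] a := by
  rw [Module.End.pow_apply]
  rfl

theorem derivationPow_apply (h0 : (p : R) = 0) (D : Derivation ℤ R R) (a : R) :
    derivationPow p h0 D a = D^[p] a := rfl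

theorem derivOp_derivationPow (h0 : (p : R) = 0) (D : Derivation ℤ R R) :
    derivOp (derivationPow p h0 D) = derivOp D ^ p := by
  ext a
  rw [derivOp_pow_apply]
  rfl

theorem derivOp_injective : Function.Injective (derivOp (R := R)) := fun _ _ h =>
  Derivation.ext fun a => congr($h a)

/-- Brackets of `D` with multiplication operators are again multiplication operators, so they
commute and the special case of Jacobson's formula applies; `D ^ p` then kills `1`. Hochschild's and
Katz's formulas both rest on this. -/
theorem iterate_add_apply_one (h0 : (p : R) = 0) (D : Derivation ℤ R R) (x : R) :
    ((derivOp D + LinearMap.mulLeft ℤ x) ^ p) 1 = x ^ p + D^[p - 1] x := by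
  have h1 : ∀ n, (fun w => ⁅derivOp D, w⁆)^[n] (LinearMap.mulLeft ℤ x) =
      LinearMap.mulLeft ℤ (D^[n] x) := by
    intro n
    induction n with
    | zero => rfl
    | succ n ih => rw [Function.iterate_succ_apply', ih, lie_derivOp_mulLeft,
        Function.iterate_succ_apply']
  rw [add_pow_of_commute_iterate (natCast_end_eq_zero h0)]
  · rw [h1, ← derivOp_derivationPow h0, LinearMap.pow_mulLeft]
    simp only [LinearMap.add_apply, LinearMap.mulLeft_apply, mul_one]
    change derivationPow p h0 D 1 + _ + _ = _
    rw [Derivation.map_one_eq_zero, zero_add]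
  · intro n
    rw [h1]
    ext w
    simp [mul_left_comm]

/-- The extension of a derivation to polynomials that kills the variable. -/
def polyDerivation (D : Derivation ℤ R R) :
    Derivation ℤ (Polynomial R) (Polynomial R) :=
  (PolynomialModule.equivPolynomialSelf (R := R)).toLinearMap.compDer D.mapCoeffs

theorem coeff_polyDerivation (D : Derivation ℤ R R) (f : Polynomial R) (i : ℕ) :
    (polyDerivation D f).coeff i = D (f.coeff i) := rfl

open Polynomial in
/-- Hochschild's formula, modulo multiples of `D`. -/
theorem exists_iterate_smul (h0 : (p : R) = 0) (D : Derivation ℤ R R) (b : R) :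
    ∃ g : R, ∀ c, (b • D)^[p] c = b ^ p * D^[p] c + g * D c := by
  let G := polyDerivation D
  have hG1 : G 1 = 0 := G.map_one_eq_zero
  -- Let `X` stand for `D`. Composing `b D` with `∑ c_i D^i` replaces the symbol `∑ c_i X^i` by its
  -- image under `y`, so `y ^ n` applied to `1` is the symbol of the `n`-th iterate of `b D`.
  let y : Module.End ℤ R[X] := derivOp (C b • G) + LinearMap.mulLeft ℤ (C b * X)
  have h0' : ((p : ℕ) : R[X]) = 0 := by rw [← map_natCast C, h0, C_0]
  have h1 : (y ^ p) 1 = (C b * X) ^ p + (C b • G)^[p - 1] (C b * X) :=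
    iterate_add_apply_one h0' _ _
  have hy : ∀ f i, (y f).coeff i = b * D (f.coeff i) + if i = 0 then 0 else b * f.coeff (i - 1) := by
    intro f i
    have : y f = C b * G f + C b * (X * f) := by
      simp [y]
    rw [this, coeff_add, coeff_C_mul, coeff_C_mul]
    rcases i with _ | i
    · simp [G, coeff_polyDerivation]
    · simp [G, coeff_polyDerivation, coeff_X_mul]
  have h2 : ∀ n i, n < i → ((y ^ n) 1).coeff i = 0 := by
    intro n
    induction n with
    | zero =>
      intro i hi
      simp [coeff_one, hi.ne']
    | succ n ih =>
      intro i hi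
      rw [pow_succ', Module.End.mul_apply, hy, ih i (by omega), if_neg (by omega),
        ih (i - 1) (by omega)]
      simp
  have h3 : ∀ n c, (b • D)^[n] c = ∑ i ∈ Finset.range (n + 1), ((y ^ n) 1).coeff i * D^[i] c := by
    intro n c
    induction n with
    | zero => simp
    | succ n ih =>
      rw [Function.iterate_succ_apply', ih, Finset.sum_range_succ' _ (n + 1)]
      rw [pow_succ']
      simp only [Module.End.mul_apply, hy, map_sum, Derivation.leibniz]
      simp only [if_neg (Nat.succ_ne_zero _), Nat.add_sub_cancel, if_true, add_mul,
        Finset.sum_add_distrib]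
      have h4 := Finset.sum_range_succ' (fun i => b * D (((y ^ n) 1).coeff i) * D^[i] c) (n + 1)
      rw [Finset.sum_range_succ, h2 n (n + 1) (by omega)] at h4
      simp only [map_zero, mul_zero, zero_mul, add_zero] at h4
      rw [zero_mul, add_zero, add_right_comm, ← h4, ← Finset.sum_add_distrib,
        ← Finset.sum_add_distrib]
      refine Finset.sum_congr rfl fun i _ => ?_
      rw [Derivation.smul_apply, Derivation.smul_apply, Function.iterate_succ_apply']
      simp only [smul_eq_mul]
      ring
  -- `G` kills `X`, so the correction term stays homogeneous linear in `X`: it is the symbol of a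
  -- multiple of `D`.
  have h5 : ∀ n, ∃ g, (C b • G)^[n] (C b * X) = C g * X := by
    intro n
    induction n with
    | zero => exact ⟨b, rfl⟩
    | succ n ih =>
      obtain ⟨g, hg⟩ := ih
      refine ⟨b * D g, ?_⟩
      rw [Function.iterate_succ_apply', hg]
      ext i
      rw [Derivation.smul_apply, smul_eq_mul, coeff_C_mul, coeff_polyDerivation]
      rcases i with _ | i
      · simp
      · simp only [coeff_mul_X, coeff_C]
        split_ifs <;> simp
  obtain ⟨g, hg⟩ := h5 (p - 1)
  refine ⟨g, fun c => ?_⟩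
  rw [h3, h1, hg, Finset.sum_range_succ, Finset.range_eq_Ico,
    Finset.sum_eq_sum_Ico_succ_bot hp.out.pos, Finset.sum_eq_sum_Ico_succ_bot hp.out.one_lt,
    Finset.sum_eq_zero]
  · have hp1 : p ≠ 1 := hp.out.one_lt.ne'
    have hp0 : p ≠ 0 := hp.out.ne_zero
    rw [mul_pow, ← C_pow]
    simp only [coeff_add, coeff_C_mul, coeff_X_pow, coeff_X]
    simp [hp1.symm, hp0.symm, add_comm]
  · intro i hi
    rw [Finset.mem_Ico] at hi
    rw [mul_pow, ← C_pow]
    simp only [coeff_add, coeff_C_mul, coeff_X_pow, coeff_X]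
    simp [show i ≠ p by omega, show (1 : ℕ) ≠ i by omega]

/-- Katz's formula for the Cartier operator on the form `a ^ (p - 1) da`. -/
theorem iterate_pow_pred_mul [IsDomain R] (h0 : (p : R) = 0) (D : Derivation ℤ R R) (a : R) :
    D^[p - 1] (a ^ (p - 1) * D a) = a ^ (p - 1) * D^[p] a - D a ^ p := by
  by_cases ha : a = 0
  · subst ha
    simp [zero_pow hp.out.ne_zero, iterate_map_zero]
  set c := a ^ p with hc
  set v := a ^ (p - 1) with hv
  have hva : v * a = c := by rw [hv, hc, ← pow_succ, Nat.sub_add_cancel hp.out.pos]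
  have hDc : D c = 0 := by
    rw [hc, Derivation.leibniz_pow, nsmul_eq_mul, h0, zero_mul]
  have hDcn : ∀ n, D (c ^ n) = 0 := fun n => by
    rw [Derivation.leibniz_pow, hDc, smul_zero, smul_zero]
  have hDmul : ∀ n w, D (c ^ n * w) = c ^ n * D w := fun n w => by
    rw [Derivation.leibniz, hDcn, smul_eq_mul, smul_eq_mul, mul_zero, add_zero]
  -- From `v * a = c` and `D c = 0` follows `v * D a = -(a * D v)`, so `y` composed with
  -- multiplication by `v` is multiplication by `v` composed with `c D`. The formula results from
  -- computing `y ^ p` at `c = v * a` in two ways, by this relation and by linearity over `c`.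
  let y : Module.End ℤ R := derivOp (c • D) + LinearMap.mulLeft ℤ (v * D a)
  have hy : ∀ w, y w = c * D w + v * D a * w := fun w => by simp [y, mul_assoc]
  have h1 : ∀ n w, (y ^ n) (v * w) = c ^ n * v * D^[n] w := by
    intro n w
    induction n with
    | zero => simp
    | succ n ih =>
      rw [pow_succ', Module.End.mul_apply, ih, Function.iterate_succ_apply']
      have h7 : D c = v * D a + a * D v := by
        rw [← hva, Derivation.leibniz, smul_eq_mul, smul_eq_mul]
      rw [hDc] at h7
      rw [hy, mul_assoc (c ^ n), hDmul, Derivation.leibniz, smul_eq_mul, smul_eq_mul, pow_succ]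
      linear_combination (-(c ^ n * v * D^[n] w)) * h7 - c ^ n * D^[n] w * D v * hva
  have h2 := h1 p a
  have hcD : ∀ n w, (c • D)^[n] w = c ^ n * D^[n] w := by
    intro n w
    induction n with
    | zero => simp
    | succ n ih =>
      rw [Function.iterate_succ_apply', ih, Derivation.smul_apply, hDmul,
        Function.iterate_succ_apply', smul_eq_mul, pow_succ']
      ring
  have h8 : (y ^ p) 1 = (v * D a) ^ p + (c • D)^[p - 1] (v * D a) := iterate_add_apply_one h0 _ _
  have hyc : ∀ n w, (y ^ n) (c * w) = c * (y ^ n) w := by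
    intro n w
    induction n with
    | zero => simp
    | succ n ih =>
      rw [pow_succ', Module.End.mul_apply, ih, Module.End.mul_apply]
      have h6 : D (c * (y ^ n) w) = c * D ((y ^ n) w) := by simpa using hDmul 1 ((y ^ n) w)
      rw [hy, hy, h6]
      ring
  have h9 := hyc p 1
  rw [mul_one, ← hva, h2, h8, hva, hcD] at h9
  have hc0 : c ≠ 0 := pow_ne_zero _ ha
  have hvp : v ^ p = c ^ (p - 1) := by rw [hv, hc, ← pow_mul, ← pow_mul, mul_comm]
  have hcp : c ^ p = c * c ^ (p - 1) := by
    rw [← pow_succ', Nat.sub_add_cancel hp.out.pos]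
  rw [mul_pow, hvp] at h9
  -- The identity has been obtained only up to the factor `c ^ p`, which is cancelled in the domain.
  refine mul_left_cancel₀ (pow_ne_zero p hc0) ?_
  rw [hcp] at h9 ⊢
  linear_combination -h9

end DerivationPowers

/-! ### Sums and brackets of `p`-th powers of derivations -/

section DerivationPowerSums

variable {R : Type*} [CommRing R] {p : ℕ} [hp : Fact p.Prime]

theorem commute_derivOp_iff {D E : Derivation ℤ R R} :
    Commute (derivOp D) (derivOp E) ↔ ⁅D, E⁆ = 0 := by
  rw [commute_iff_lie_eq, lie_derivOp]
  exact ⟨fun h => derivOp_injective (h.trans rfl), fun h => by rw [h]; rfl⟩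

theorem derivationPow_add_of_lie_iterate (h0 : (p : R) = 0) {D E : Derivation ℤ R R}
    (h : ∀ n, ⁅E, (fun M => ⁅D, M⁆)^[n] E⁆ = 0) :
    derivationPow p h0 (D + E) =
      derivationPow p h0 D + derivationPow p h0 E + (fun M => ⁅D, M⁆)^[p - 1] E := by
  have key : ∀ n, (fun w => ⁅derivOp D, w⁆)^[n] (derivOp E) =
      derivOp ((fun M => ⁅D, M⁆)^[n] E) := by
    intro n
    induction n with
    | zero => rfl
    | succ n ih =>
      rw [Function.iterate_succ_apply', ih, Function.iterate_succ_apply', lie_derivOp]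
  apply derivOp_injective
  have h1 := add_pow_of_commute_iterate (natCast_end_eq_zero h0) (a := derivOp D) (b := derivOp E)
    (fun n => by rw [key]; exact commute_derivOp_iff.mpr (h n))
  rw [derivOp_derivationPow, show derivOp (D + E) = derivOp D + derivOp E from rfl, h1, key,
    ← derivOp_derivationPow h0, ← derivOp_derivationPow h0]
  rfl

theorem derivationPow_add_of_lie (h0 : (p : R) = 0) {D E : Derivation ℤ R R} (h : ⁅D, E⁆ = 0) :
    derivationPow p h0 (D + E) = derivationPow p h0 D + derivationPow p h0 E := by
  apply derivOp_injective
  have h1 := add_pow_of_commute (natCast_end_eq_zero h0) (commute_derivOp_iff.mpr h)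
  rw [derivOp_derivationPow, show derivOp (D + E) = derivOp D + derivOp E from rfl, h1,
    ← derivOp_derivationPow h0, ← derivOp_derivationPow h0]
  rfl

theorem derivationPow_zero (h0 : (p : R) = 0) :
    derivationPow p h0 (0 : Derivation ℤ R R) = 0 := by
  ext a
  obtain ⟨q, hq⟩ : ∃ q, p = q + 1 := ⟨p - 1, by have := hp.out.pos; omega⟩
  rw [derivationPow_apply, hq, Function.iterate_succ_apply']
  rfl

theorem derivationPow_apply_eq_zero (h0 : (p : R) = 0) {D : Derivation ℤ R R} {a : R}
    (h : D a = 0) : derivationPow p h0 D a = 0 := by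
  obtain ⟨q, hq⟩ : ∃ q, p = q + 1 := ⟨p - 1, by have := hp.out.pos; omega⟩
  rw [derivationPow_apply, hq, Function.iterate_succ_apply, h]
  exact iterate_map_zero D q

theorem derivationPow_neg (h0 : (p : R) = 0) (D : Derivation ℤ R R) :
    derivationPow p h0 (-D) = -derivationPow p h0 D := by
  have h1 : ⁅D, -D⁆ = 0 := by rw [lie_neg, lie_self, neg_zero]
  have h2 := derivationPow_add_of_lie h0 h1
  rw [add_neg_cancel, derivationPow_zero] at h2
  exact (neg_eq_of_add_eq_zero_right h2.symm).symm

/-- A scalar killed by `D` passes through all iterates, so Hochschild's correction term is absent.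
-/
theorem derivationPow_smul_of_apply_eq_zero (h0 : (p : R) = 0) {D : Derivation ℤ R R} {c : R}
    (h : D c = 0) : derivationPow p h0 (c • D) = c ^ p • derivationPow p h0 D := by
  have hc : ∀ n, D (c ^ n) = 0 := fun n => by rw [Derivation.leibniz_pow, h, smul_zero, smul_zero]
  ext a
  change (c • D)^[p] a = c ^ p * D^[p] a
  generalize p = n
  induction n with
  | zero => simp
  | succ n ih =>
    rw [Function.iterate_succ_apply', ih, Function.iterate_succ_apply', Derivation.smul_apply,
      Derivation.leibniz, hc, smul_zero, add_zero, smul_eq_mul, smul_eq_mul, pow_succ']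
    ring

theorem derivationPow_sum (h0 : (p : R) = 0) {ι : Type*} (s : Finset ι)
    (D : ι → Derivation ℤ R R) (h : ∀ i j, ⁅D i, D j⁆ = 0) :
    derivationPow p h0 (∑ i ∈ s, D i) = ∑ i ∈ s, derivationPow p h0 (D i) := by
  classical
  induction s using Finset.induction_on with
  | empty => simp [derivationPow_zero]
  | insert i s hi ih =>
    rw [Finset.sum_insert hi, Finset.sum_insert hi, derivationPow_add_of_lie h0, ih]
    rw [lie_sum]
    exact Finset.sum_eq_zero fun j _ => h i j

theorem lie_smul_derivation (D E : Derivation ℤ R R) (c : R) :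
    ⁅D, c • E⁆ = D c • E + c • ⁅D, E⁆ := by
  ext a
  simp only [Derivation.commutator_apply, Derivation.smul_apply, Derivation.add_apply,
    Derivation.leibniz, smul_eq_mul]
  ring

/-- For a module `F` of derivations closed under brackets, the `p`-th power map is additive and
`p`-linear modulo `F`. -/
theorem derivationPow_sum_smul_sub_mem (h0 : (p : R) = 0)
    (F : Submodule R (Derivation ℤ R R)) (hF : ∀ D ∈ F, ∀ E ∈ F, ⁅D, E⁆ ∈ F)
    {ι : Type*} (s : Finset ι) (b : ι → R) (D : ι → Derivation ℤ R R) (hD : ∀ i, D i ∈ F) :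
    derivationPow p h0 (∑ i ∈ s, b i • D i) - ∑ i ∈ s, b i ^ p • derivationPow p h0 (D i) ∈ F := by
  classical
  have hadd : ∀ D ∈ F, ∀ E ∈ F,
      derivationPow p h0 (D + E) - (derivationPow p h0 D + derivationPow p h0 E) ∈ F := by
    intro D hD E hE
    -- The operators of the derivations in `F` form a Lie subring of the endomorphism ring, the
    -- setting of Jacobson's formula.
    let H : AddSubgroup (Module.End ℤ R) :=
      { carrier := {w | ∃ G ∈ F, derivOp G = w}
        add_mem' := by
          rintro _ _ ⟨G, hG, rfl⟩ ⟨G', hG', rfl⟩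
          exact ⟨G + G', F.add_mem hG hG', rfl⟩
        zero_mem' := ⟨0, F.zero_mem, rfl⟩
        neg_mem' := by
          rintro _ ⟨G, hG, rfl⟩
          exact ⟨-G, F.neg_mem hG, rfl⟩ }
    have hH : ∀ x ∈ H, ∀ y ∈ H, ⁅x, y⁆ ∈ H := by
      rintro _ ⟨G, hG, rfl⟩ _ ⟨G', hG', rfl⟩
      exact ⟨⁅G, G'⁆, hF G hG G' hG', (lie_derivOp G G').symm⟩
    obtain ⟨G, hG, e⟩ := add_pow_sub_mem (natCast_end_eq_zero h0) H hH ⟨D, hD, rfl⟩ ⟨E, hE, rfl⟩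
    have e' : G = derivationPow p h0 (D + E) -
        (derivationPow p h0 D + derivationPow p h0 E) := by
      apply derivOp_injective
      rw [e, ← derivOp_derivationPow h0, ← derivOp_derivationPow h0,
        show derivOp D + derivOp E = derivOp (D + E) from rfl, ← derivOp_derivationPow h0]
      rfl
    rwa [← e']
  have hsmul : ∀ D ∈ F, ∀ c : R,
      derivationPow p h0 (c • D) - c ^ p • derivationPow p h0 D ∈ F := by
    intro D hD c
    obtain ⟨g, hg⟩ := exists_iterate_smul h0 D c
    have e : derivationPow p h0 (c • D) - c ^ p • derivationPow p h0 D = g • D := by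
      ext a
      rw [Derivation.sub_apply, derivationPow_apply, hg, Derivation.smul_apply,
        Derivation.smul_apply, derivationPow_apply, smul_eq_mul, smul_eq_mul, add_sub_cancel_left]
    rw [e]
    exact F.smul_mem g hD
  induction s using Finset.induction_on with
  | empty => simp [derivationPow_zero]
  | insert i s hi ih =>
    rw [Finset.sum_insert hi, Finset.sum_insert hi]
    have h1 := hadd _ (F.smul_mem (b i) (hD i)) _
      (F.sum_mem fun j (_ : j ∈ s) => F.smul_mem (b j) (hD j))
    have h2 := F.add_mem (F.add_mem h1 (hsmul _ (hD i) (b i))) ih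
    convert h2 using 1
    abel

end DerivationPowerSums

/-! ### The deformed connection of a chart -/

/-- The ring-theoretic data of the deformed connection over affine opens `Spec A` of `S` and
`Spec C` of `X`: the canonical connection `can`, the pullback `T` of the Higgs field, the map `Z`
dual to `dF̃/p`, and a finite dual basis of the module of differentials of `A`. -/
structure DeformationChart (p : ℕ) [Fact p.Prime] (A C : Type u) [CommRing A] [CommRing C] where
  hA : (p : A) = 0
  hC : (p : C) = 0
  f : A →+* C
  can : Derivation ℤ A A → Derivation ℤ C C
  can_f : ∀ D a, can D (f a) = f (D a)
  can_add : ∀ D E, can (D + E) = can D + can E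
  can_smul : ∀ (a : A) D, can (a • D) = f a • can D
  can_lie : ∀ D E, ⁅can D, can E⁆ = can ⁅D, E⁆
  can_pow : ∀ D, derivationPow p hC (can D) = can (derivationPow p hA D)
  T : Derivation ℤ A A → Derivation ℤ C C
  T_f : ∀ D a, T D (f a) = 0
  T_add : ∀ D E, T (D + E) = T D + T E
  -- Semilinear, since `T` is evaluated at `w^*D` and `w^♯ a` becomes `a ^ p` after pullback along
  -- Frobenius.
  T_smul : ∀ (a : A) D, T (a • D) = f a ^ p • T D
  T_lie : ∀ D E, ⁅T D, T E⁆ = 0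
  can_lie_T : ∀ D E, ⁅can D, T E⁆ = 0
  N : ℕ
  T_nil : ∀ D, (derivationPow p hC)^[N] (T D) = 0
  Z : Derivation ℤ A A → A → A
  Z_add : ∀ D E a, Z (D + E) a = Z D a + Z E a
  Z_smul : ∀ (b : A) D a, Z (b • D) a = b * Z D a
  -- This identity says that the form `D ↦ Z D a` is closed; the next one says that its image under
  -- the Cartier operator is `da`.
  Z_lie : ∀ D E a, Z ⁅D, E⁆ a = D (Z E a) - E (Z D a)
  Z_pow : ∀ D a, Z (derivationPow p hA D) a = D^[p - 1] (Z D a) + D a ^ p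
  n : ℕ
  x : Fin n → A
  del : Fin n → Derivation ℤ A A
  eq_sum : ∀ D, D = ∑ i, D (x i) • del i
  Z_eq_sum : ∀ D a, Z D a = ∑ i, Z D (x i) * del i a ^ p

namespace DeformationChart

variable {p : ℕ} [hp : Fact p.Prime] {A C : Type u} [CommRing A] [CommRing C]
  (d : DeformationChart p A C)

/-- The `m`-fold iterate of the `p`-th power map on `T D`. -/
def Tp (m : ℕ) (D : Derivation ℤ A A) : Derivation ℤ C C := (derivationPow p d.hC)^[m] (d.T D)

/-- The coefficients of the `m`-th summand of the deformation. -/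
def coeff : ℕ → Derivation ℤ A A → Fin d.n → A
  | 0, D, j => d.Z D (d.x j)
  | m + 1, D, j => ∑ i, d.Z D (d.x i) * coeff m (d.del i) j ^ p

/-- The `m`-th summand of the deformation. -/
def phi (m : ℕ) (D : Derivation ℤ A A) : Derivation ℤ C C :=
  ∑ j, d.f (d.coeff m D j) • d.Tp m (d.del j)

/-- Iterated `p`-th powers are powers of one operator, so whatever commutes with `T D` commutes with
every `Tp m D`. -/
theorem derivOp_Tp (m : ℕ) (D : Derivation ℤ A A) :
    derivOp (d.Tp m D) = derivOp (d.T D) ^ p ^ m := by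
  induction m with
  | zero => simp [Tp]
  | succ m ih =>
    rw [Tp, Function.iterate_succ_apply', derivOp_derivationPow]
    rw [Tp] at ih
    rw [ih, ← pow_mul, ← pow_succ]

theorem Tp_succ (m : ℕ) (D : Derivation ℤ A A) :
    d.Tp (m + 1) D = derivationPow p d.hC (d.Tp m D) := Function.iterate_succ_apply' _ _ _

theorem Tp_f (m : ℕ) (D : Derivation ℤ A A) (a : A) : d.Tp m D (d.f a) = 0 := by
  induction m with
  | zero => exact d.T_f D a
  | succ m ih =>
    rw [Tp_succ]
    exact derivationPow_apply_eq_zero d.hC ih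

theorem Tp_lie (m n : ℕ) (D E : Derivation ℤ A A) : ⁅d.Tp m D, d.Tp n E⁆ = 0 := by
  rw [← commute_derivOp_iff, derivOp_Tp, derivOp_Tp]
  exact (commute_derivOp_iff.mpr (d.T_lie D E)).pow_pow _ _

theorem can_lie_Tp (n : ℕ) (D E : Derivation ℤ A A) : ⁅d.can D, d.Tp n E⁆ = 0 := by
  rw [← commute_derivOp_iff, derivOp_Tp]
  exact (commute_derivOp_iff.mpr (d.can_lie_T D E)).pow_right _

theorem Tp_eq_zero (m : ℕ) (hm : d.N ≤ m) (D : Derivation ℤ A A) : d.Tp m D = 0 := by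
  obtain ⟨k, rfl⟩ := Nat.exists_eq_add_of_le' hm
  rw [Tp, Function.iterate_add_apply, d.T_nil]
  exact Function.iterate_fixed (derivationPow_zero d.hC) k

/-- The additive group of vertical vector fields generated by the multiples of the `Tp m D` by
functions on `Spec A`. -/
def vert : AddSubgroup (Derivation ℤ C C) :=
  AddSubgroup.closure {M | ∃ c m D, M = d.f c • d.Tp m D}

theorem smul_Tp_mem_vert (c : A) (m : ℕ) (D : Derivation ℤ A A) : d.f c • d.Tp m D ∈ d.vert :=
  AddSubgroup.subset_closure ⟨c, m, D, rfl⟩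

theorem Tp_mem_vert (m : ℕ) (D : Derivation ℤ A A) : d.Tp m D ∈ d.vert := by
  simpa using d.smul_Tp_mem_vert 1 m D

theorem phi_mem_vert (m : ℕ) (D : Derivation ℤ A A) : d.phi m D ∈ d.vert :=
  sum_mem fun _ _ => d.smul_Tp_mem_vert _ _ _

variable {d}

theorem smul_mem_vert (c : A) {M : Derivation ℤ C C} (hM : M ∈ d.vert) : d.f c • M ∈ d.vert := by
  induction hM using AddSubgroup.closure_induction with
  | mem M hM =>
    obtain ⟨c', m, D, rfl⟩ := hM
    rw [smul_smul, ← map_mul]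
    exact d.smul_Tp_mem_vert _ _ _
  | zero => rw [smul_zero]; exact zero_mem _
  | add M M' _ _ h h' => rw [smul_add]; exact add_mem h h'
  | neg M _ h => rw [smul_neg]; exact neg_mem h

theorem vert_f {M : Derivation ℤ C C} (hM : M ∈ d.vert) (a : A) : M (d.f a) = 0 := by
  induction hM using AddSubgroup.closure_induction with
  | mem M hM =>
    obtain ⟨c', m, D, rfl⟩ := hM
    rw [Derivation.smul_apply, Tp_f, smul_zero]
  | zero => rfl
  | add M M' _ _ h h' => rw [Derivation.add_apply, h, h', add_zero]
  | neg M _ h => rw [Derivation.neg_apply, h, neg_zero]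

/-- The generators `Tp m D` commute, and the Leibniz terms vanish because the coefficients come from
`A`, on which every element of `vert` is zero. Arbitrary coefficients in `C` would destroy this. -/
theorem vert_lie {M M' : Derivation ℤ C C} (hM : M ∈ d.vert) (hM' : M' ∈ d.vert) :
    ⁅M, M'⁆ = 0 := by
  induction hM' using AddSubgroup.closure_induction with
  | mem M' hM' =>
    obtain ⟨c', m', D', rfl⟩ := hM'
    rw [lie_smul_derivation, vert_f hM, zero_smul, zero_add]
    suffices h : ⁅M, d.Tp m' D'⁆ = 0 by rw [h, smul_zero]
    induction hM using AddSubgroup.closure_induction with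
    | mem M hM =>
      obtain ⟨c, m, D, rfl⟩ := hM
      rw [← lie_skew, lie_smul_derivation, Tp_f, zero_smul, zero_add, Tp_lie, smul_zero, neg_zero]
    | zero => rw [zero_lie]
    | add M M' _ _ h h' => rw [add_lie, h, h', add_zero]
    | neg M _ h => rw [neg_lie, h, neg_zero]
  | zero => rw [lie_zero]
  | add M M' _ _ h h' => rw [lie_add, h, h', add_zero]
  | neg M _ h => rw [lie_neg, h, neg_zero]

theorem pow_smul (c : A) {M : Derivation ℤ C C} (hM : M ∈ d.vert) :
    derivationPow p d.hC (d.f c • M) = d.f c ^ p • derivationPow p d.hC M :=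
  derivationPow_smul_of_apply_eq_zero d.hC (vert_f hM c)

/-- On commuting fields the `p`-th power is additive, and it takes `f c • Tp m D` to `f (c ^ p) • Tp
(m + 1) D`. -/
theorem pow_mem_vert {M : Derivation ℤ C C} (hM : M ∈ d.vert) :
    derivationPow p d.hC M ∈ d.vert := by
  induction hM using AddSubgroup.closure_induction with
  | mem M hM =>
    obtain ⟨c', m, D, rfl⟩ := hM
    rw [pow_smul _ (d.Tp_mem_vert m D), ← Tp_succ, ← map_pow]
    exact d.smul_Tp_mem_vert _ _ _
  | zero => rw [derivationPow_zero]; exact zero_mem _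
  | add M M' h1 h2 h h' =>
    rw [derivationPow_add_of_lie _ (vert_lie h1 h2)]
    exact add_mem h h'
  | neg M _ h => rw [derivationPow_neg]; exact neg_mem h

theorem can_f_pow (D : Derivation ℤ A A) (c : A) : d.can D (d.f c ^ p) = 0 := by
  rw [Derivation.leibniz_pow, nsmul_eq_mul, d.hC, zero_mul]

/-- Elements of `vert` need not commute with `can D`, since their coefficients may be
differentiated. In a `p`-th power the coefficients are `p`-th powers, hence constants. -/
theorem can_lie_pow (D : Derivation ℤ A A) {M : Derivation ℤ C C} (hM : M ∈ d.vert) :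
    ⁅d.can D, derivationPow p d.hC M⁆ = 0 := by
  induction hM using AddSubgroup.closure_induction with
  | mem M hM =>
    obtain ⟨c', m, D', rfl⟩ := hM
    rw [pow_smul _ (d.Tp_mem_vert m D'), ← Tp_succ, lie_smul_derivation, can_f_pow, zero_smul,
      can_lie_Tp, smul_zero, add_zero]
  | zero => rw [derivationPow_zero, lie_zero]
  | add M M' h1 h2 h h' =>
    rw [derivationPow_add_of_lie _ (vert_lie h1 h2), lie_add, h, h', add_zero]
  | neg M _ h => rw [derivationPow_neg, lie_neg, h, neg_zero]

theorem pow_sum {ι : Type*} (s : Finset ι) (M : ι → Derivation ℤ C C) (hM : ∀ i, M i ∈ d.vert) :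
    derivationPow p d.hC (∑ i ∈ s, M i) = ∑ i ∈ s, derivationPow p d.hC (M i) :=
  derivationPow_sum d.hC s M fun i j => vert_lie (hM i) (hM j)

variable (d)

theorem coeff_add (m : ℕ) (D E : Derivation ℤ A A) (j : Fin d.n) :
    d.coeff m (D + E) j = d.coeff m D j + d.coeff m E j := by
  cases m with
  | zero => exact d.Z_add D E _
  | succ m => simp only [coeff, d.Z_add, add_mul, Finset.sum_add_distrib]

theorem coeff_smul (m : ℕ) (a : A) (D : Derivation ℤ A A) (j : Fin d.n) :
    d.coeff m (a • D) j = a * d.coeff m D j := by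
  cases m with
  | zero => exact d.Z_smul a D _
  | succ m => simp only [coeff, d.Z_smul, mul_assoc, Finset.mul_sum]

theorem phi_add (m : ℕ) (D E : Derivation ℤ A A) : d.phi m (D + E) = d.phi m D + d.phi m E := by
  simp only [phi, coeff_add, map_add, add_smul, Finset.sum_add_distrib]

theorem phi_smul (m : ℕ) (a : A) (D : Derivation ℤ A A) :
    d.phi m (a • D) = d.f a • d.phi m D := by
  simp only [phi, coeff_smul, map_mul, mul_smul, Finset.smul_sum]

theorem phi_zero (D : Derivation ℤ A A) :
    d.phi 0 D = ∑ i, d.f (d.Z D (d.x i)) • d.T (d.del i) := rfl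

/-- This recovers the recursion of the summands from their explicit coefficients: on `vert` the
`p`-th power is additive and raises coefficients from `A` to the power `p`. -/
theorem phi_succ (m : ℕ) (D : Derivation ℤ A A) :
    d.phi (m + 1) D =
      ∑ i, d.f (d.Z D (d.x i)) • derivationPow p d.hC (d.phi m (d.del i)) := by
  simp only [phi]
  rw [Finset.sum_congr rfl fun j _ => show d.f (d.coeff (m + 1) D j) • d.Tp (m + 1) (d.del j) =
      ∑ i, d.f (d.Z D (d.x i)) • (d.f (d.coeff m (d.del i) j) ^ p • d.Tp (m + 1) (d.del j)) by
    rw [coeff, map_sum, Finset.sum_smul]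
    simp only [map_mul, map_pow, mul_smul]]
  rw [Finset.sum_comm]
  refine Finset.sum_congr rfl fun i _ => ?_
  rw [← Finset.smul_sum, pow_sum _ _ fun j => d.smul_Tp_mem_vert _ _ _]
  congr 1
  refine Finset.sum_congr rfl fun j _ => ?_
  rw [pow_smul _ (d.Tp_mem_vert _ _), Tp_succ]

theorem phi_eq_zero (m : ℕ) (hm : d.N ≤ m) (D : Derivation ℤ A A) : d.phi m D = 0 := by
  simp only [phi, d.Tp_eq_zero m hm, smul_zero, Finset.sum_const_zero]

/-- The linear extension of a Frobenius-semilinear map does not depend on the representation of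
its argument. -/
theorem sum_smul_eq (Phi : Derivation ℤ A A → Derivation ℤ C C)
    (hadd : ∀ D E, Phi (D + E) = Phi D + Phi E)
    (hsmul : ∀ (a : A) D, Phi (a • D) = d.f a ^ p • Phi D) (D : Derivation ℤ A A) {m : ℕ}
    (a : Fin m → A) (E : Fin m → Derivation ℤ A A)
    (h : ∀ b, d.Z D b = ∑ j, a j * E j b ^ p) :
    ∑ j, d.f (a j) • Phi (E j) = ∑ i, d.f (d.Z D (d.x i)) • Phi (d.del i) := by
  have hsum : ∀ E, Phi E = ∑ i, d.f (E (d.x i)) ^ p • Phi (d.del i) := by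
    intro E
    let Phi' : Derivation ℤ A A →+ Derivation ℤ C C := AddMonoidHom.mk' Phi hadd
    have h1 : Phi E = Phi' (∑ i, E (d.x i) • d.del i) := by
      rw [← d.eq_sum]
      rfl
    rw [h1, map_sum]
    exact Finset.sum_congr rfl fun i _ => hsmul _ _
  simp only [h, map_sum, Finset.sum_smul]
  rw [Finset.sum_comm]
  refine Finset.sum_congr rfl fun j _ => ?_
  rw [hsum (E j), Finset.smul_sum]
  refine Finset.sum_congr rfl fun i _ => ?_
  rw [smul_smul, map_mul, map_pow]

theorem pow_phi_add (m : ℕ) (D E : Derivation ℤ A A) :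
    derivationPow p d.hC (d.phi m (D + E)) =
      derivationPow p d.hC (d.phi m D) + derivationPow p d.hC (d.phi m E) := by
  rw [phi_add, derivationPow_add_of_lie _ (vert_lie (d.phi_mem_vert _ _) (d.phi_mem_vert _ _))]

theorem pow_phi_smul (m : ℕ) (a : A) (D : Derivation ℤ A A) :
    derivationPow p d.hC (d.phi m (a • D)) = d.f a ^ p • derivationPow p d.hC (d.phi m D) := by
  rw [phi_smul, pow_smul _ (d.phi_mem_vert _ _)]

/-- The sum of all summands of the deformation. -/
def total (D : Derivation ℤ A A) : Derivation ℤ C C := ∑ m ∈ Finset.range d.N, d.phi m D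

/-- The deformed connection. -/
def nab (D : Derivation ℤ A A) : Derivation ℤ C C := d.can D - d.total D

theorem total_mem_vert (D : Derivation ℤ A A) : d.total D ∈ d.vert :=
  sum_mem fun _ _ => d.phi_mem_vert _ _

theorem total_add (D E : Derivation ℤ A A) : d.total (D + E) = d.total D + d.total E := by
  simp only [total, phi_add, Finset.sum_add_distrib]

theorem total_smul (a : A) (D : Derivation ℤ A A) : d.total (a • D) = d.f a • d.total D := by
  simp only [total, phi_smul, Finset.smul_sum]

/-- The coefficient of `Z D (x i)` in `total D`. -/
def core (i : Fin d.n) : Derivation ℤ C C := d.T (d.del i) + derivationPow p d.hC (d.total (d.del i))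

theorem core_mem_vert (i : Fin d.n) : d.core i ∈ d.vert :=
  add_mem (d.Tp_mem_vert 0 _) (pow_mem_vert (d.total_mem_vert _))

theorem can_lie_core (D : Derivation ℤ A A) (i : Fin d.n) : ⁅d.can D, d.core i⁆ = 0 := by
  rw [core, lie_add, d.can_lie_T, can_lie_pow _ (d.total_mem_vert _), add_zero]

theorem pow_total (D : Derivation ℤ A A) :
    derivationPow p d.hC (d.total D) =
      ∑ m ∈ Finset.range d.N, derivationPow p d.hC (d.phi m D) :=
  pow_sum _ _ fun _ => d.phi_mem_vert _ _

/-- The fixed point equation for the deformation: the summand with index zero contributes the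
`T`-part of `core`, and the recursion turns the remaining summands into `p`-th powers, which add up
to the `p`-th power of the total. -/
theorem total_eq (D : Derivation ℤ A A) :
    d.total D = ∑ i, d.f (d.Z D (d.x i)) • d.core i := by
  -- The summand with index `N` vanishes; including it leaves exactly `N` summands once the zeroth
  -- is split off.
  have h1 : d.total D = ∑ m ∈ Finset.range (d.N + 1), d.phi m D := by
    rw [Finset.sum_range_succ, d.phi_eq_zero d.N le_rfl, add_zero, total]
  rw [h1, Finset.sum_range_succ', phi_zero]
  simp only [core, smul_add, Finset.sum_add_distrib, pow_total, phi_succ, Finset.smul_sum]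
  rw [Finset.sum_comm, add_comm]

/-- The fields `core i` are horizontal for the canonical connection, so only the coefficients get
differentiated. -/
theorem can_lie_total (D E : Derivation ℤ A A) :
    ⁅d.can D, d.total E⁆ = ∑ i, d.f (D (d.Z E (d.x i))) • d.core i := by
  rw [total_eq, lie_sum]
  refine Finset.sum_congr rfl fun i _ => ?_
  rw [lie_smul_derivation, can_lie_core, smul_zero, add_zero, d.can_f]

theorem nab_add (D E : Derivation ℤ A A) : d.nab (D + E) = d.nab D + d.nab E := by
  simp only [nab, d.can_add, total_add]
  abel

theorem nab_smul (a : A) (D : Derivation ℤ A A) : d.nab (a • D) = d.f a • d.nab D := by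
  simp only [nab, d.can_smul, total_smul, smul_sub]

theorem nab_f (D : Derivation ℤ A A) (a : A) : d.nab D (d.f a) = d.f (D a) := by
  rw [nab, Derivation.sub_apply, d.can_f, vert_f (d.total_mem_vert D), sub_zero]

/-- The two mixed brackets differentiate the coefficients `Z`, and closedness (`Z_lie`) adds them up
to the total of the bracket; the vertical parts commute. -/
theorem nab_lie (D E : Derivation ℤ A A) : ⁅d.nab D, d.nab E⁆ = d.nab ⁅D, E⁆ := by
  have h1 : d.total ⁅D, E⁆ = ⁅d.can D, d.total E⁆ - ⁅d.can E, d.total D⁆ := by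
    rw [can_lie_total, can_lie_total, total_eq, ← Finset.sum_sub_distrib]
    refine Finset.sum_congr rfl fun i _ => ?_
    rw [d.Z_lie, map_sub, sub_smul]
  rw [nab, nab, nab, h1, sub_lie, lie_sub, lie_sub, d.can_lie,
    vert_lie (d.total_mem_vert D) (d.total_mem_vert E), ← lie_skew (d.total D)]
  abel

/-- The heart of the `p`-curvature computation. Jacobson's formula leaves the iterated bracket with
coefficients `D^[p - 1] (Z D (x i))`, which `Z_pow` compares with the total of the `p`-th power of
`D`. The discrepancy `∑ (D (x i)) ^ p • core i` cancels the `p`-th power of the total and leaves `T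
D`. -/
theorem nab_pow (D : Derivation ℤ A A) :
    derivationPow p d.hC (d.nab D) = d.nab (derivationPow p d.hA D) + d.T D := by
  have hit : ∀ n, (fun M => ⁅d.can D, M⁆)^[n] (-d.total D) =
      -∑ i, d.f (D^[n] (d.Z D (d.x i))) • d.core i := by
    intro n
    induction n with
    | zero => rw [Function.iterate_zero_apply, total_eq]; rfl
    | succ n ih =>
      rw [Function.iterate_succ_apply', ih, lie_neg, lie_sum]
      congr 1
      refine Finset.sum_congr rfl fun i _ => ?_
      rw [lie_smul_derivation, can_lie_core, smul_zero, add_zero, d.can_f,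
        Function.iterate_succ_apply']
  -- All iterated brackets of `can D` with the total are combinations of the `core i` with
  -- coefficients from `A`; they lie in `vert` and so commute with the total.
  have h1 := derivationPow_add_of_lie_iterate d.hC (D := d.can D) (E := -d.total D) (by
    intro n
    rw [hit]
    refine vert_lie (neg_mem (d.total_mem_vert D)) (neg_mem (sum_mem fun i _ => ?_))
    exact smul_mem_vert _ (d.core_mem_vert i))
  rw [← sub_eq_add_neg, hit, derivationPow_neg, d.can_pow] at h1
  have h2 : d.total (derivationPow p d.hA D) =
      ∑ i, d.f (D^[p - 1] (d.Z D (d.x i))) • d.core i + ∑ i, d.f (D (d.x i)) ^ p • d.core i := by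
    rw [total_eq, ← Finset.sum_add_distrib]
    refine Finset.sum_congr rfl fun i _ => ?_
    rw [d.Z_pow, map_add, map_pow, add_smul]
  have hT : d.T D = ∑ i, d.f (D (d.x i)) ^ p • d.T (d.del i) := by
    let T' : Derivation ℤ A A →+ Derivation ℤ C C := AddMonoidHom.mk' d.T d.T_add
    have h3 : d.T D = T' (∑ i, D (d.x i) • d.del i) := by
      rw [← d.eq_sum]
      rfl
    rw [h3, map_sum]
    exact Finset.sum_congr rfl fun i _ => d.T_smul _ _
  have htot : derivationPow p d.hC (d.total D) =
      ∑ i, d.f (D (d.x i)) ^ p • derivationPow p d.hC (d.total (d.del i)) := by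
    let t : Derivation ℤ A A →+ Derivation ℤ C C := AddMonoidHom.mk' d.total d.total_add
    have h3 : d.total D = t (∑ i, D (d.x i) • d.del i) := by
      rw [← d.eq_sum]
      rfl
    have h4 : d.total D = ∑ i, d.f (D (d.x i)) • d.total (d.del i) := by
      rw [h3, map_sum]
      exact Finset.sum_congr rfl fun i _ => d.total_smul _ _
    rw [h4, pow_sum _ _ fun i => smul_mem_vert _ (d.total_mem_vert _)]
    exact Finset.sum_congr rfl fun i _ => pow_smul _ (d.total_mem_vert _)
  -- Both `T` and the `p`-th power of `total` are additive and `p`-linear in `D`, so they can be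
  -- expanded in the dual basis.
  have h5 : ∑ i, d.f (D (d.x i)) ^ p • d.core i = d.T D + derivationPow p d.hC (d.total D) := by
    rw [hT, htot, ← Finset.sum_add_distrib]
    exact Finset.sum_congr rfl fun i _ => smul_add _ _ _
  rw [nab, h1, nab, h2, h5]
  abel

end DeformationChart

/-! ### Derivations along ring homomorphisms -/

section DerivationsAlong

/-- `δ` is an additive map that satisfies the Leibniz rule along the ring homomorphism `ψ`. -/
structure IsDerivationAlong {A C : Type*} [CommRing A] [CommRing C] (ψ : A →+* C) (δ : A → C) :
    Prop where
  map_add : ∀ a b, δ (a + b) = δ a + δ b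
  map_mul : ∀ a b, δ (a * b) = ψ a * δ b + ψ b * δ a

namespace IsDerivationAlong

variable {A B C : Type u} [CommRing A] [CommRing B] [CommRing C]

theorem map_zero {ψ : A →+* C} {δ : A → C} (h : IsDerivationAlong ψ δ) : δ 0 = 0 := by
  simpa using h.map_add 0 0

theorem map_one {ψ : A →+* C} {δ : A → C} (h : IsDerivationAlong ψ δ) : δ 1 = 0 := by
  simpa using h.map_mul 1 1

theorem map_pow {ψ : A →+* C} {δ : A → C} (h : IsDerivationAlong ψ δ) (a : A) (n : ℕ) :
    δ (a ^ n) = n * ψ a ^ (n - 1) * δ a := by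
  induction n with
  | zero => simp [h.map_one]
  | succ n ih =>
    rw [pow_succ, h.map_mul, ih]
    rcases n with _ | n
    · simp
    · push_cast
      rw [_root_.map_pow]
      ring

theorem map_pow_of_natCast_eq_zero {ψ : A →+* C} {δ : A → C} (h : IsDerivationAlong ψ δ) {p : ℕ}
    (hp : (p : C) = 0) (a : A) : δ (a ^ p) = 0 := by
  rw [h.map_pow, hp, zero_mul, zero_mul]

theorem of_derivation (D : Derivation ℤ C C) (ψ : A →+* C) : IsDerivationAlong ψ (D ∘ ψ) where
  map_add a b := by simp
  map_mul a b := by simp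

theorem comp_derivation (ψ : A →+* C) (D : Derivation ℤ A A) : IsDerivationAlong ψ (ψ ∘ D) where
  map_add a b := by simp
  map_mul a b := by simp

theorem zero (ψ : A →+* C) : IsDerivationAlong ψ (fun _ => 0) where
  map_add a b := by simp
  map_mul a b := by simp

/-- The ring homomorphism `a ↦ ψ a + ε δ a` to the dual numbers. -/
def toDualNumber {ψ : A →+* C} {δ : A → C} (h : IsDerivationAlong ψ δ) :
    A →+* TrivSqZeroExt C C where
  toFun a := (ψ a, δ a)
  map_one' := by
    rw [h.map_one, _root_.map_one]
    rfl
  map_zero' := by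
    rw [h.map_zero, _root_.map_zero]
    rfl
  map_add' a b := by
    rw [h.map_add, _root_.map_add]
    rfl
  map_mul' a b := by
    rw [h.map_mul, _root_.map_mul]
    refine Prod.ext rfl ?_
    change _ = ψ a • δ b + MulOpposite.op (ψ b) • δ a
    rw [op_smul_eq_smul, smul_eq_mul, smul_eq_mul]

theorem eqOn_closure {ψ : A →+* C} {δ δ' : A → C} (h : IsDerivationAlong ψ δ)
    (h' : IsDerivationAlong ψ δ') {s : Set A} (hs : Set.EqOn δ δ' s) {a : A}
    (ha : a ∈ Subring.closure s) : δ a = δ' a := by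
  induction ha using Subring.closure_induction with
  | mem a ha => exact hs ha
  | zero => rw [h.map_zero, h'.map_zero]
  | one => rw [h.map_one, h'.map_one]
  | add a b _ _ ha hb => rw [h.map_add, h'.map_add, ha, hb]
  | neg a _ ha =>
    have h1 := h.map_add a (-a)
    have h2 := h'.map_add a (-a)
    rw [add_neg_cancel, h.map_zero, ha] at h1
    rw [add_neg_cancel, h'.map_zero] at h2
    exact add_left_cancel (h1.symm.trans h2)
  | mul a b _ _ ha hb => rw [h.map_mul, h'.map_mul, ha, hb]

end IsDerivationAlong

/-- The universal property maps the pushout into the subring generated by the two images, and the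
composite with the inclusion is the identity. -/
theorem closure_eq_top_of_isPushout {A' A B C : CommRingCat.{u}} {i : A' ⟶ A} {j : A' ⟶ B}
    {f : A ⟶ C} {q : B ⟶ C} (h : IsPushout i j f q) :
    Subring.closure (Set.range f.hom ∪ Set.range q.hom) = ⊤ := by
  set K := Subring.closure (Set.range f.hom ∪ Set.range q.hom) with hK
  have hf : ∀ a, f.hom a ∈ K := fun a => Subring.subset_closure (Or.inl ⟨a, rfl⟩)
  have hq : ∀ a, q.hom a ∈ K := fun a => Subring.subset_closure (Or.inr ⟨a, rfl⟩)
  let f' : A ⟶ CommRingCat.of K := CommRingCat.ofHom (f.hom.codRestrict K hf)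
  let q' : B ⟶ CommRingCat.of K := CommRingCat.ofHom (q.hom.codRestrict K hq)
  let r : C ⟶ CommRingCat.of K := h.desc f' q' (by
    ext a
    exact congr($(h.w).hom a))
  let s : CommRingCat.of K ⟶ C := CommRingCat.ofHom K.subtype
  have e : r ≫ s = 𝟙 C := by
    refine h.hom_ext ?_ ?_
    · rw [← Category.assoc, h.inl_desc, Category.comp_id]
      rfl
    · rw [← Category.assoc, h.inr_desc, Category.comp_id]
      rfl
  refine eq_top_iff.mpr fun c _ => ?_
  have e' : (r.hom c : C) = c := congr($(e).hom c)
  rw [← e']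
  exact (r.hom c).2

theorem eq_of_isPushout {A' A B C : CommRingCat.{u}} {i : A' ⟶ A} {j : A' ⟶ B}
    {f : A ⟶ C} {q : B ⟶ C} (h : IsPushout i j f q) {C' : Type u} [CommRing C'] {ψ : C →+* C'}
    {δ δ' : C → C'} (hδ : IsDerivationAlong ψ δ) (hδ' : IsDerivationAlong ψ δ')
    (hf : ∀ a, δ (f.hom a) = δ' (f.hom a)) (hq : ∀ b, δ (q.hom b) = δ' (q.hom b)) (c : C) :
    δ c = δ' c := by
  refine hδ.eqOn_closure hδ' (s := Set.range f.hom ∪ Set.range q.hom) ?_ ?_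
  · rintro _ (⟨a, rfl⟩ | ⟨b, rfl⟩)
    exacts [hf a, hq b]
  · rw [closure_eq_top_of_isPushout h]
    trivial

/-- Derivations along a ring homomorphism are its lifts to the dual numbers, and the universal
property combines two compatible lifts into one. -/
theorem exists_derivation_of_isPushout {A' A B C : CommRingCat.{u}} {i : A' ⟶ A} {j : A' ⟶ B}
    {f : A ⟶ C} {q : B ⟶ C} (h : IsPushout i j f q) {δ : A → C} {δ' : B → C}
    (hδ : IsDerivationAlong f.hom δ) (hδ' : IsDerivationAlong q.hom δ')
    (hc : ∀ a, δ (i.hom a) = δ' (j.hom a)) :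
    ∃ E : Derivation ℤ C C, (∀ a, E (f.hom a) = δ a) ∧ ∀ b, E (q.hom b) = δ' b := by
  let F : A ⟶ CommRingCat.of (TrivSqZeroExt C C) := CommRingCat.ofHom hδ.toDualNumber
  let Q : B ⟶ CommRingCat.of (TrivSqZeroExt C C) := CommRingCat.ofHom hδ'.toDualNumber
  have hFQ : i ≫ F = j ≫ Q := by
    refine CommRingCat.hom_ext (RingHom.ext fun a => ?_)
    have h1 : f.hom (i.hom a) = q.hom (j.hom a) := congr($(h.w).hom a)
    exact TrivSqZeroExt.ext (x := (f.hom (i.hom a), δ (i.hom a)))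
      (y := (q.hom (j.hom a), δ' (j.hom a))) h1 (hc a)
  let r : C ⟶ CommRingCat.of (TrivSqZeroExt C C) := h.desc F Q hFQ
  let s : CommRingCat.of (TrivSqZeroExt C C) ⟶ C :=
    CommRingCat.ofHom (TrivSqZeroExt.fstHom ℤ C C).toRingHom
  have e : r ≫ s = 𝟙 C := by
    refine h.hom_ext ?_ ?_
    · rw [← Category.assoc, h.inl_desc, Category.comp_id]
      rfl
    · rw [← Category.assoc, h.inr_desc, Category.comp_id]
      rfl
  have e' : ∀ c, (r.hom c).fst = c := fun c => congr($(e).hom c)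
  let E : C →+ C :=
    { toFun := fun c => (r.hom c).snd
      map_zero' := by rw [map_zero]; rfl
      map_add' := fun a b => by rw [map_add]; rfl }
  refine ⟨Derivation.mk' E.toIntLinearMap fun a b => ?_, fun a => ?_, fun b => ?_⟩
  · change (r.hom (a * b)).snd = a • (r.hom b).snd + b • (r.hom a).snd
    rw [map_mul, TrivSqZeroExt.snd_mul, e', e', op_smul_eq_smul]
  · exact congr(($(h.inl_desc F Q hFQ).hom a).snd)
  · exact congr(($(h.inr_desc F Q hFQ).hom b).snd)

end DerivationsAlong

/-! ### Derivations and étale or smooth ring homomorphisms -/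

section Extension

variable {A B : Type u} [CommRing A] [CommRing B]

open TensorProduct in
-- For a formally étale extension the differentials of `B` are the base change of those of `A`.
theorem exists_derivation_extension (φ : A →+* B) (hφ : φ.FormallyEtale)
    (D : Derivation ℤ A A) : ∃ E : Derivation ℤ B B, ∀ a, E (φ a) = φ (D a) := by
  algebraize [φ]
  have : Algebra.FormallyEtale A B := hφ
  let D' : Derivation ℤ A B := (Algebra.linearMap A B).compDer D
  let l : B ⊗[A] Ω[A⁄ℤ] →ₗ[B] B := LinearMap.liftBaseChange B D'.liftKaehlerDifferential
  let e := KaehlerDifferential.tensorKaehlerEquivOfFormallyEtale ℤ A B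
  refine ⟨(l ∘ₗ e.symm.toLinearMap).compDer (KaehlerDifferential.D ℤ B), fun a => ?_⟩
  change l (e.symm (KaehlerDifferential.D ℤ B (algebraMap A B a))) = algebraMap A B (D a)
  rw [KaehlerDifferential.tensorKaehlerEquivOfFormallyEtale_symm_D_algebraMap]
  simp [l, D']

/-- The difference kills the image of `A`, hence is `A`-linear, and the relative differentials
vanish. -/
theorem derivation_ext_of_formallyUnramified (φ : A →+* B) (hφ : φ.FormallyEtale)
    {E E' : Derivation ℤ B B} (h : ∀ a, E (φ a) = E' (φ a)) : E = E' := by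
  algebraize [φ]
  have : Algebra.FormallyEtale A B := hφ
  let G : Derivation A B B := Derivation.mk'
    { toFun := fun b => (E - E') b
      map_add' := fun a b => map_add _ a b
      map_smul' := fun a b => by
        have h1 : (E - E') (algebraMap A B a) = 0 := by
          rw [Derivation.sub_apply, sub_eq_zero]
          exact h a
        rw [Algebra.smul_def, Derivation.leibniz, h1, smul_zero, add_zero, RingHom.id_apply,
          smul_eq_mul, Algebra.smul_def] }
    fun a b => (E - E').leibniz a b
  have hG : G = 0 := by
    rw [← G.liftKaehlerDifferential_comp, Subsingleton.elim G.liftKaehlerDifferential 0]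
    rfl
  ext b
  have h1 : (E - E') b = 0 := congr($hG b)
  rwa [Derivation.sub_apply, sub_eq_zero] at h1

end Extension

/-- A finite dual basis of the differentials of a ring `A`: every derivation of `A` is determined by
its values on the `x i` through `d a = ∑ i, del i a • d (x i)`. -/
structure DualBasis (p : ℕ) (A : Type u) [CommRing A] where
  n : ℕ
  x : Fin n → A
  del : Fin n → Derivation ℤ A A
  eq_sum : ∀ {C : Type u} [CommRing C] (ψ : A →+* C) (δ : A → C), (p : C) = 0 →
    IsDerivationAlong ψ δ → ∀ a, δ a = ∑ i, ψ (del i a) * δ (x i)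

open scoped KaehlerDifferential in
-- The module of differentials is finite projective and generated by finitely many `d (x i)`; a
-- splitting of the resulting surjection from a free module gives the `del i`. The elements of `R`
-- are `p`-th powers, so a derivation into a ring killed by `p` is automatically `R`-linear and
-- factors through these differentials.
theorem nonempty_dualBasis {R A : Type u} [CommRing R] [CommRing A] (φ : R →+* A) (hφ : φ.Smooth)
    {p : ℕ} (hR : ∀ r : R, ∃ s, r = s ^ p) : Nonempty (DualBasis p A) := by
  algebraize [φ]
  have : Algebra.Smooth R A := hφ
  have hfin : (Submodule.span A (Set.range (KaehlerDifferential.D R A))).FG := by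
    rw [KaehlerDifferential.span_range_derivation]
    exact Module.Finite.fg_top
  obtain ⟨s, hs, hspan⟩ := Submodule.fg_span_iff_fg_span_finset_subset _ |>.mp hfin
  let n := s.card
  let w : Fin n → Ω[A⁄R] := fun i => (s.equivFin.symm i : Ω[A⁄R])
  have hw : ∀ i, ∃ x, KaehlerDifferential.D R A x = w i := fun i => hs (s.equivFin.symm i).2
  choose x hx using hw
  let F : (Fin n → A) →ₗ[A] Ω[A⁄R] := Fintype.linearCombination A w
  have hF : Function.Surjective F := by
    rw [← LinearMap.range_eq_top, Fintype.range_linearCombination,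
      ← KaehlerDifferential.span_range_derivation, hspan]
    congr 1
    ext ω
    constructor
    · rintro ⟨i, rfl⟩
      exact (s.equivFin.symm i).2
    · intro hω
      exact ⟨s.equivFin ⟨ω, hω⟩, by simp [w]⟩
  obtain ⟨σ, hσ⟩ := F.exists_rightInverse_of_surjective (LinearMap.range_eq_top.mpr hF)
  let del : Fin n → Derivation R A A := fun i =>
    (LinearMap.proj i ∘ₗ σ).compDer (KaehlerDifferential.D R A)
  refine ⟨⟨n, x, fun i => (del i).restrictScalars ℤ, ?_⟩⟩
  intro C _ ψ δ hp hδ a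
  algebraize [ψ, ψ.comp φ]
  let d : Derivation R A C := Derivation.mk'
    { toFun := δ
      map_add' := hδ.map_add
      map_smul' := fun r a => by
        obtain ⟨s, rfl⟩ := hR r
        have h1 : δ (φ (s ^ p)) = 0 := by rw [map_pow, hδ.map_pow_of_natCast_eq_zero hp]
        rw [Algebra.smul_def, Algebra.smul_def, hδ.map_mul]
        change ψ (φ _) * _ + _ * δ (φ _) = ψ (φ _) * _
        rw [h1, mul_zero, add_zero]
        rfl }
    hδ.map_mul
  have h1 : KaehlerDifferential.D R A a = ∑ i, del i a • KaehlerDifferential.D R A (x i) := by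
    have h2 : F (σ (KaehlerDifferential.D R A a)) = KaehlerDifferential.D R A a :=
      congr($hσ _)
    rw [← h2, Fintype.linearCombination_apply]
    simp only [hx]
    rfl
  have h3 := congr(d.liftKaehlerDifferential $h1)
  rw [map_sum] at h3
  simp only [map_smul, Derivation.liftKaehlerDifferential_comp_D] at h3
  exact h3

open scoped KaehlerDifferential in
-- The differentials of a formally smooth algebra are projective, so a functional with values in `B`
-- lifts through the surjection.
theorem exists_kaehlerDifferential_lift {R A B : Type u} [CommRing R] [CommRing A] [CommRing B]
    [Algebra R A] [Algebra.FormallySmooth R A] (r : A →+* B) (hr : Function.Surjective r)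
    {δ : A → B} (hδ : IsDerivationAlong r δ) (hR : ∀ c, δ (algebraMap R A c) = 0) :
    ∃ l : Ω[A⁄R] →ₗ[A] A, ∀ a, r (l (KaehlerDifferential.D R A a)) = δ a := by
  algebraize [r, r.comp (algebraMap R A)]
  let d : Derivation R A B := Derivation.mk'
    { toFun := δ
      map_add' := hδ.map_add
      map_smul' := fun c a => by
        rw [Algebra.smul_def, Algebra.smul_def, hδ.map_mul, hR, mul_zero, add_zero]
        rfl }
    hδ.map_mul
  obtain ⟨l, hl⟩ := Module.projective_lifting_property (Algebra.linearMap A B)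
    d.liftKaehlerDifferential hr
  refine ⟨l, fun a => ?_⟩
  have h1 := congr($hl (KaehlerDifferential.D R A a))
  rw [Derivation.liftKaehlerDifferential_comp_D] at h1
  exact h1

/-! ### Restriction and gluing -/

section Gluing

variable {X : Scheme.{u}}

theorem res_res {U₁ U₂ U₃ : X.Opens} (h₁ : U₁ ≤ U₂) (h₂ : U₂ ≤ U₃) (b : Γ(X, U₃)) :
    res X h₁ (res X h₂ b) = res X (h₁.trans h₂) b := by
  change (X.presheaf.map (homOfLE h₂).op ≫ X.presheaf.map (homOfLE h₁).op).hom b = _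
  rw [← X.presheaf.map_comp]
  rfl

theorem res_self {U : X.Opens} (h : U ≤ U) (b : Γ(X, U)) : res X h b = b := by
  change (X.presheaf.map (𝟙 (op U))).hom b = b
  rw [X.presheaf.map_id]
  rfl

theorem eq_of_res_eq {U : X.Opens} {s t : Γ(X, U)}
    (h : ∀ x ∈ U, ∃ (O : X.Opens) (hO : O ≤ U), x ∈ O ∧ res X hO s = res X hO t) : s = t := by
  refine X.IsSheaf.section_ext fun x hx => ?_
  obtain ⟨O, hO, hxO, e⟩ := h x hx
  exact ⟨O, hO, hxO, e⟩

/-- The intersection of two members of the cover need not be a member, so agreement is required only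
on members around each of its points. Values are glued by the sheaf property. -/
theorem exists_glued_derivation {U : X.Opens} {ι : Type u} (O : ι → X.Opens)
    (hO : ∀ i, O i ≤ U) (hcov : ∀ x ∈ U, ∃ i, x ∈ O i)
    (E : ∀ i, Derivation ℤ Γ(X, O i) Γ(X, O i))
    (hE : ∀ i j x, x ∈ O i → x ∈ O j → ∃ l, x ∈ O l ∧ ∃ (hi : O l ≤ O i) (hj : O l ≤ O j),
      (∀ b, E l (res X hi b) = res X hi (E i b)) ∧ ∀ b, E l (res X hj b) = res X hj (E j b)) :
    ∃ E' : Derivation ℤ Γ(X, U) Γ(X, U), ∀ i b, res X (hO i) (E' b) = E i (res X (hO i) b) := by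
  have key : ∀ b : Γ(X, U), ∃ s : Γ(X, U), ∀ i, res X (hO i) s = E i (res X (hO i) b) := by
    intro b
    have hc : TopCat.Presheaf.IsCompatible X.sheaf.1 O (fun i => E i (res X (hO i) b)) := by
      intro i j
      change res X inf_le_left (E i (res X (hO i) b)) = res X inf_le_right (E j (res X (hO j) b))
      refine eq_of_res_eq fun x hx => ?_
      obtain ⟨l, hxl, hi, hj, h1, h2⟩ := hE i j x hx.1 hx.2
      refine ⟨O l, le_inf hi hj, hxl, ?_⟩
      rw [res_res, res_res, ← h1, ← h2, res_res, res_res]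
    obtain ⟨s, hs, -⟩ := X.sheaf.existsUnique_gluing' O U (fun i => homOfLE (hO i))
      (fun x hx => by
        obtain ⟨i, hi⟩ := hcov x hx
        exact TopologicalSpace.Opens.mem_iSup.mpr ⟨i, hi⟩) _ hc
    exact ⟨s, hs⟩
  choose G hG using key
  have hext : ∀ s t : Γ(X, U), (∀ i, res X (hO i) s = res X (hO i) t) → s = t := by
    intro s t h
    refine eq_of_res_eq fun x hx => ?_
    obtain ⟨i, hi⟩ := hcov x hx
    exact ⟨O i, hO i, hi, h i⟩
  let G' : Γ(X, U) →+ Γ(X, U) := AddMonoidHom.mk' G fun a b => hext _ _ fun i => by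
    rw [hG, map_add, map_add, map_add, hG, hG]
  refine ⟨Derivation.mk' G'.toIntLinearMap fun a b => hext _ _ fun i => ?_, fun i b => hG b i⟩
  change res X (hO i) (G (a * b)) = res X (hO i) (a * G b + b * G a)
  rw [hG, map_mul, Derivation.leibniz, map_add, map_mul, map_mul, hG, hG, smul_eq_mul, smul_eq_mul]

/-- Restriction between affine opens is a map on sections of the étale morphism `𝟙 X`. -/
theorem res_formallyEtale {U₁ U₂ : X.affineOpens} (h : U₁.1 ≤ U₂.1) :
    (res X h).FormallyEtale := by
  have h1 : ((𝟙 X : X ⟶ X).appLE U₂.1 U₁.1 h).hom.FormallyEtale :=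
    (Etale.etale_appLE (𝟙 X) U₂.2 U₁.2 h).formallyEtale
  have h2 : (𝟙 X : X ⟶ X).appLE U₂.1 U₁.1 h = X.presheaf.map (homOfLE h).op := by
    exact Category.id_comp _
  rwa [h2] at h1

/-- The restriction of a derivation to a smaller affine open. -/
def resDer {U₁ U₂ : X.affineOpens} (h : U₁.1 ≤ U₂.1) (D : Derivation ℤ Γ(X, U₂.1) Γ(X, U₂.1)) :
    Derivation ℤ Γ(X, U₁.1) Γ(X, U₁.1) :=
  (exists_derivation_extension (res X h) (res_formallyEtale h) D).choose

theorem resDer_res {U₁ U₂ : X.affineOpens} (h : U₁.1 ≤ U₂.1)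
    (D : Derivation ℤ Γ(X, U₂.1) Γ(X, U₂.1)) (a : Γ(X, U₂.1)) :
    resDer h D (res X h a) = res X h (D a) :=
  (exists_derivation_extension (res X h) (res_formallyEtale h) D).choose_spec a

theorem eq_resDer {U₁ U₂ : X.affineOpens} (h : U₁.1 ≤ U₂.1)
    (D : Derivation ℤ Γ(X, U₂.1) Γ(X, U₂.1)) (E : Derivation ℤ Γ(X, U₁.1) Γ(X, U₁.1))
    (hE : ∀ a, E (res X h a) = res X h (D a)) : E = resDer h D :=
  derivation_ext_of_formallyUnramified (res X h) (res_formallyEtale h) fun a => by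
    rw [hE, resDer_res]

end Gluing

/-! ### Frobenius twists over a perfect field -/

section Frobenius

variable {k : Type u} [Field k] {p : ℕ} [Fact p.Prime] [CharP k p]
  {S : Scheme.{u}} (h : S ⟶ Spec (.of k))

theorem frobSharp_projSharp (V : S.affineOpens) (b : Γ(S, V.1)) :
    frobSharp p h V (projSharp p h V b) = b ^ p := by
  have h1 : (frobTwistProj p h).app V.1 ≫
      (relFrobenius p h).appLE _ _ (le_relFrobenius_preimage p h V) =
      (absFrobenius p h).appLE V.1 V.1 le_rfl := by
    rw [Scheme.Hom.app_eq_appLE]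
    refine (Scheme.Hom.appLE_comp_appLE _ _ _ _ _ _ _).trans ?_
    simp only [relFrobenius_proj]
  have h2 : (absFrobenius p h).appLE V.1 V.1 le_rfl = (absFrobenius p h).app V.1 := by
    rw [Scheme.Hom.app_eq_appLE]
    rfl
  exact congr($(h1.trans h2).hom b)

end Frobenius

section Perfect

variable {k : Type u} [Field k] {p : ℕ} [Fact p.Prime] [CharP k p] [PerfectRing k p]

variable (k p) in
theorem exists_eq_pow_of_perfect (c : Γ(Spec (.of k), ⊤)) : ∃ s, c = s ^ p := by
  obtain ⟨s, hs⟩ := surjective_frobenius k p ((Scheme.ΓSpecIso (.of k)).hom.hom c)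
  refine ⟨(Scheme.ΓSpecIso (.of k)).inv.hom s, ?_⟩
  rw [← map_pow]
  have h1 : s ^ p = (Scheme.ΓSpecIso (.of k)).hom.hom c := hs
  rw [h1]
  exact congr($((Scheme.ΓSpecIso (.of k)).hom_inv_id.symm).hom c)

variable (p) in
/-- Over a perfect field, every derivation is a vector field. -/
def vecOf {X : Scheme.{u}} (h : X ⟶ Spec (.of k)) (U : X.Opens)
    (D : Derivation ℤ Γ(X, U) Γ(X, U)) : Vec h U :=
  ⟨D, fun c => by
    obtain ⟨s, rfl⟩ := exists_eq_pow_of_perfect k p c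
    rw [map_pow, Derivation.leibniz_pow, nsmul_eq_mul, natCast_eq_zero p h U, zero_mul]⟩

variable {S : Scheme.{u}} (h : S ⟶ Spec (.of k))

instance : IsIso (frobTwistProj p h) := by
  have h1 : IsIso (sigma k p) :=
    (ConcreteCategory.isIso_iff_bijective _).mpr (bijective_frobenius k p)
  have : IsIso (Spec.map (sigma k p)) := inferInstance
  exact (IsPullback.of_hasPullback h (Spec.map (sigma k p))).isIso_fst_of_isIso

theorem projSharp_bijective (V : S.affineOpens) : Function.Bijective (projSharp p h V) :=
  ConcreteCategory.bijective_of_isIso ((frobTwistProj p h).app V.1)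

/-- Over a perfect field `w` is an isomorphism, and transporting `D` along it provides a candidate
for the choice made in `twistVec`. -/
theorem twistVec_projSharp (V : S.affineOpens) (D : Vec h V.1) (b : Γ(S, V.1)) :
    (twistVec p h V D).1 (projSharp p h V b) = projSharp p h V (D.1 b) := by
  let e : Γ(S, V.1) ≃+* Γ(frobTwist p h, (twistOpen p h V).1) :=
    RingEquiv.ofBijective (projSharp p h V) (projSharp_bijective h V)
  have he : ∀ a, e a = projSharp p h V a := fun _ => rfl
  let D₀ : Γ(frobTwist p h, (twistOpen p h V).1) →+ Γ(frobTwist p h, (twistOpen p h V).1) :=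
    (e.toAddMonoidHom.comp D.1.toLinearMap.toAddMonoidHom).comp e.symm.toAddMonoidHom
  have hD₀ : ∀ a, D₀ a = e (D.1 (e.symm a)) := fun _ => rfl
  let D' : Derivation ℤ Γ(frobTwist p h, (twistOpen p h V).1)
      Γ(frobTwist p h, (twistOpen p h V).1) := Derivation.mk' D₀.toIntLinearMap (by
    intro a b
    change D₀ (a * b) = a * D₀ b + b * D₀ a
    rw [hD₀, hD₀, hD₀, map_mul, Derivation.leibniz, smul_eq_mul, smul_eq_mul, map_add, map_mul,
      map_mul, e.apply_symm_apply, e.apply_symm_apply])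
  refine Classical.epsilon_spec (p := fun D' : Vec (frobTwistStr p h) (twistOpen p h V).1 =>
    ∀ b, D'.1 (projSharp p h V b) = projSharp p h V (D.1 b))
    ⟨vecOf p _ _ D', fun b => ?_⟩ b
  change e (D.1 (e.symm (e b))) = e (D.1 b)
  rw [e.symm_apply_apply]

theorem nonempty_dualBasis_sections [Smooth h] (V : S.affineOpens) :
    Nonempty (DualBasis p Γ(S, V.1)) :=
  nonempty_dualBasis (constants h V.1)
    (Scheme.Hom.smooth_appLE h (isAffineOpen_top _) V.2 le_top) (exists_eq_pow_of_perfect k p)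

end Perfect

/-! ### Vector fields on the fibre product `X = Y ×_{S'} S` -/

section Square

variable {k : Type u} [Field k] {p : ℕ} [Fact p.Prime] [CharP k p]
  {S : Scheme.{u}} {h : S ⟶ Spec (.of k)} {Y X : Scheme.{u}} {g : Y ⟶ frobTwist p h}
  {π : X ⟶ Y} {f : X ⟶ S} (sq : IsPullback π f g (relFrobenius p h))
  (V : S.affineOpens) (U' : Y.affineOpens) (hU' : U'.1 ≤ g ⁻¹ᵁ (twistOpen p h V).1)

theorem isPushout_sections :
    IsPushout ((relFrobenius p h).appLE _ _ (le_relFrobenius_preimage p h V))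
      (g.appLE _ _ hU') (f.appLE _ _ (preimageOpen_le sq hU')) (π.app U'.1) := by
  have h1 : (preimageOpen sq U').1 = π ⁻¹ᵁ U'.1 ⊓ f ⁻¹ᵁ V.1 :=
    (inf_eq_left.mpr (preimageOpen_le sq hU')).symm
  have h2 := (isIso_pushoutSection_iff sq (le_relFrobenius_preimage p h V) hU' h1).mp
    (isIso_pushoutSection_of_isAffineOpen sq _ hU' h1 (twistOpen p h V).2 V.2 U'.2)
  rw [Scheme.Hom.app_eq_appLE]
  exact h2.flip

theorem derivation_ext_of_square
    {E E' : Derivation ℤ Γ(X, (preimageOpen sq U').1) Γ(X, (preimageOpen sq U').1)}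
    (h₁ : ∀ a, E ((f.appLE _ _ (preimageOpen_le sq hU')).hom a) =
      E' ((f.appLE _ _ (preimageOpen_le sq hU')).hom a))
    (h₂ : ∀ b, E ((π.app U'.1).hom b) = E' ((π.app U'.1).hom b)) : E = E' :=
  Derivation.ext (eq_of_isPushout (isPushout_sections sq V U' hU')
    (.of_derivation E (RingHom.id _)) (.of_derivation E' (RingHom.id _)) h₁ h₂)

theorem higgs_g (θ : LambdaConnection (frobTwistStr p h) g 0) (V' : (frobTwist p h).affineOpens) (hV' : U'.1 ≤ g ⁻¹ᵁ V'.1)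
    (D : Vec (frobTwistStr p h) V'.1) (a : Γ(frobTwist p h, V'.1)) :
    (θ.toFun V' U' hV' D).1 ((g.appLE _ _ hV').hom a) = 0 := by
  rw [θ.lifts, map_zero, zero_mul]

/-- The composite `w ∘ F` is the absolute Frobenius, so the `p`-th power of a function pulled back
from `S` comes from `Y`. -/
theorem pi_app_projSharp (a : Γ(S, V.1)) :
    (π.app U'.1).hom ((g.appLE _ _ hU').hom (projSharp p h V a)) =
      (f.appLE _ _ (preimageOpen_le sq hU')).hom a ^ p := by
  have h1 := congr($((isPushout_sections sq V U' hU').w).hom (projSharp p h V a))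
  refine h1.symm.trans ?_
  change (f.appLE _ _ (preimageOpen_le sq hU')).hom (frobSharp p h V (projSharp p h V a)) = _
  rw [frobSharp_projSharp, map_pow]

variable [PerfectRing k p]

/-- The two prescriptions must agree on functions from `S'`. There `v` vanishes by hypothesis, and
so does `D`: as `w` is an isomorphism, such functions become `p`-th powers on `S`. -/
theorem fibreVec_spec (D : Vec h V.1) (v : Vec (g ≫ frobTwistStr p h) U'.1)
    (hv : ∀ a, v.1 ((g.appLE _ _ hU').hom a) = 0) :
    (∀ a, (fibreVec sq V U' hU' D v).1 ((f.appLE _ _ (preimageOpen_le sq hU')).hom a) =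
      (f.appLE _ _ (preimageOpen_le sq hU')).hom (D.1 a)) ∧
    (∀ b, (fibreVec sq V U' hU' D v).1 ((π.app U'.1).hom b) = (π.app U'.1).hom (v.1 b)) := by
  refine Classical.epsilon_spec (p := fun E : Vec (f ≫ h) (preimageOpen sq U').1 =>
    (∀ a, E.1 ((f.appLE _ _ (preimageOpen_le sq hU')).hom a) =
      (f.appLE _ _ (preimageOpen_le sq hU')).hom (D.1 a)) ∧
    (∀ b, E.1 ((π.app U'.1).hom b) = (π.app U'.1).hom (v.1 b))) ?_
  obtain ⟨E, hE⟩ := exists_derivation_of_isPushout (isPushout_sections sq V U' hU')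
    (.comp_derivation _ D.1) (.comp_derivation _ v.1) (by
      intro a
      obtain ⟨a, rfl⟩ := (projSharp_bijective (p := p) h V).2 a
      have h1 : D.1 (frobSharp p h V (projSharp p h V a)) = 0 := by
        rw [frobSharp_projSharp, Derivation.leibniz_pow, nsmul_eq_mul, natCast_eq_zero p h V.1,
          zero_mul]
      rw [Function.comp_apply, Function.comp_apply, hv, map_zero]
      exact (congrArg _ h1).trans (map_zero _))
  exact ⟨vecOf p _ _ E, hE⟩

theorem nablaCan_f (D : Vec h V.1) (a : Γ(S, V.1)) :
    (nablaCan sq V U' hU' D).1 ((f.appLE _ _ (preimageOpen_le sq hU')).hom a) =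
      (f.appLE _ _ (preimageOpen_le sq hU')).hom (D.1 a) :=
  (fibreVec_spec sq V U' hU' D 0 fun _ => rfl).1 a

theorem nablaCan_pi (D : Vec h V.1) (b : Γ(Y, U'.1)) :
    (nablaCan sq V U' hU' D).1 ((π.app U'.1).hom b) = 0 :=
  ((fibreVec_spec sq V U' hU' D 0 fun _ => rfl).2 b).trans (map_zero _)

variable (θ : LambdaConnection (frobTwistStr p h) g 0)

theorem pullbackHiggs_f (D : Vec h V.1) (a : Γ(S, V.1)) :
    (pullbackHiggs sq θ V U' hU' D).1 ((f.appLE _ _ (preimageOpen_le sq hU')).hom a) = 0 :=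
  ((fibreVec_spec sq V U' hU' 0 _ (higgs_g U' θ _ hU' _)).1 a).trans (map_zero _)

theorem pullbackHiggs_pi (D : Vec h V.1) (b : Γ(Y, U'.1)) :
    (pullbackHiggs sq θ V U' hU' D).1 ((π.app U'.1).hom b) =
      (π.app U'.1).hom ((θ.toFun (twistOpen p h V) U' hU' (twistVec p h V D)).1 b) :=
  (fibreVec_spec sq V U' hU' 0 _ (higgs_g U' θ _ hU' _)).2 b

end Square

/-! ### Reduction modulo `p` of a flat algebra, and division by `p` of differentials -/

section Reduction

theorem surjective_of_isPushout {R K A B : CommRingCat.{u}} {s : R ⟶ A} {ρ : R ⟶ K} {r : A ⟶ B}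
    {t : K ⟶ B} (sq : IsPushout s ρ r t) (hρ : Function.Surjective ρ.hom) :
    Function.Surjective r.hom := by
  intro a
  have h1 : a ∈ Subring.closure (Set.range r.hom ∪ Set.range t.hom) := by
    rw [closure_eq_top_of_isPushout sq]
    trivial
  have h2 : Subring.closure (Set.range r.hom ∪ Set.range t.hom) ≤ r.hom.range := by
    rw [Subring.closure_le]
    rintro _ (⟨a, rfl⟩ | ⟨c, rfl⟩)
    · exact ⟨a, rfl⟩
    · obtain ⟨c, rfl⟩ := hρ c
      exact ⟨s.hom c, congr($(sq.w).hom c)⟩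
  exact h2 h1

/-- The universal property gives a map from `B` to `A` modulo `p` through which the quotient map of
`A` factors. -/
theorem exists_eq_mul_of_isPushout {R K A B : CommRingCat.{u}} {s : R ⟶ A} {ρ : R ⟶ K}
    {r : A ⟶ B} {t : K ⟶ B} (sq : IsPushout s ρ r t) (hρ : Function.Surjective ρ.hom) {p : ℕ}
    (hker : ∀ c, ρ.hom c = 0 → ∃ y, c = p * y) {x : A} (hx : r.hom x = 0) : ∃ y, x = p * y := by
  let I : Ideal A := Ideal.span {(p : A)}
  let q : A →+* A ⧸ I := Ideal.Quotient.mk I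
  have hqp : q p = 0 := Ideal.Quotient.eq_zero_iff_mem.mpr (Ideal.mem_span_singleton_self _)
  let κ : K →+* A ⧸ I :=
    RingHom.liftOfSurjective ρ.hom hρ ⟨q.comp s.hom, fun c hc => by
      obtain ⟨y, rfl⟩ := hker c hc
      rw [RingHom.mem_ker, map_mul, RingHom.comp_apply, map_natCast s.hom, hqp, zero_mul]⟩
  have hκ : ∀ c, κ (ρ.hom c) = q (s.hom c) := fun c =>
    RingHom.liftOfRightInverse_comp_apply _ _ _ _ _
  let d : B ⟶ CommRingCat.of (A ⧸ I) :=
    sq.desc (CommRingCat.ofHom q) (CommRingCat.ofHom κ)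
      (CommRingCat.hom_ext (RingHom.ext fun c => (hκ c).symm))
  have h1 : d.hom (r.hom x) = q x := congr($(sq.inl_desc _ _ _).hom x)
  rw [hx, map_zero] at h1
  exact Ideal.mem_span_singleton.mp (Ideal.Quotient.eq_zero_iff_mem.mp h1.symm)

/-- By the equational criterion for flatness, the relation `p x = 0` comes from elements of `R` that
are killed by `p`. -/
theorem exists_eq_mul_of_flat {R A : Type*} [CommRing R] [CommRing A] [Algebra R A]
    [Module.Flat R A] {p : ℕ} (hR : ∀ c : R, p * c = 0 → ∃ y, c = p * y) {x : A}
    (hx : p * x = 0) : ∃ y, x = p * y := by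
  have h1 : (p : R) • x = 0 := by rw [Algebra.smul_def, map_natCast, hx]
  obtain ⟨n, a, y, hxy, ha⟩ := Module.Flat.isTrivialRelation_of_sum_smul_eq_zero
    (f := fun _ : Fin 1 => (p : R)) (x := fun _ => x) ((Fin.sum_univ_one _).trans h1)
  have h2 : ∀ j, ∃ z, a 0 j • y j = p * z := fun j => by
    have h3 := ha j
    rw [Fin.sum_univ_one] at h3
    obtain ⟨b, hb⟩ := hR _ h3
    exact ⟨b • y j, by rw [hb, Algebra.smul_def, Algebra.smul_def, map_mul, map_natCast, mul_assoc]⟩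
  choose z hz using h2
  refine ⟨∑ j, z j, (hxy 0).trans ?_⟩
  rw [Finset.mul_sum]
  exact Finset.sum_congr rfl fun j _ => hz j

/-- This is the division by `p` in `dF̃/p`, for a lift of Frobenius with value `x ^ p + p * c`. -/
theorem derivation_pow_add {R A M : Type*} [CommRing R] [CommRing A] [Algebra R A]
    [AddCommGroup M] [Module A M] [Module R M] (d : Derivation R A M) (p : ℕ) (x c : A) :
    d (x ^ p + p * c) = (p : A) • (x ^ (p - 1) • d x + d c) := by
  rw [map_add, Derivation.leibniz_pow, Derivation.leibniz, Derivation.map_natCast, smul_zero,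
    add_zero, ← Nat.cast_smul_eq_nsmul A, smul_add]

theorem map_derivation_pow_add {R A M : Type*} [CommRing R] [CommRing A] [Algebra R A]
    [AddCommGroup M] [Module A M] [Module R M] (d : Derivation R A M) (l : M →ₗ[A] A) (p : ℕ)
    (x c : A) : p * (l (x ^ (p - 1) • d x + d c)) = l (d (x ^ p + p * c)) := by
  rw [derivation_pow_add, map_smul, smul_eq_mul]

/-- The reduction modulo `p` of `ω` depends only on `p • ω = d (Φ x)`, and this only on the
reduction of `x`, when `Φ` is a lift of Frobenius. -/
theorem sum_eq_of_derivation_eq_smul {R A B M : Type*} [CommRing R] [CommRing A] [CommRing B]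
    [Algebra R A] [AddCommGroup M] [Module A M] [Module R M] {d : Derivation R A M}
    {l : M →ₗ[A] A} {r : A →+* B} {D : Derivation ℤ B B} (hl : ∀ a, r (l (d a)) = D (r a)) {p : ℕ}
    (h0 : (p : B) = 0) (hker : ∀ x : A, r x = 0 → ∃ y, x = p * y) (htor : ∀ x : A, p * x = 0 → r x = 0)
    {Φ : A →+* A} (hΦ : ∀ x, r (Φ x) = r x ^ p) {x x' z : A} (hx : r x' = r x)
    {m : ℕ} {v y : Fin m → A} (hd : d (Φ x') = (p : A) • ∑ j, v j • d (y j))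
    (hz : p * z = l (d (Φ x))) : ∑ j, r (v j) * D (r (y j)) = r z := by
  -- Two lifts differ by `p * e`. The error `d (Φ e)` that remains after division by `p` reduces to
  -- the derivative of a `p`-th power, which is zero.
  obtain ⟨e, he⟩ := hker (x' - x) (by rw [map_sub, hx, sub_self])
  obtain rfl : x' = x + p * e := by rw [← he, add_sub_cancel]
  rw [map_add, map_mul, map_natCast, map_add, Derivation.leibniz,
    Derivation.map_natCast, smul_zero, add_zero] at hd
  have hd' := congr(l $hd)
  simp only [map_add, map_smul, map_sum, smul_eq_mul] at hd'
  rw [← hz, ← mul_add, ← sub_eq_zero, ← mul_sub] at hd'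
  have h1 := htor _ hd'
  rw [map_sub, map_add, hl, hΦ, Derivation.leibniz_pow, ← Nat.cast_smul_eq_nsmul B, h0, zero_smul,
    add_zero, map_sum, sub_eq_zero] at h1
  rw [h1]
  refine Finset.sum_congr rfl fun j _ => ?_
  rw [map_mul, hl]

end Reduction

/-! ### Witt vectors of length two over a perfect field -/

section WittTwo

variable {k : Type u} [Field k] {p : ℕ} [hp : Fact p.Prime] [CharP k p] [PerfectRing k p]

/-- The kernel of the reduction is the image of Verschiebung. Over a perfect field Frobenius is
surjective on Witt vectors, and `V F = p`. -/
theorem exists_eq_mul_of_w2Red_eq_zero {x : W2 k p} (hx : w2Red k p x = 0) :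
    ∃ y, x = p * y := by
  obtain ⟨x, rfl⟩ := WittVector.truncate_surjective p 2 k x
  rw [w2Red_truncate] at hx
  obtain ⟨y, rfl⟩ : ∃ y, x = WittVector.verschiebung^[1] y :=
    ⟨_, WittVector.eq_iterate_verschiebung (n := 1) fun i hi => by
      rw [Nat.lt_one_iff.mp hi, hx]⟩
  obtain ⟨z, rfl⟩ := (WittVector.frobenius_bijective p k).2 y
  refine ⟨WittVector.truncate 2 z, ?_⟩
  rw [Function.iterate_one, WittVector.verschiebung_frobenius, map_mul, map_natCast, mul_comm]

omit [PerfectRing k p] in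
-- The second component of `p * x` is the `p`-th power of the first component of `x`.
theorem w2Red_eq_zero_of_mul_eq_zero {x : W2 k p} (hx : p * x = 0) : w2Red k p x = 0 := by
  obtain ⟨x, rfl⟩ := WittVector.truncate_surjective p 2 k x
  rw [← map_natCast (WittVector.truncate (p := p) (R := k) 2), ← map_mul] at hx
  have h1 := (WittVector.mem_ker_truncate (p := p) 2 _).mp hx 1 (by norm_num)
  rw [mul_comm, WittVector.mul_charP_coeff_succ] at h1
  rw [w2Red_truncate]
  exact pow_eq_zero_iff hp.out.ne_zero |>.mp h1

theorem w2Sigma_bijective : Function.Bijective (w2Sigma k p) := by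
  constructor
  · rw [injective_iff_map_eq_zero]
    intro x hx
    obtain ⟨x, rfl⟩ := WittVector.truncate_surjective p 2 k x
    rw [w2Sigma_truncate] at hx
    refine (WittVector.mem_ker_truncate (p := p) (R := k) 2 x).mpr fun i hi => ?_
    have h1 := (WittVector.mem_ker_truncate (p := p) 2 _).mp hx i hi
    rw [WittVector.map_coeff] at h1
    exact pow_eq_zero_iff hp.out.ne_zero |>.mp h1
  · intro x
    obtain ⟨x, rfl⟩ := WittVector.truncate_surjective p 2 k x
    obtain ⟨y, rfl⟩ := (WittVector.frobenius_bijective p k).2 x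
    refine ⟨WittVector.truncate 2 y, ?_⟩
    rw [w2Sigma_truncate, WittVector.frobenius_eq_map_frobenius]

variable (k p) in
/-- The reduction `W₂(k) → k` on global sections. -/
abbrev specRedSharp : Γ(Spec (.of (W2 k p)), ⊤) →+* Γ(Spec (.of k), ⊤) :=
  ((specRed k p).appLE ⊤ ⊤ le_top).hom

omit [CharP k p] [PerfectRing k p] in
theorem specRedSharp_apply (c : Γ(Spec (.of (W2 k p)), ⊤)) :
    (Scheme.ΓSpecIso (.of k)).hom.hom (specRedSharp k p c) =
      w2Red k p ((Scheme.ΓSpecIso (.of (W2 k p))).hom.hom c) := by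
  have h1 := Scheme.ΓSpecIso_naturality (CommRingCat.ofHom (w2Red k p))
  have h2 : (specRed k p).appLE ⊤ ⊤ le_top = (specRed k p).appTop :=
    (Scheme.Hom.app_eq_appLE (f := specRed k p) (U := ⊤)).symm
  have h3 := congr($(h1).hom c)
  rw [← h2] at h3
  exact h3

theorem ΓSpecIso_injective (R : CommRingCat.{u}) :
    Function.Injective (Scheme.ΓSpecIso R).hom.hom :=
  (ConcreteCategory.bijective_of_isIso (Scheme.ΓSpecIso R).hom).1

theorem ΓSpecIso_surjective (R : CommRingCat.{u}) :
    Function.Surjective (Scheme.ΓSpecIso R).hom.hom :=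
  (ConcreteCategory.bijective_of_isIso (Scheme.ΓSpecIso R).hom).2

omit [CharP k p] [PerfectRing k p] in
theorem specRedSharp_surjective : Function.Surjective (specRedSharp k p) := by
  intro c
  obtain ⟨x, hx⟩ := w2Red_surjective k p ((Scheme.ΓSpecIso (.of k)).hom.hom c)
  obtain ⟨y, rfl⟩ := ΓSpecIso_surjective (.of (W2 k p)) x
  refine ⟨y, ΓSpecIso_injective _ ?_⟩
  rw [specRedSharp_apply, hx]

theorem exists_eq_mul_of_specRedSharp_eq_zero {c : Γ(Spec (.of (W2 k p)), ⊤)}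
    (hc : specRedSharp k p c = 0) : ∃ y, c = p * y := by
  have h1 := specRedSharp_apply c
  rw [hc, map_zero] at h1
  obtain ⟨y, hy⟩ := exists_eq_mul_of_w2Red_eq_zero h1.symm
  obtain ⟨z, rfl⟩ := ΓSpecIso_surjective (.of (W2 k p)) y
  refine ⟨z, ΓSpecIso_injective _ ?_⟩
  rw [hy, map_mul, map_natCast]

theorem exists_eq_mul_of_mul_eq_zero {c : Γ(Spec (.of (W2 k p)), ⊤)}
    (hc : p * c = 0) : ∃ y, c = p * y := by
  refine exists_eq_mul_of_specRedSharp_eq_zero (ΓSpecIso_injective _ ?_)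
  rw [specRedSharp_apply, map_zero]
  refine w2Red_eq_zero_of_mul_eq_zero ?_
  have h1 := congr((Scheme.ΓSpecIso (.of (W2 k p))).hom.hom $hc)
  rw [map_mul, map_natCast, map_zero] at h1
  exact h1

end WittTwo

/-! ### The dual of `dF̃ / p` -/

namespace FrobeniusLifting

variable {k : Type u} [Field k] {p : ℕ} [hp : Fact p.Prime] [CharP k p]
  {S : Scheme.{u}} {h : S ⟶ Spec (.of k)} (L : FrobeniusLifting p h)

theorem isPushout_red (W : L.St.affineOpens) :
    IsPushout (L.str.appLE ⊤ W.1 le_top) ((specRed k p).appLE ⊤ ⊤ le_top)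
      (L.i.app W.1) (h.appLE ⊤ (L.red W).1 le_top) := by
  have h1 : (L.red W).1 = L.i ⁻¹ᵁ W.1 ⊓ h ⁻¹ᵁ ⊤ := (inf_eq_left.mpr le_top).symm
  have h2 := (isIso_pushoutSection_iff L.isPullback le_top le_top h1).mp
    (isIso_pushoutSection_of_isAffineOpen L.isPullback le_top le_top h1
      (isAffineOpen_top _) (isAffineOpen_top _) W.2)
  rw [Scheme.Hom.app_eq_appLE]
  exact h2

theorem twistIncl_appLE (W : L.St.affineOpens) (x : Γ(L.St, W.1)) :
    ((twistIncl p L.isPullback.w).appLE _ _ (L.twistOpen_le W)).hom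
      (((w2TwistProj p L.str).app W.1).hom x) = projSharp p h (L.red W) (L.redSharp W x) := by
  have h1 : (w2TwistProj p L.str).app W.1 ≫
      (twistIncl p L.isPullback.w).appLE (L.twistLift W) _ (L.twistOpen_le W) =
      L.i.app W.1 ≫ (frobTwistProj p h).app (L.red W).1 := by
    rw [Scheme.Hom.app_eq_appLE, Scheme.Hom.app_eq_appLE, Scheme.Hom.app_eq_appLE]
    refine (Scheme.Hom.appLE_comp_appLE _ _ _ _ _ _ _).trans ?_
    refine Eq.trans ?_ (Scheme.Hom.appLE_comp_appLE _ _ _ _ _ _ _).symm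
    simp only [twistIncl_proj]
  exact congr($(h1).hom x)

/-- The lifting of Frobenius, as an endomorphism of `Γ(S̃, W)`. -/
def frobLift (W : L.St.affineOpens) : Γ(L.St, W.1) →+* Γ(L.St, W.1) :=
  ((L.Ft ≫ w2TwistProj p L.str).appLE W.1 W.1 (L.le_Ft_preimage W)).hom

theorem frobLift_apply (W : L.St.affineOpens) (x : Γ(L.St, W.1)) :
    L.frobLift W x = (L.Ft.appLE _ _ (L.le_Ft_preimage W)).hom
      (((w2TwistProj p L.str).app W.1).hom x) := by
  have h1 : (w2TwistProj p L.str).app W.1 ≫ L.Ft.appLE (L.twistLift W) _ (L.le_Ft_preimage W) =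
      (L.Ft ≫ w2TwistProj p L.str).appLE W.1 W.1 (L.le_Ft_preimage W) := by
    rw [Scheme.Hom.app_eq_appLE]
    exact Scheme.Hom.appLE_comp_appLE _ _ _ _ _ _ _
  exact congr($(h1).hom x).symm

theorem redSharp_frobLift (W : L.St.affineOpens) (x : Γ(L.St, W.1)) :
    L.redSharp W (L.frobLift W x) = L.redSharp W x ^ p := by
  have e : L.i ≫ L.Ft ≫ w2TwistProj p L.str = absFrobenius p h ≫ L.i := by
    rw [← Category.assoc, L.i_Ft, Category.assoc, twistIncl_proj, ← Category.assoc,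
      relFrobenius_proj]
  have h1 : (L.Ft ≫ w2TwistProj p L.str).appLE W.1 W.1 (L.le_Ft_preimage W) ≫ L.i.app W.1 =
      L.i.app W.1 ≫ (absFrobenius p h).app (L.red W).1 := by
    rw [Scheme.Hom.app_eq_appLE, Scheme.Hom.app_eq_appLE]
    refine (Scheme.Hom.appLE_comp_appLE _ _ _ _ _ _ _).trans ?_
    refine Eq.trans ?_ (Scheme.Hom.appLE_comp_appLE _ _ _ _ _ _ _).symm
    simp only [e]
  exact congr($(h1).hom x)

theorem redSharp_res {W₁ W₂ : L.St.affineOpens} (hW : W₁.1 ≤ W₂.1)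
    (hV : (L.red W₁).1 ≤ (L.red W₂).1) (x : Γ(L.St, W₂.1)) :
    L.redSharp W₁ (res L.St hW x) = res S hV (L.redSharp W₂ x) := by
  have h1 : L.St.presheaf.map (homOfLE hW).op ≫ L.i.app W₁.1 =
      L.i.app W₂.1 ≫ S.presheaf.map (homOfLE hV).op := L.i.naturality (homOfLE hW).op
  exact congr($(h1).hom x)

theorem frobLift_res {W₁ W₂ : L.St.affineOpens} (hW : W₁.1 ≤ W₂.1) (x : Γ(L.St, W₂.1)) :
    L.frobLift W₁ (res L.St hW x) = res L.St hW (L.frobLift W₂ x) := by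
  have h1 : L.St.presheaf.map (homOfLE hW).op ≫
      (L.Ft ≫ w2TwistProj p L.str).appLE W₁.1 W₁.1 (L.le_Ft_preimage W₁) =
      (L.Ft ≫ w2TwistProj p L.str).appLE W₂.1 W₂.1 (L.le_Ft_preimage W₂) ≫
        L.St.presheaf.map (homOfLE hW).op := by
    exact (Scheme.Hom.map_appLE ..).trans (Scheme.Hom.appLE_map ..).symm
  exact congr($(h1).hom x)

variable [PerfectRing k p]

omit [PerfectRing k p] in
theorem redSharp_surjective (W : L.St.affineOpens) : Function.Surjective (L.redSharp W) :=
  surjective_of_isPushout (L.isPushout_red W) specRedSharp_surjective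

theorem exists_eq_mul_of_redSharp_eq_zero (W : L.St.affineOpens) {x : Γ(L.St, W.1)}
    (hx : L.redSharp W x = 0) : ∃ y, x = p * y :=
  exists_eq_mul_of_isPushout (L.isPushout_red W) specRedSharp_surjective
    (fun _ => exists_eq_mul_of_specRedSharp_eq_zero) hx

/-- Smoothness makes the sections of `S̃` flat over `W₂(k)`, where every element killed by `p` is a
multiple of `p`. -/
theorem redSharp_eq_zero_of_mul_eq_zero (W : L.St.affineOpens) {x : Γ(L.St, W.1)}
    (hx : p * x = 0) : L.redSharp W x = 0 := by
  have hs : (L.str.appLE ⊤ W.1 le_top).hom.Smooth :=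
    have := L.smooth
    Scheme.Hom.smooth_appLE L.str (isAffineOpen_top _) W.2 le_top
  let alg : Algebra Γ(Spec (.of (W2 k p)), ⊤) Γ(L.St, W.1) :=
    (L.str.appLE ⊤ W.1 le_top).hom.toAlgebra
  have hflat : Module.Flat Γ(Spec (.of (W2 k p)), ⊤) Γ(L.St, W.1) := hs.flat
  obtain ⟨y, rfl⟩ := exists_eq_mul_of_flat
    (fun _ => exists_eq_mul_of_mul_eq_zero (k := k)) hx
  rw [map_mul, map_natCast, natCast_eq_zero p h, zero_mul]

instance : IsIso (w2TwistProj p L.str) := by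
  have h1 : IsIso (CommRingCat.ofHom (w2Sigma k p)) :=
    (ConcreteCategory.isIso_iff_bijective _).mpr w2Sigma_bijective
  have : IsIso (Spec.map (CommRingCat.ofHom (w2Sigma k p))) := inferInstance
  exact (IsPullback.of_hasPullback L.str
    (Spec.map (CommRingCat.ofHom (w2Sigma k p)))).isIso_fst_of_isIso

theorem w2TwistProj_app_surjective (W : L.St.affineOpens) :
    Function.Surjective ((w2TwistProj p L.str).app W.1).hom :=
  (ConcreteCategory.bijective_of_isIso ((w2TwistProj p L.str).app W.1)).2

theorem exists_frobLift_eq (W : L.St.affineOpens) (x : Γ(L.St, W.1)) :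
    ∃ c, L.frobLift W x = x ^ p + p * c := by
  obtain ⟨c, hc⟩ := L.exists_eq_mul_of_redSharp_eq_zero W (x := L.frobLift W x - x ^ p) (by
    rw [map_sub, redSharp_frobLift, map_pow, sub_self])
  exact ⟨c, by rw [← hc, add_sub_cancel]⟩

omit [PerfectRing k p] in
/-- A functional on the differentials of `S̃` that lifts the vector field `D`. -/
theorem exists_lift (W : L.St.affineOpens) (D : Vec h (L.red W).1) :
    letI : Algebra Γ(Spec (.of (W2 k p)), ⊤) Γ(L.St, W.1) :=
      (L.str.appLE ⊤ W.1 le_top).hom.toAlgebra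
    ∃ l : Ω[Γ(L.St, W.1)⁄Γ(Spec (.of (W2 k p)), ⊤)] →ₗ[Γ(L.St, W.1)] Γ(L.St, W.1),
      ∀ a, L.redSharp W (l (KaehlerDifferential.D Γ(Spec (.of (W2 k p)), ⊤) Γ(L.St, W.1) a)) =
        D.1 (L.redSharp W a) := by
  have hs : (L.str.appLE ⊤ W.1 le_top).hom.Smooth :=
    have := L.smooth
    Scheme.Hom.smooth_appLE L.str (isAffineOpen_top _) W.2 le_top
  let alg : Algebra Γ(Spec (.of (W2 k p)), ⊤) Γ(L.St, W.1) :=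
    (L.str.appLE ⊤ W.1 le_top).hom.toAlgebra
  have hfs : Algebra.Smooth Γ(Spec (.of (W2 k p)), ⊤) Γ(L.St, W.1) := hs
  refine exists_kaehlerDifferential_lift (L.redSharp W) (L.redSharp_surjective W)
    (.of_derivation D.1 (L.redSharp W)) fun c => ?_
  have h1 : L.redSharp W ((L.str.appLE ⊤ W.1 le_top).hom c) =
      constants h _ (specRedSharp k p c) := congr($((L.isPushout_red W).w).hom c)
  exact (congrArg D.1 h1).trans (D.2 _)

/-- The value of a lift of `D` on `d(F̃^♯ x)`, divided by `p`, reduces to the pairing of `D` with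
`dF̃ / p`. -/
theorem IsDivFrobPairing.eq_redSharp {W : L.St.affineOpens} {D : Vec h (L.red W).1}
    {x z : Γ(L.St, W.1)} {a : Γ(S, (L.red W).1)}
    (ha : L.IsDivFrobPairing W D (projSharp p h (L.red W) (L.redSharp W x)) a) :
    letI : Algebra Γ(Spec (.of (W2 k p)), ⊤) Γ(L.St, W.1) :=
      (L.str.appLE ⊤ W.1 le_top).hom.toAlgebra
    ∀ l : Ω[Γ(L.St, W.1)⁄Γ(Spec (.of (W2 k p)), ⊤)] →ₗ[Γ(L.St, W.1)] Γ(L.St, W.1),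
      (∀ a, L.redSharp W (l (KaehlerDifferential.D Γ(Spec (.of (W2 k p)), ⊤) Γ(L.St, W.1) a)) =
        D.1 (L.redSharp W a)) →
      p * z = l (KaehlerDifferential.D Γ(Spec (.of (W2 k p)), ⊤) Γ(L.St, W.1) (L.frobLift W x)) →
      a = L.redSharp W z := by
  intro l hl hz
  let alg : Algebra Γ(Spec (.of (W2 k p)), ⊤) Γ(L.St, W.1) :=
    (L.str.appLE ⊤ W.1 le_top).hom.toAlgebra
  obtain ⟨bt, m, v, y, hbt, hd, rfl⟩ := ha
  obtain ⟨x', rfl⟩ := L.w2TwistProj_app_surjective W bt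
  rw [twistIncl_appLE] at hbt
  rw [← frobLift_apply] at hd
  exact sum_eq_of_derivation_eq_smul hl (natCast_eq_zero p h _)
    (fun _ => L.exists_eq_mul_of_redSharp_eq_zero W)
    (fun _ => L.redSharp_eq_zero_of_mul_eq_zero W) (L.redSharp_frobLift W)
    ((projSharp_bijective h (L.red W)).1 hbt) hd hz

omit [PerfectRing k p] in
theorem isDivFrobPairing_of_frobLift_eq (W : L.St.affineOpens) (D : Vec h (L.red W).1)
    {x c : Γ(L.St, W.1)} (hc : L.frobLift W x = x ^ p + p * c) :
    L.IsDivFrobPairing W D (projSharp p h (L.red W) (L.redSharp W x))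
      (L.redSharp W x ^ (p - 1) * D.1 (L.redSharp W x) + D.1 (L.redSharp W c)) := by
  let alg : Algebra Γ(Spec (.of (W2 k p)), ⊤) Γ(L.St, W.1) :=
    (L.str.appLE ⊤ W.1 le_top).hom.toAlgebra
  -- The chosen form is `x ^ (p - 1) dx + dc`, whose multiple by `p` is `d (x ^ p + p * c)`.
  refine ⟨((w2TwistProj p L.str).app W.1).hom x, 2, ![x ^ (p - 1), 1], ![x, c],
    L.twistIncl_appLE W x, ?_, ?_⟩
  · rw [← frobLift_apply, hc, Fin.sum_univ_two]
    simp only [Matrix.cons_val_zero, Matrix.cons_val_one, one_smul]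
    exact derivation_pow_add _ p x c
  · rw [Fin.sum_univ_two]
    simp

theorem isDivFrobPairing_zeta (W : L.St.affineOpens) (D : Vec h (L.red W).1)
    (x : Γ(L.St, W.1)) :
    L.IsDivFrobPairing W D (projSharp p h (L.red W) (L.redSharp W x))
      (L.zeta W D (projSharp p h (L.red W) (L.redSharp W x))) := by
  obtain ⟨c, hc⟩ := L.exists_frobLift_eq W x
  exact Classical.epsilon_spec
    (p := L.IsDivFrobPairing W D (projSharp p h (L.red W) (L.redSharp W x)))
    ⟨_, L.isDivFrobPairing_of_frobLift_eq W D hc⟩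

/-- `zeta` is a choice among the values allowed by `IsDivFrobPairing`. That relation determines its
value: the chosen one and the explicit one are both the reduction of the same functional on
differentials, divided by `p`. -/
theorem zeta_eq (W : L.St.affineOpens) (D : Vec h (L.red W).1)
    {x c : Γ(L.St, W.1)} (hc : L.frobLift W x = x ^ p + p * c) :
    L.zeta W D (projSharp p h (L.red W) (L.redSharp W x)) =
      L.redSharp W x ^ (p - 1) * D.1 (L.redSharp W x) + D.1 (L.redSharp W c) := by
  obtain ⟨l, hl⟩ := L.exists_lift W D
  let alg : Algebra Γ(Spec (.of (W2 k p)), ⊤) Γ(L.St, W.1) :=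
    (L.str.appLE ⊤ W.1 le_top).hom.toAlgebra
  have h1 : p * (l (x ^ (p - 1) • KaehlerDifferential.D Γ(Spec (.of (W2 k p)), ⊤) Γ(L.St, W.1) x +
      KaehlerDifferential.D Γ(Spec (.of (W2 k p)), ⊤) Γ(L.St, W.1) c)) =
      l (KaehlerDifferential.D Γ(Spec (.of (W2 k p)), ⊤) Γ(L.St, W.1) (L.frobLift W x)) := by
    rw [hc]
    exact map_derivation_pow_add _ l p x c
  exact ((L.isDivFrobPairing_zeta W D x).eq_redSharp L l hl h1).trans
    ((L.isDivFrobPairing_of_frobLift_eq W D hc).eq_redSharp L l hl h1).symm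

/-- The map `a ↦ ⟨D, (dF̃/p)(d(w^♯ a))⟩` for a derivation `D` of `Γ(S, V)`. -/
def zetaDer (W : L.St.affineOpens) (D : Derivation ℤ Γ(S, (L.red W).1) Γ(S, (L.red W).1))
    (a : Γ(S, (L.red W).1)) : Γ(S, (L.red W).1) :=
  L.zeta W (vecOf p h _ D) (projSharp p h (L.red W) a)

/-- The functions `x` and `c` do not depend on `D`, so additivity, linearity, and the bracket and
`p`-th power identities for `zetaDer` become computations with one explicit formula. -/
theorem exists_zetaDer_eq (W : L.St.affineOpens) (a : Γ(S, (L.red W).1)) :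
    ∃ x c, L.redSharp W x = a ∧ L.frobLift W x = x ^ p + p * c ∧
      ∀ D, L.zetaDer W D a = a ^ (p - 1) * D a + D (L.redSharp W c) := by
  obtain ⟨x, rfl⟩ := L.redSharp_surjective W a
  obtain ⟨c, hc⟩ := L.exists_frobLift_eq W x
  exact ⟨x, c, rfl, hc, fun D => L.zeta_eq W (vecOf p h _ D) hc⟩

/-- In the explicit formula the correction `c` of a sum or product is unwieldy. The characterization
by `p * z = l (d (Φ x))` gives both rules directly, since `Φ` is a ring homomorphism reducing to
Frobenius. -/
theorem isDerivationAlong_zetaDer (W : L.St.affineOpens)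
    (D : Derivation ℤ Γ(S, (L.red W).1) Γ(S, (L.red W).1)) :
    IsDerivationAlong (frobRingHom _ p (natCast_eq_zero p h (L.red W).1)) (L.zetaDer W D) := by
  obtain ⟨l, hl⟩ := L.exists_lift W (vecOf p h _ D)
  let alg : Algebra Γ(Spec (.of (W2 k p)), ⊤) Γ(L.St, W.1) :=
    (L.str.appLE ⊤ W.1 le_top).hom.toAlgebra
  let dd := KaehlerDifferential.D Γ(Spec (.of (W2 k p)), ⊤) Γ(L.St, W.1)
  have key : ∀ x, ∃ z, p * z = l (dd (L.frobLift W x)) := by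
    intro x
    obtain ⟨c, hc⟩ := L.exists_frobLift_eq W x
    refine ⟨l (x ^ (p - 1) • dd x + dd c), ?_⟩
    rw [hc]
    exact map_derivation_pow_add _ l p x c
  have hz : ∀ x z, p * z = l (dd (L.frobLift W x)) →
      L.zetaDer W D (L.redSharp W x) = L.redSharp W z := fun x z hxz =>
    (L.isDivFrobPairing_zeta W (vecOf p h _ D) x).eq_redSharp L l hl hxz
  constructor
  · intro a b
    obtain ⟨x, rfl⟩ := L.redSharp_surjective W a
    obtain ⟨y, rfl⟩ := L.redSharp_surjective W b
    obtain ⟨z, hxz⟩ := key x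
    obtain ⟨z', hyz⟩ := key y
    rw [← map_add, hz x z hxz, hz y z' hyz, hz (x + y) (z + z'), map_add]
    rw [mul_add, hxz, hyz, map_add, map_add, map_add]
  · intro a b
    obtain ⟨x, rfl⟩ := L.redSharp_surjective W a
    obtain ⟨y, rfl⟩ := L.redSharp_surjective W b
    obtain ⟨z, hxz⟩ := key x
    obtain ⟨z', hyz⟩ := key y
    rw [← map_mul, hz x z hxz, hz y z' hyz,
      hz (x * y) (L.frobLift W x * z' + L.frobLift W y * z)]
    · rw [map_add, map_mul, map_mul, redSharp_frobLift, redSharp_frobLift]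
      rfl
    · rw [map_mul, Derivation.leibniz, map_add, map_smul, map_smul, ← hxz, ← hyz, smul_eq_mul,
        smul_eq_mul]
      ring

theorem zetaDer_add (W : L.St.affineOpens)
    (D E : Derivation ℤ Γ(S, (L.red W).1) Γ(S, (L.red W).1)) (a : Γ(S, (L.red W).1)) :
    L.zetaDer W (D + E) a = L.zetaDer W D a + L.zetaDer W E a := by
  obtain ⟨x, c, -, -, hD⟩ := L.exists_zetaDer_eq W a
  rw [hD, hD, hD, Derivation.add_apply, Derivation.add_apply]
  ring

theorem zetaDer_smul (W : L.St.affineOpens) (b : Γ(S, (L.red W).1))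
    (D : Derivation ℤ Γ(S, (L.red W).1) Γ(S, (L.red W).1)) (a : Γ(S, (L.red W).1)) :
    L.zetaDer W (b • D) a = b * L.zetaDer W D a := by
  obtain ⟨x, c, -, -, hD⟩ := L.exists_zetaDer_eq W a
  rw [hD, hD, Derivation.smul_apply, Derivation.smul_apply, smul_eq_mul, smul_eq_mul]
  ring

/-- The form `a ^ (p - 1) da + dc` is closed. -/
theorem zetaDer_lie (W : L.St.affineOpens)
    (D E : Derivation ℤ Γ(S, (L.red W).1) Γ(S, (L.red W).1)) (a : Γ(S, (L.red W).1)) :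
    L.zetaDer W ⁅D, E⁆ a = D (L.zetaDer W E a) - E (L.zetaDer W D a) := by
  obtain ⟨x, c, -, -, hD⟩ := L.exists_zetaDer_eq W a
  rw [hD, hD, hD, Derivation.commutator_apply, Derivation.commutator_apply, map_add, map_add,
    Derivation.leibniz, Derivation.leibniz, Derivation.leibniz_pow, Derivation.leibniz_pow]
  simp only [smul_eq_mul, nsmul_eq_mul]
  ring

/-- Katz's formula handles `a ^ (p - 1) da`, and the exact part `dc` contributes equally to both
sides. -/
theorem zetaDer_pow [IsIntegral S] (W : L.St.affineOpens)
    (D : Derivation ℤ Γ(S, (L.red W).1) Γ(S, (L.red W).1)) (a : Γ(S, (L.red W).1)) :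
    L.zetaDer W (derivationPow p (natCast_eq_zero p h _) D) a =
      D^[p - 1] (L.zetaDer W D a) + D a ^ p := by
  -- Katz's formula needs a domain, and the ring of sections over the empty open is zero.
  rcases isEmpty_or_nonempty (L.red W).1 with he | he
  · have h0 : (L.red W).1 = ⊥ :=
      TopologicalSpace.Opens.ext (Set.isEmpty_coe_sort.mp he)
    have : Subsingleton Γ(S, (L.red W).1) := by
      rw [h0]
      infer_instance
    exact Subsingleton.elim _ _
  · obtain ⟨x, c, -, -, hD⟩ := L.exists_zetaDer_eq W a
    have h1 : D^[p - 1] (D (L.redSharp W c)) = D^[p] (L.redSharp W c) := by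
      rw [← Function.iterate_succ_apply, Nat.succ_eq_add_one, Nat.sub_add_cancel hp.out.pos]
    rw [hD, hD, iterate_map_add D, iterate_pow_pred_mul (natCast_eq_zero p h _), h1,
      derivationPow_apply, derivationPow_apply]
    ring

theorem zetaDer_res {W₁ W₂ : L.St.affineOpens} (hW : W₁.1 ≤ W₂.1)
    (hV : (L.red W₁).1 ≤ (L.red W₂).1)
    (D₁ : Derivation ℤ Γ(S, (L.red W₁).1) Γ(S, (L.red W₁).1))
    (D₂ : Derivation ℤ Γ(S, (L.red W₂).1) Γ(S, (L.red W₂).1))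
    (hD : ∀ a, D₁ (res S hV a) = res S hV (D₂ a)) (a : Γ(S, (L.red W₂).1)) :
    L.zetaDer W₁ D₁ (res S hV a) = res S hV (L.zetaDer W₂ D₂ a) := by
  obtain ⟨x, c, rfl, hc, h2⟩ := L.exists_zetaDer_eq W₂ a
  have h1 : L.frobLift W₁ (res L.St hW x) = res L.St hW x ^ p + p * res L.St hW c := by
    rw [frobLift_res, hc, map_add, map_mul, map_pow, map_natCast]
  have h3 := L.zeta_eq W₁ (vecOf p h _ D₁) h1
  rw [L.redSharp_res hW hV, L.redSharp_res hW hV] at h3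
  rw [h2]
  refine h3.trans ?_
  change _ * D₁ _ + D₁ _ = _
  rw [hD, hD, map_add, map_mul, map_pow]

end FrobeniusLifting

/-! ### Functoriality of deformation charts -/

section Functoriality

variable {p : ℕ} [hp : Fact p.Prime]

theorem derivationPow_comp {R R' : Type*} [CommRing R] [CommRing R'] (h0 : (p : R) = 0)
    (h0' : (p : R') = 0) (τ : R →+* R') {D : Derivation ℤ R R} {D' : Derivation ℤ R' R'}
    (h : ∀ c, D' (τ c) = τ (D c)) (c : R) :
    derivationPow p h0' D' (τ c) = τ (derivationPow p h0 D c) :=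
  (Function.Semiconj.iterate_right (f := τ) (fun c => (h c).symm) p c).symm

theorem iterate_derivationPow_comp {R R' : Type*} [CommRing R] [CommRing R'] (h0 : (p : R) = 0)
    (h0' : (p : R') = 0) (τ : R →+* R') {D : Derivation ℤ R R} {D' : Derivation ℤ R' R'}
    (h : ∀ c, D' (τ c) = τ (D c)) (n : ℕ) (c : R) :
    (derivationPow p h0')^[n] D' (τ c) = τ ((derivationPow p h0)^[n] D c) := by
  induction n generalizing c with
  | zero => exact h c
  | succ n ih =>
    rw [Function.iterate_succ_apply', Function.iterate_succ_apply']
    exact derivationPow_comp h0 h0' τ ih c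

theorem iterate_derivationPow_apply_eq_zero {R : Type*} [CommRing R] (h0 : (p : R) = 0)
    {D : Derivation ℤ R R} {c : R} (h : D c = 0) (n : ℕ) :
    (derivationPow p h0)^[n] D c = 0 := by
  induction n with
  | zero => exact h
  | succ n ih =>
    rw [Function.iterate_succ_apply']
    exact derivationPow_apply_eq_zero h0 ih

theorem sum_derivation_apply {R ι : Type*} [CommRing R] (s : Finset ι)
    (D : ι → Derivation ℤ R R) (a : R) : (∑ i ∈ s, D i) a = ∑ i ∈ s, D i a :=
  map_sum (AddMonoidHom.mk' (fun D : Derivation ℤ R R => D a) fun _ _ => rfl) D s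

variable {A₁ A₂ C₁ C₂ : Type u} [CommRing A₁] [CommRing A₂] [CommRing C₁] [CommRing C₂]

/-- A morphism of deformation charts along which derivations of `A₂` extend uniquely to `A₁`. -/
structure DeformationChart.Hom (d₁ : DeformationChart p A₁ C₁) (d₂ : DeformationChart p A₂ C₂)
    (ρ : A₂ →+* A₁) (τ : C₂ →+* C₁) : Prop where
  f_comp : ∀ a, d₁.f (ρ a) = τ (d₂.f a)
  exists_extension : ∀ D : Derivation ℤ A₂ A₂, ∃ E : Derivation ℤ A₁ A₁, ∀ a, E (ρ a) = ρ (D a)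
  ext : ∀ E E' : Derivation ℤ A₁ A₁, (∀ a, E (ρ a) = E' (ρ a)) → E = E'
  can_comp : ∀ D₁ D₂, (∀ a, D₁ (ρ a) = ρ (D₂ a)) → ∀ c, d₁.can D₁ (τ c) = τ (d₂.can D₂ c)
  T_comp : ∀ D₁ D₂, (∀ a, D₁ (ρ a) = ρ (D₂ a)) → ∀ c, d₁.T D₁ (τ c) = τ (d₂.T D₂ c)
  Z_comp : ∀ D₁ D₂, (∀ a, D₁ (ρ a) = ρ (D₂ a)) → ∀ a, d₁.Z D₁ (ρ a) = ρ (d₂.Z D₂ a)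
  eq_sum : ∀ (D : Derivation ℤ A₁ A₁) a, D (ρ a) = ∑ j, D (ρ (d₂.x j)) * ρ (d₂.del j a)
  N_eq : d₁.N = d₂.N

namespace DeformationChart.Hom

variable {d₁ : DeformationChart p A₁ C₁} {d₂ : DeformationChart p A₂ C₂}
  {ρ : A₂ →+* A₁} {τ : C₂ →+* C₁} (H : Hom d₁ d₂ ρ τ)

include H

/-- The dual bases of the two charts are unrelated. The extensions `E j` of `d₂.del j` along `ρ`,
with the functions `ρ (d₂.x j)`, expand every derivation of `A₁`, and by `sum_smul_eq` the sum over
the first chart may be computed with them. -/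
theorem sum_smul_comp (Phi₁ : Derivation ℤ A₁ A₁ → Derivation ℤ C₁ C₁)
    (Phi₂ : Derivation ℤ A₂ A₂ → Derivation ℤ C₂ C₂)
    (hadd : ∀ D E, Phi₁ (D + E) = Phi₁ D + Phi₁ E)
    (hsmul : ∀ (a : A₁) D, Phi₁ (a • D) = d₁.f a ^ p • Phi₁ D)
    (hPhi : ∀ D₁ D₂, (∀ a, D₁ (ρ a) = ρ (D₂ a)) → ∀ c, Phi₁ D₁ (τ c) = τ (Phi₂ D₂ c))
    {D₁ : Derivation ℤ A₁ A₁} {D₂ : Derivation ℤ A₂ A₂} (hD : ∀ a, D₁ (ρ a) = ρ (D₂ a)) (c : C₂) :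
    (∑ i, d₁.f (d₁.Z D₁ (d₁.x i)) • Phi₁ (d₁.del i)) (τ c) =
      τ ((∑ i, d₂.f (d₂.Z D₂ (d₂.x i)) • Phi₂ (d₂.del i)) c) := by
  choose E hE using fun j => H.exists_extension (d₂.del j)
  have h1 : ∀ D : Derivation ℤ A₁ A₁, D = ∑ j, D (ρ (d₂.x j)) • E j := by
    intro D
    refine H.ext _ _ fun a => ?_
    rw [H.eq_sum, sum_derivation_apply]
    refine Finset.sum_congr rfl fun j _ => ?_
    rw [Derivation.smul_apply, hE, smul_eq_mul]
  have h2 : ∀ b, d₁.Z D₁ b = ∑ j, ρ (d₂.Z D₂ (d₂.x j)) * E j b ^ p := by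
    intro b
    rw [d₁.Z_eq_sum]
    have h3 : ∀ i, d₁.del i b ^ p = ∑ j, d₁.del i (ρ (d₂.x j)) ^ p * E j b ^ p := by
      intro i
      have h4 : d₁.del i b = ∑ j, d₁.del i (ρ (d₂.x j)) * E j b := by
        conv_lhs => rw [h1 (d₁.del i)]
        rw [sum_derivation_apply]
        rfl
      have h5 := map_sum (frobRingHom A₁ p d₁.hA)
        (fun j => d₁.del i (ρ (d₂.x j)) * E j b) Finset.univ
      rw [h4]
      refine h5.trans (Finset.sum_congr rfl fun j _ => ?_)
      exact mul_pow _ _ _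
    simp only [h3, Finset.mul_sum]
    rw [Finset.sum_comm]
    refine Finset.sum_congr rfl fun j _ => ?_
    rw [← H.Z_comp D₁ D₂ hD, d₁.Z_eq_sum D₁ (ρ _), Finset.sum_mul]
    exact Finset.sum_congr rfl fun i _ => (mul_assoc _ _ _).symm
  rw [← d₁.sum_smul_eq Phi₁ hadd hsmul D₁ _ E h2]
  simp only [sum_derivation_apply, Derivation.smul_apply, smul_eq_mul, map_sum,
    map_mul]
  refine Finset.sum_congr rfl fun j _ => ?_
  rw [H.f_comp, hPhi _ _ (hE j)]

theorem phi_comp (m : ℕ) {D₁ : Derivation ℤ A₁ A₁} {D₂ : Derivation ℤ A₂ A₂}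
    (hD : ∀ a, D₁ (ρ a) = ρ (D₂ a)) (c : C₂) : d₁.phi m D₁ (τ c) = τ (d₂.phi m D₂ c) := by
  induction m generalizing D₁ D₂ c with
  | zero =>
    rw [d₁.phi_zero, d₂.phi_zero]
    exact H.sum_smul_comp d₁.T d₂.T d₁.T_add d₁.T_smul H.T_comp hD c
  | succ m ih =>
    rw [d₁.phi_succ, d₂.phi_succ]
    exact H.sum_smul_comp (fun D => derivationPow p d₁.hC (d₁.phi m D))
      (fun D => derivationPow p d₂.hC (d₂.phi m D)) (d₁.pow_phi_add m) (d₁.pow_phi_smul m)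
      (fun D₁ D₂ hD => derivationPow_comp d₂.hC d₁.hC τ fun c => ih hD c) hD c

theorem nab_comp {D₁ : Derivation ℤ A₁ A₁} {D₂ : Derivation ℤ A₂ A₂}
    (hD : ∀ a, D₁ (ρ a) = ρ (D₂ a)) (c : C₂) : d₁.nab D₁ (τ c) = τ (d₂.nab D₂ c) := by
  rw [DeformationChart.nab, DeformationChart.nab, Derivation.sub_apply, Derivation.sub_apply,
    map_sub, H.can_comp _ _ hD, DeformationChart.total, DeformationChart.total, H.N_eq,
    sum_derivation_apply, sum_derivation_apply, map_sum]
  exact congrArg _ (Finset.sum_congr rfl fun m _ => H.phi_comp m hD c)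

end DeformationChart.Hom

end Functoriality

/-! ### The canonical connection and the Higgs field on sections -/

section Square

variable {k : Type u} [Field k] {p : ℕ} [hp : Fact p.Prime] [CharP k p]
  {S : Scheme.{u}} {h : S ⟶ Spec (.of k)} {Y X : Scheme.{u}} {g : Y ⟶ frobTwist p h}
  {π : X ⟶ Y} {f : X ⟶ S} (sq : IsPullback π f g (relFrobenius p h))

/-- The ring homomorphism `Γ(S, V) → Γ(X, π⁻¹(U'))`. -/
def fSharp (V : S.affineOpens) (U' : Y.affineOpens) (hU' : U'.1 ≤ g ⁻¹ᵁ (twistOpen p h V).1) :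
    Γ(S, V.1) →+* Γ(X, (preimageOpen sq U').1) :=
  (f.appLE _ _ (preimageOpen_le sq hU')).hom

/-- The ring homomorphism `Γ(Y, U') → Γ(X, π⁻¹(U'))`. -/
def piSharp (U' : Y.affineOpens) : Γ(Y, U'.1) →+* Γ(X, (preimageOpen sq U').1) :=
  (π.app U'.1).hom

section

variable (V : S.affineOpens) (U' : Y.affineOpens) (hU' : U'.1 ≤ g ⁻¹ᵁ (twistOpen p h V).1)

theorem derivation_ext_of_sharp
    {E E' : Derivation ℤ Γ(X, (preimageOpen sq U').1) Γ(X, (preimageOpen sq U').1)}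
    (h₁ : ∀ a, E (fSharp sq V U' hU' a) = E' (fSharp sq V U' hU' a))
    (h₂ : ∀ b, E (piSharp sq U' b) = E' (piSharp sq U' b)) : E = E' :=
  derivation_ext_of_square sq V U' hU' h₁ h₂

variable [PerfectRing k p]

/-- The canonical connection on derivations. -/
def canDer (D : Derivation ℤ Γ(S, V.1) Γ(S, V.1)) :
    Derivation ℤ Γ(X, (preimageOpen sq U').1) Γ(X, (preimageOpen sq U').1) :=
  (nablaCan sq V U' hU' (vecOf p h V.1 D)).1

theorem canDer_fSharp (D : Derivation ℤ Γ(S, V.1) Γ(S, V.1)) (a : Γ(S, V.1)) :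
    canDer sq V U' hU' D (fSharp sq V U' hU' a) = fSharp sq V U' hU' (D a) :=
  nablaCan_f sq V U' hU' (vecOf p h V.1 D) a

theorem canDer_piSharp (D : Derivation ℤ Γ(S, V.1) Γ(S, V.1)) (b : Γ(Y, U'.1)) :
    canDer sq V U' hU' D (piSharp sq U' b) = 0 :=
  nablaCan_pi sq V U' hU' (vecOf p h V.1 D) b

theorem canDer_add (D E : Derivation ℤ Γ(S, V.1) Γ(S, V.1)) :
    canDer sq V U' hU' (D + E) = canDer sq V U' hU' D + canDer sq V U' hU' E := by
  refine derivation_ext_of_sharp sq V U' hU' (fun a => ?_) fun b => ?_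
  · rw [Derivation.add_apply, canDer_fSharp, canDer_fSharp, canDer_fSharp, Derivation.add_apply,
      map_add]
  · rw [Derivation.add_apply, canDer_piSharp, canDer_piSharp, canDer_piSharp, add_zero]

theorem canDer_smul (a : Γ(S, V.1)) (D : Derivation ℤ Γ(S, V.1) Γ(S, V.1)) :
    canDer sq V U' hU' (a • D) = fSharp sq V U' hU' a • canDer sq V U' hU' D := by
  refine derivation_ext_of_sharp sq V U' hU' (fun a => ?_) fun b => ?_
  · rw [Derivation.smul_apply, canDer_fSharp, canDer_fSharp, Derivation.smul_apply, smul_eq_mul,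
      smul_eq_mul, map_mul]
  · rw [Derivation.smul_apply, canDer_piSharp, canDer_piSharp, smul_zero]

theorem canDer_lie (D E : Derivation ℤ Γ(S, V.1) Γ(S, V.1)) :
    ⁅canDer sq V U' hU' D, canDer sq V U' hU' E⁆ = canDer sq V U' hU' ⁅D, E⁆ := by
  refine derivation_ext_of_sharp sq V U' hU' (fun a => ?_) fun b => ?_
  · simp only [Derivation.commutator_apply, canDer_fSharp, map_sub]
  · simp only [Derivation.commutator_apply, canDer_piSharp, map_zero, sub_zero]

theorem canDer_pow (D : Derivation ℤ Γ(S, V.1) Γ(S, V.1)) :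
    derivationPow p (natCast_eq_zero p (f ≫ h) _) (canDer sq V U' hU' D) =
      canDer sq V U' hU' (derivationPow p (natCast_eq_zero p h _) D) := by
  refine derivation_ext_of_sharp sq V U' hU' (fun a => ?_) fun b => ?_
  · rw [canDer_fSharp]
    exact derivationPow_comp _ _ _ (canDer_fSharp sq V U' hU' D) a
  · rw [canDer_piSharp]
    exact derivationPow_apply_eq_zero _ (canDer_piSharp sq V U' hU' D b)

variable (p h) in
theorem twistVec_ext {D E : Vec (frobTwistStr p h) (twistOpen p h V).1}
    (hDE : ∀ a, D.1 (projSharp p h V a) = E.1 (projSharp p h V a)) : D = E := by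
  refine Subtype.ext (Derivation.ext fun a => ?_)
  obtain ⟨a, rfl⟩ := (projSharp_bijective (p := p) h V).2 a
  exact hDE a

theorem twistVec_add (D E : Vec h V.1) :
    twistVec p h V (D + E) = twistVec p h V D + twistVec p h V E := by
  refine twistVec_ext p h V fun a => ?_
  rw [twistVec_projSharp]
  refine Eq.trans ?_ (congrArg₂ (· + ·) (twistVec_projSharp h V D a)
    (twistVec_projSharp h V E a)).symm
  exact map_add _ _ _

theorem twistVec_smul (b : Γ(S, V.1)) (D : Vec h V.1) :
    twistVec p h V (b • D) = projSharp p h V b • twistVec p h V D := by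
  refine twistVec_ext p h V fun a => ?_
  rw [twistVec_projSharp]
  refine Eq.trans ?_ (congrArg (projSharp p h V b * ·) (twistVec_projSharp h V D a)).symm
  exact map_mul _ _ _

variable (θ : LambdaConnection (frobTwistStr p h) g 0)

/-- The Higgs field evaluated at `w^*D`, on derivations. -/
def higgsDer (D : Derivation ℤ Γ(S, V.1) Γ(S, V.1)) : Derivation ℤ Γ(Y, U'.1) Γ(Y, U'.1) :=
  (θ.toFun (twistOpen p h V) U' hU' (twistVec p h V (vecOf p h V.1 D))).1

/-- The pullback of the Higgs field, on derivations. -/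
def pullbackDer (D : Derivation ℤ Γ(S, V.1) Γ(S, V.1)) :
    Derivation ℤ Γ(X, (preimageOpen sq U').1) Γ(X, (preimageOpen sq U').1) :=
  (pullbackHiggs sq θ V U' hU' (vecOf p h V.1 D)).1

theorem pullbackDer_fSharp (D : Derivation ℤ Γ(S, V.1) Γ(S, V.1)) (a : Γ(S, V.1)) :
    pullbackDer sq V U' hU' θ D (fSharp sq V U' hU' a) = 0 :=
  pullbackHiggs_f sq V U' hU' θ (vecOf p h V.1 D) a

theorem pullbackDer_piSharp (D : Derivation ℤ Γ(S, V.1) Γ(S, V.1)) (b : Γ(Y, U'.1)) :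
    pullbackDer sq V U' hU' θ D (piSharp sq U' b) = piSharp sq U' (higgsDer V U' hU' θ D b) :=
  pullbackHiggs_pi sq V U' hU' θ (vecOf p h V.1 D) b

theorem higgsDer_add (D E : Derivation ℤ Γ(S, V.1) Γ(S, V.1)) :
    higgsDer V U' hU' θ (D + E) = higgsDer V U' hU' θ D + higgsDer V U' hU' θ E := by
  have h1 : vecOf p h V.1 (D + E) = vecOf p h V.1 D + vecOf p h V.1 E := rfl
  rw [higgsDer, h1, twistVec_add, θ.map_add]
  rfl

theorem higgsDer_smul (a : Γ(S, V.1)) (D : Derivation ℤ Γ(S, V.1) Γ(S, V.1)) :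
    higgsDer V U' hU' θ (a • D) =
      (g.appLE _ _ hU').hom (projSharp p h V a) • higgsDer V U' hU' θ D := by
  have h1 : vecOf p h V.1 (a • D) = a • vecOf p h V.1 D := rfl
  rw [higgsDer, h1, twistVec_smul, θ.map_smul]
  rfl

theorem pullbackDer_add (D E : Derivation ℤ Γ(S, V.1) Γ(S, V.1)) :
    pullbackDer sq V U' hU' θ (D + E) =
      pullbackDer sq V U' hU' θ D + pullbackDer sq V U' hU' θ E := by
  refine derivation_ext_of_sharp sq V U' hU' (fun a => ?_) fun b => ?_
  · rw [Derivation.add_apply, pullbackDer_fSharp, pullbackDer_fSharp, pullbackDer_fSharp, add_zero]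
  · rw [Derivation.add_apply, pullbackDer_piSharp, pullbackDer_piSharp, pullbackDer_piSharp,
      higgsDer_add, Derivation.add_apply, map_add]

/-- `θ` is linear over functions on `S'`, and `w^♯ a` pulls back to the `p`-th power of `a` on `X`.
-/
theorem pullbackDer_smul (a : Γ(S, V.1)) (D : Derivation ℤ Γ(S, V.1) Γ(S, V.1)) :
    pullbackDer sq V U' hU' θ (a • D) =
      fSharp sq V U' hU' a ^ p • pullbackDer sq V U' hU' θ D := by
  refine derivation_ext_of_sharp sq V U' hU' (fun a => ?_) fun b => ?_
  · rw [Derivation.smul_apply, pullbackDer_fSharp, pullbackDer_fSharp, smul_zero]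
  · rw [Derivation.smul_apply, pullbackDer_piSharp, pullbackDer_piSharp, higgsDer_smul,
      Derivation.smul_apply, smul_eq_mul, smul_eq_mul, map_mul]
    exact congrArg (· * _) (pi_app_projSharp sq V U' hU' a)

variable {θ} in
theorem pullbackDer_lie (hθ : θ.IsHiggsField) (D E : Derivation ℤ Γ(S, V.1) Γ(S, V.1)) :
    ⁅pullbackDer sq V U' hU' θ D, pullbackDer sq V U' hU' θ E⁆ = 0 := by
  refine derivation_ext_of_sharp sq V U' hU' (fun a => ?_) fun b => ?_
  · simp only [Derivation.commutator_apply, pullbackDer_fSharp, map_zero, sub_zero]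
    rfl
  · simp only [Derivation.commutator_apply, pullbackDer_piSharp]
    rw [← map_sub, ← Derivation.commutator_apply]
    have h1 : ⁅higgsDer V U' hU' θ D, higgsDer V U' hU' θ E⁆ = 0 := hθ _ _ _ _ _
    rw [h1]
    exact map_zero _

theorem canDer_lie_pullbackDer (D E : Derivation ℤ Γ(S, V.1) Γ(S, V.1)) :
    ⁅canDer sq V U' hU' D, pullbackDer sq V U' hU' θ E⁆ = 0 := by
  refine derivation_ext_of_sharp sq V U' hU' (fun a => ?_) fun b => ?_
  · simp only [Derivation.commutator_apply, pullbackDer_fSharp, canDer_fSharp, map_zero, sub_zero]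
    rfl
  · simp only [Derivation.commutator_apply, pullbackDer_piSharp, canDer_piSharp, map_zero, sub_zero]
    rfl

variable {θ} in
theorem iterate_derivationPow_pullbackDer {N : ℕ}
    (hN : ∀ V U hU D, (Vec.pPow p)^[N] (θ.toFun V U hU D) = 0)
    (D : Derivation ℤ Γ(S, V.1) Γ(S, V.1)) :
    (derivationPow p (natCast_eq_zero p (f ≫ h) _))^[N] (pullbackDer sq V U' hU' θ D) = 0 := by
  refine derivation_ext_of_sharp sq V U' hU' (fun a => ?_) fun b => ?_
  · exact iterate_derivationPow_apply_eq_zero _ (pullbackDer_fSharp sq V U' hU' θ D a) N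
  · have h1 := iterate_derivationPow_comp (natCast_eq_zero p (g ≫ frobTwistStr p h) _)
      (natCast_eq_zero p (f ≫ h) _) _ (pullbackDer_piSharp sq V U' hU' θ D) N b
    have h2 : ∀ (n : ℕ) (v : Vec (g ≫ frobTwistStr p h) U'.1), ((Vec.pPow p)^[n] v).1 =
        (derivationPow p (natCast_eq_zero p (g ≫ frobTwistStr p h) _))^[n] v.1 := by
      intro n v
      induction n with
      | zero => rfl
      | succ n ih =>
        rw [Function.iterate_succ_apply', Function.iterate_succ_apply', ← ih]
        rfl
    have h3 : (derivationPow p (natCast_eq_zero p (g ≫ frobTwistStr p h) _))^[N]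
        (higgsDer V U' hU' θ D) = 0 := by
      rw [higgsDer, ← h2, hN]
      rfl
    rw [h1, h3]
    exact map_zero _

end

/-! ### Restriction -/

section Restriction

variable {V₁ V₂ : S.affineOpens} {U₁ U₂ : Y.affineOpens} (hV : V₁.1 ≤ V₂.1) (hU : U₁.1 ≤ U₂.1)
  (h₁ : U₁.1 ≤ g ⁻¹ᵁ (twistOpen p h V₁).1) (h₂ : U₂.1 ≤ g ⁻¹ᵁ (twistOpen p h V₂).1)

theorem preimageOpen_mono (hU : U₁.1 ≤ U₂.1) : (preimageOpen sq U₁).1 ≤ (preimageOpen sq U₂).1 :=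
  fun _ hx => hU hx

theorem fSharp_res (a : Γ(S, V₂.1)) :
    fSharp sq V₁ U₁ h₁ (res S hV a) = res X (preimageOpen_mono sq hU) (fSharp sq V₂ U₂ h₂ a) := by
  have h3 : S.presheaf.map (homOfLE hV).op ≫ f.appLE _ _ (preimageOpen_le sq h₁) =
      f.appLE _ _ (preimageOpen_le sq h₂) ≫
        X.presheaf.map (homOfLE (preimageOpen_mono sq hU)).op :=
    (Scheme.Hom.map_appLE ..).trans (Scheme.Hom.appLE_map ..).symm
  exact congr($(h3).hom a)

theorem piSharp_res (b : Γ(Y, U₂.1)) :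
    piSharp sq U₁ (res Y hU b) = res X (preimageOpen_mono sq hU) (piSharp sq U₂ b) := by
  have h3 : Y.presheaf.map (homOfLE hU).op ≫ π.app U₁.1 =
      π.app U₂.1 ≫ X.presheaf.map (homOfLE (preimageOpen_mono sq hU)).op :=
    π.naturality (homOfLE hU).op
  exact congr($(h3).hom b)

variable (h) in
theorem twistOpen_mono (hV : V₁.1 ≤ V₂.1) : (twistOpen p h V₁).1 ≤ (twistOpen p h V₂).1 :=
  fun _ hx => hV hx

variable (h) in
theorem projSharp_res (a : Γ(S, V₂.1)) :
    projSharp p h V₁ (res S hV a) =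
      res (frobTwist p h) (twistOpen_mono h hV) (projSharp p h V₂ a) := by
  have h3 : S.presheaf.map (homOfLE hV).op ≫ (frobTwistProj p h).app V₁.1 =
      (frobTwistProj p h).app V₂.1 ≫
        (frobTwist p h).presheaf.map (homOfLE (twistOpen_mono h hV)).op :=
    (frobTwistProj p h).naturality (homOfLE hV).op
  exact congr($(h3).hom a)

theorem eq_of_sharp_comp
    {E₁ : Derivation ℤ Γ(X, (preimageOpen sq U₁).1) Γ(X, (preimageOpen sq U₁).1)}
    {E₂ : Derivation ℤ Γ(X, (preimageOpen sq U₂).1) Γ(X, (preimageOpen sq U₂).1)}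
    (hf : ∀ a, E₁ (res X (preimageOpen_mono sq hU) (fSharp sq V₂ U₂ h₂ a)) =
      res X (preimageOpen_mono sq hU) (E₂ (fSharp sq V₂ U₂ h₂ a)))
    (hπ : ∀ b, E₁ (res X (preimageOpen_mono sq hU) (piSharp sq U₂ b)) =
      res X (preimageOpen_mono sq hU) (E₂ (piSharp sq U₂ b)))
    (c : Γ(X, (preimageOpen sq U₂).1)) :
    E₁ (res X (preimageOpen_mono sq hU) c) = res X (preimageOpen_mono sq hU) (E₂ c) :=
  eq_of_isPushout (isPushout_sections sq V₂ U₂ h₂)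
    (.of_derivation E₁ (res X (preimageOpen_mono sq hU)))
    (.comp_derivation (res X (preimageOpen_mono sq hU)) E₂) hf hπ c

variable [PerfectRing k p] {D₁ : Derivation ℤ Γ(S, V₁.1) Γ(S, V₁.1)}
  {D₂ : Derivation ℤ Γ(S, V₂.1) Γ(S, V₂.1)} (hD : ∀ a, D₁ (res S hV a) = res S hV (D₂ a))

include hD

theorem canDer_res (c : Γ(X, (preimageOpen sq U₂).1)) :
    canDer sq V₁ U₁ h₁ D₁ (res X (preimageOpen_mono sq hU) c) =
      res X (preimageOpen_mono sq hU) (canDer sq V₂ U₂ h₂ D₂ c) := by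
  refine eq_of_sharp_comp sq hU h₂ (fun a => ?_) (fun b => ?_) c
  · rw [← fSharp_res sq hV hU h₁ h₂, canDer_fSharp, canDer_fSharp, hD, fSharp_res sq hV hU h₁ h₂]
  · rw [← piSharp_res sq hU, canDer_piSharp, canDer_piSharp, map_zero]

variable (θ : LambdaConnection (frobTwistStr p h) g 0)

theorem higgsDer_res (b : Γ(Y, U₂.1)) :
    higgsDer V₁ U₁ h₁ θ D₁ (res Y hU b) = res Y hU (higgsDer V₂ U₂ h₂ θ D₂ b) := by
  refine θ.map_res _ _ _ _ (twistOpen_mono h hV) hU h₁ h₂ _ _ (fun a => ?_) b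
  obtain ⟨a, rfl⟩ := (projSharp_bijective (p := p) h V₂).2 a
  rw [twistVec_projSharp, ← projSharp_res h hV, ← projSharp_res h hV, twistVec_projSharp]
  exact congrArg _ (hD a)

theorem pullbackDer_res (c : Γ(X, (preimageOpen sq U₂).1)) :
    pullbackDer sq V₁ U₁ h₁ θ D₁ (res X (preimageOpen_mono sq hU) c) =
      res X (preimageOpen_mono sq hU) (pullbackDer sq V₂ U₂ h₂ θ D₂ c) := by
  refine eq_of_sharp_comp sq hU h₂ (fun a => ?_) (fun b => ?_) c
  · rw [← fSharp_res sq hV hU h₁ h₂, pullbackDer_fSharp, pullbackDer_fSharp, map_zero]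
  · rw [← piSharp_res sq hU, pullbackDer_piSharp, pullbackDer_piSharp, ← piSharp_res sq hU,
      higgsDer_res hV hU h₁ h₂ hD]

end Restriction

end Square

/-! ### The deformation over basic opens -/

section Local

variable {k : Type u} [Field k] {p : ℕ} [hp : Fact p.Prime] [CharP k p] [PerfectRing k p]
  {S : Scheme.{u}} {h : S ⟶ Spec (.of k)} (L : FrobeniusLifting p h) {Y X : Scheme.{u}}
  {g : Y ⟶ frobTwist p h} {π : X ⟶ Y} {f : X ⟶ S} (sq : IsPullback π f g (relFrobenius p h))
  (θ : LambdaConnection (frobTwistStr p h) g 0)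

section Chart

variable [IsIntegral S] {θ} (hθ : θ.IsHiggsField) {N : ℕ}
  (hN : ∀ V U hU D, (Vec.pPow p)^[N] (θ.toFun V U hU D) = 0)
  (W : L.St.affineOpens) (U' : Y.affineOpens) (hU' : U'.1 ≤ g ⁻¹ᵁ (twistOpen p h (L.red W)).1)
  (B : DualBasis p Γ(S, (L.red W).1))

/-- The deformation chart over affine opens. -/
def deformationChart :
    DeformationChart p Γ(S, (L.red W).1) Γ(X, (preimageOpen sq U').1) where
  hA := natCast_eq_zero p h _
  hC := natCast_eq_zero p (f ≫ h) _
  f := fSharp sq (L.red W) U' hU'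
  can := canDer sq (L.red W) U' hU'
  can_f := canDer_fSharp sq (L.red W) U' hU'
  can_add := canDer_add sq (L.red W) U' hU'
  can_smul := canDer_smul sq (L.red W) U' hU'
  can_lie := canDer_lie sq (L.red W) U' hU'
  can_pow := canDer_pow sq (L.red W) U' hU'
  T := pullbackDer sq (L.red W) U' hU' θ
  T_f := pullbackDer_fSharp sq (L.red W) U' hU' θ
  T_add := pullbackDer_add sq (L.red W) U' hU' θ
  T_smul := pullbackDer_smul sq (L.red W) U' hU' θ
  T_lie := pullbackDer_lie sq (L.red W) U' hU' hθ
  can_lie_T := canDer_lie_pullbackDer sq (L.red W) U' hU' θ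
  N := N
  T_nil := iterate_derivationPow_pullbackDer sq (L.red W) U' hU' hN
  Z := L.zetaDer W
  Z_add := L.zetaDer_add W
  Z_smul := L.zetaDer_smul W
  Z_lie := L.zetaDer_lie W
  Z_pow := L.zetaDer_pow W
  n := B.n
  x := B.x
  del := B.del
  eq_sum D := Derivation.ext fun a => by
    rw [sum_derivation_apply]
    refine (B.eq_sum (RingHom.id _) _ (natCast_eq_zero p h _)
      (.of_derivation D (RingHom.id _)) a).trans ?_
    exact Finset.sum_congr rfl fun i _ => mul_comm _ _
  Z_eq_sum D a := by
    rw [B.eq_sum _ _ (natCast_eq_zero p h _) (L.isDerivationAlong_zetaDer W D) a]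
    exact Finset.sum_congr rfl fun i _ => mul_comm _ _

include hθ hN

/-- `linearExtension` is a choice: a representation of its argument exists by the dual basis, and
`sum_smul_eq` shows that every representation gives the same value. -/
theorem coe_linearExtension
    {Phi : Vec h (L.red W).1 → Vec (f ≫ h) (preimageOpen sq U').1}
    {Phi' : Derivation ℤ Γ(S, (L.red W).1) Γ(S, (L.red W).1) →
      Derivation ℤ Γ(X, (preimageOpen sq U').1) Γ(X, (preimageOpen sq U').1)}
    (hPhi : ∀ D, (Phi D).1 = Phi' D.1) (hadd : ∀ D E, Phi' (D + E) = Phi' D + Phi' E)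
    (hsmul : ∀ (a : Γ(S, (L.red W).1)) D,
      Phi' (a • D) = fSharp sq (L.red W) U' hU' a ^ p • Phi' D) (D : Vec h (L.red W).1) :
    (linearExtension sq (L.red W) U' hU' Phi (L.zeta W D)).1 =
      ∑ i, fSharp sq (L.red W) U' hU' (L.zetaDer W D.1 (B.x i)) • Phi' (B.del i) := by
  let d := deformationChart L sq hθ hN W U' hU' B
  have hcoe : ∀ {m : ℕ} (a : Fin m → Γ(S, (L.red W).1)) (E : Fin m → Vec h (L.red W).1),
      (∑ j, fSharp sq (L.red W) U' hU' (a j) • Phi (E j)).1 =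
        ∑ j, fSharp sq (L.red W) U' hU' (a j) • Phi' (E j).1 := by
    intro m a E
    rw [AddSubmonoidClass.coe_finsetSum]
    exact Finset.sum_congr rfl fun j _ => 
      congrArg (fSharp sq (L.red W) U' hU' (a j) • ·) (hPhi (E j))
  obtain ⟨m, a, E, hE, he⟩ : ∃ (m : ℕ) (a : Fin m → Γ(S, (L.red W).1))
      (E : Fin m → Vec h (L.red W).1),
      (∀ b', L.zeta W D b' = ∑ j, a j * frobSharp p h _ ((twistVec p h _ (E j)).1 b')) ∧
      linearExtension sq (L.red W) U' hU' Phi (L.zeta W D) =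
        ∑ j, fSharp sq (L.red W) U' hU' (a j) • Phi (E j) := by
    refine Classical.epsilon_spec (p := fun G => ∃ (m : ℕ) (a : Fin m → Γ(S, (L.red W).1))
      (E : Fin m → Vec h (L.red W).1),
      (∀ b', L.zeta W D b' = ∑ j, a j * frobSharp p h _ ((twistVec p h _ (E j)).1 b')) ∧
      G = ∑ j, fSharp sq (L.red W) U' hU' (a j) • Phi (E j)) ⟨_, B.n,
        fun i => L.zetaDer W D.1 (B.x i), fun i => vecOf p h _ (B.del i), fun b' => ?_, rfl⟩
    obtain ⟨b, rfl⟩ := (projSharp_bijective (p := p) h (L.red W)).2 b'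
    refine (d.Z_eq_sum D.1 b).trans (Finset.sum_congr rfl fun i _ => ?_)
    rw [twistVec_projSharp, frobSharp_projSharp]
    rfl
  rw [he, hcoe]
  refine d.sum_smul_eq Phi' hadd hsmul D.1 a (fun j => (E j).1) fun b => ?_
  refine (hE (projSharp p h _ b)).trans (Finset.sum_congr rfl fun j _ => ?_)
  rw [twistVec_projSharp, frobSharp_projSharp]

theorem coe_summand (n : ℕ) (D : Vec h (L.red W).1) :
    (summand L sq θ W U' hU' n D).1 = (deformationChart L sq hθ hN W U' hU' B).phi n D.1 := by
  induction n generalizing D with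
  | zero =>
    exact coe_linearExtension L sq hθ hN W U' hU' B (fun D => rfl)
      (pullbackDer_add sq (L.red W) U' hU' θ) (pullbackDer_smul sq (L.red W) U' hU' θ) D
  | succ n ih =>
    rw [DeformationChart.phi_succ]
    refine coe_linearExtension L sq hθ hN W U' hU' B
      (Phi' := fun D => derivationPow p (natCast_eq_zero p (f ≫ h) _)
        ((deformationChart L sq hθ hN W U' hU' B).phi n D)) (fun D => ?_)
      ((deformationChart L sq hθ hN W U' hU' B).pow_phi_add n)
      ((deformationChart L sq hθ hN W U' hU' B).pow_phi_smul n) D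
    exact congrArg (derivationPow p (natCast_eq_zero p (f ≫ h) _)) (ih D)

end Chart

/-- The deformed connection over affine opens, on derivations. -/
def localNabla (W : L.St.affineOpens) (U' : Y.affineOpens)
    (hU' : U'.1 ≤ g ⁻¹ᵁ (twistOpen p h (L.red W)).1)
    (D : Derivation ℤ Γ(S, (L.red W).1) Γ(S, (L.red W).1)) :
    Derivation ℤ Γ(X, (preimageOpen sq U').1) Γ(X, (preimageOpen sq U').1) :=
  (nablaCan sq (L.red W) U' hU' (vecOf p h _ D) -
    ∑ᶠ n : ℕ, summand L sq θ W U' hU' n (vecOf p h _ D)).1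

variable [IsIntegral S]

variable {θ} in
-- `localNabla` involves neither a dual basis nor a nilpotency bound, so each of its properties may
-- be checked in a chart with arbitrary choices of these. The bound makes the `finsum` finite.
theorem localNabla_eq (hθ : θ.IsHiggsField) {N : ℕ}
    (hN : ∀ V U hU D, (Vec.pPow p)^[N] (θ.toFun V U hU D) = 0)
    (W : L.St.affineOpens) (U' : Y.affineOpens) (hU' : U'.1 ≤ g ⁻¹ᵁ (twistOpen p h (L.red W)).1)
    (B : DualBasis p Γ(S, (L.red W).1)) (D : Derivation ℤ Γ(S, (L.red W).1) Γ(S, (L.red W).1)) :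
    localNabla L sq θ W U' hU' D = (deformationChart L sq hθ hN W U' hU' B).nab D := by
  let d := deformationChart L sq hθ hN W U' hU' B
  have h1 : ∑ᶠ n : ℕ, summand L sq θ W U' hU' n (vecOf p h _ D) =
      ∑ n ∈ Finset.range N, summand L sq θ W U' hU' n (vecOf p h _ D) := by
    refine finsum_eq_sum_of_support_subset _ fun n hn => ?_
    rw [Finset.coe_range, Set.mem_Iio]
    by_contra hle
    refine hn (Subtype.ext ?_)
    rw [coe_summand L sq hθ hN W U' hU' B, d.phi_eq_zero n (not_lt.mp hle)]
    rfl
  rw [localNabla, h1]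
  refine congrArg (canDer sq (L.red W) U' hU' D - ·) ?_
  rw [AddSubmonoidClass.coe_finsetSum]
  exact Finset.sum_congr rfl fun n _ => coe_summand L sq hθ hN W U' hU' B n _

variable [Smooth h] {θ} (hθ : θ.IsHiggsField) (hnil : θ.IsNilpotent p)

section

variable (W : L.St.affineOpens) (U' : Y.affineOpens)
  (hU' : U'.1 ≤ g ⁻¹ᵁ (twistOpen p h (L.red W)).1)

include hθ hnil

theorem localNabla_add (D E : Derivation ℤ Γ(S, (L.red W).1) Γ(S, (L.red W).1)) :
    localNabla L sq θ W U' hU' (D + E) =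
      localNabla L sq θ W U' hU' D + localNabla L sq θ W U' hU' E := by
  obtain ⟨N, hN⟩ := hnil
  obtain ⟨B⟩ := nonempty_dualBasis_sections (p := p) h (L.red W)
  simp only [localNabla_eq L sq hθ hN W U' hU' B]
  exact DeformationChart.nab_add _ D E

theorem localNabla_smul (a : Γ(S, (L.red W).1))
    (D : Derivation ℤ Γ(S, (L.red W).1) Γ(S, (L.red W).1)) :
    localNabla L sq θ W U' hU' (a • D) =
      fSharp sq (L.red W) U' hU' a • localNabla L sq θ W U' hU' D := by
  obtain ⟨N, hN⟩ := hnil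
  obtain ⟨B⟩ := nonempty_dualBasis_sections (p := p) h (L.red W)
  simp only [localNabla_eq L sq hθ hN W U' hU' B]
  exact DeformationChart.nab_smul _ a D

theorem localNabla_fSharp (D : Derivation ℤ Γ(S, (L.red W).1) Γ(S, (L.red W).1))
    (a : Γ(S, (L.red W).1)) :
    localNabla L sq θ W U' hU' D (fSharp sq (L.red W) U' hU' a) =
      fSharp sq (L.red W) U' hU' (D a) := by
  obtain ⟨N, hN⟩ := hnil
  obtain ⟨B⟩ := nonempty_dualBasis_sections (p := p) h (L.red W)
  simp only [localNabla_eq L sq hθ hN W U' hU' B]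
  exact DeformationChart.nab_f (deformationChart L sq hθ hN W U' hU' B) D a

theorem localNabla_lie (D E : Derivation ℤ Γ(S, (L.red W).1) Γ(S, (L.red W).1)) :
    ⁅localNabla L sq θ W U' hU' D, localNabla L sq θ W U' hU' E⁆ =
      localNabla L sq θ W U' hU' ⁅D, E⁆ := by
  obtain ⟨N, hN⟩ := hnil
  obtain ⟨B⟩ := nonempty_dualBasis_sections (p := p) h (L.red W)
  simp only [localNabla_eq L sq hθ hN W U' hU' B]
  exact DeformationChart.nab_lie _ D E

theorem localNabla_pow (D : Derivation ℤ Γ(S, (L.red W).1) Γ(S, (L.red W).1)) :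
    derivationPow p (natCast_eq_zero p (f ≫ h) _) (localNabla L sq θ W U' hU' D) =
      localNabla L sq θ W U' hU' (derivationPow p (natCast_eq_zero p h _) D) +
        pullbackDer sq (L.red W) U' hU' θ D := by
  obtain ⟨N, hN⟩ := hnil
  obtain ⟨B⟩ := nonempty_dualBasis_sections (p := p) h (L.red W)
  simp only [localNabla_eq L sq hθ hN W U' hU' B]
  exact DeformationChart.nab_pow (deformationChart L sq hθ hN W U' hU' B) D

end

include hθ hnil in
theorem localNabla_res {W₁ W₂ : L.St.affineOpens} {U₁ U₂ : Y.affineOpens} (hW : W₁.1 ≤ W₂.1)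
    (hU : U₁.1 ≤ U₂.1) (h₁ : U₁.1 ≤ g ⁻¹ᵁ (twistOpen p h (L.red W₁)).1)
    (h₂ : U₂.1 ≤ g ⁻¹ᵁ (twistOpen p h (L.red W₂)).1) (hV : (L.red W₁).1 ≤ (L.red W₂).1)
    {D₁ : Derivation ℤ Γ(S, (L.red W₁).1) Γ(S, (L.red W₁).1)}
    {D₂ : Derivation ℤ Γ(S, (L.red W₂).1) Γ(S, (L.red W₂).1)}
    (hD : ∀ a, D₁ (res S hV a) = res S hV (D₂ a)) (c : Γ(X, (preimageOpen sq U₂).1)) :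
    localNabla L sq θ W₁ U₁ h₁ D₁ (res X (preimageOpen_mono sq hU) c) =
      res X (preimageOpen_mono sq hU) (localNabla L sq θ W₂ U₂ h₂ D₂ c) := by
  obtain ⟨N, hN⟩ := hnil
  obtain ⟨B₁⟩ := nonempty_dualBasis_sections (p := p) h (L.red W₁)
  obtain ⟨B₂⟩ := nonempty_dualBasis_sections (p := p) h (L.red W₂)
  rw [localNabla_eq L sq hθ hN W₁ U₁ h₁ B₁, localNabla_eq L sq hθ hN W₂ U₂ h₂ B₂]
  have H : DeformationChart.Hom (deformationChart L sq hθ hN W₁ U₁ h₁ B₁)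
      (deformationChart L sq hθ hN W₂ U₂ h₂ B₂) (res S hV) (res X (preimageOpen_mono sq hU)) :=
    { f_comp := fSharp_res sq hV hU h₁ h₂
      exists_extension := fun D => ⟨resDer hV D, resDer_res hV D⟩
      ext := fun E E' hE => derivation_ext_of_formallyUnramified _ (res_formallyEtale hV) hE
      can_comp := fun D₁ D₂ hD => canDer_res sq hV hU h₁ h₂ hD
      T_comp := fun D₁ D₂ hD => pullbackDer_res sq hV hU h₁ h₂ hD θ
      Z_comp := fun D₁ D₂ hD => L.zetaDer_res hW hV D₁ D₂ hD
      eq_sum := fun D a => by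
        refine (B₂.eq_sum _ _ (natCast_eq_zero p h _) (.of_derivation D (res S hV)) a).trans ?_
        exact Finset.sum_congr rfl fun i _ => mul_comm _ _
      N_eq := rfl }
  exact H.nab_comp hD c

end Local

/-! ### Bases of affine opens -/

section Basis

variable {k : Type u} [Field k] {p : ℕ} [hp : Fact p.Prime] [CharP k p] [PerfectRing k p]
  {S : Scheme.{u}} {h : S ⟶ Spec (.of k)} (L : FrobeniusLifting p h) {Y X : Scheme.{u}}
  {g : Y ⟶ frobTwist p h} {π : X ⟶ Y} {f : X ⟶ S} (sq : IsPullback π f g (relFrobenius p h))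

omit [PerfectRing k p] in
-- It suffices to consider ring generators of the pushout: functions from `Y`, and functions from
-- `S`, whose `p`-th powers come from `Y` through `S'`.
theorem exists_pow_eq_piSharp (V : S.affineOpens) (U' : Y.affineOpens)
    (hU' : U'.1 ≤ g ⁻¹ᵁ (twistOpen p h V).1) (c : Γ(X, (preimageOpen sq U').1)) :
    ∃ b, piSharp sq U' b = c ^ p := by
  have h1 : Subring.closure (Set.range (f.appLE _ _ (preimageOpen_le sq hU')).hom ∪
      Set.range (π.app U'.1).hom) ≤ (piSharp sq U').range.comap
        (frobRingHom Γ(X, (preimageOpen sq U').1) p (natCast_eq_zero p (f ≫ h) _)) := by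
    refine Subring.closure_le.mpr ?_
    rintro _ (⟨a, rfl⟩ | ⟨b, rfl⟩)
    · exact ⟨_, pi_app_projSharp sq V U' hU' a⟩
    · exact ⟨b ^ p, map_pow (piSharp sq U') b p⟩
  have h2 := (closure_eq_top_of_isPushout (isPushout_sections sq V U' hU')).ge
    (Subring.mem_top c)
  exact h1 h2

include sq in
omit [PerfectRing k p] in
theorem f_preimage_twistOpen (V : S.affineOpens) :
    π ⁻¹ᵁ g ⁻¹ᵁ (twistOpen p h V).1 = f ⁻¹ᵁ V.1 := by
  change (π ≫ g ≫ frobTwistProj p h) ⁻¹ᵁ V.1 = (f ≫ absFrobenius p h) ⁻¹ᵁ V.1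
  rw [← relFrobenius_proj, ← Category.assoc, ← Category.assoc, sq.w]

omit [PerfectRing k p] in
-- The opens `π⁻¹(U')` form a basis of `X`: a basic open of `c` is also that of `c ^ p`, which is
-- the pullback of a function `b` on `Y`.
theorem exists_mem_preimageOpen {x : X} {O : X.Opens} (hO : x ∈ O) {P : L.St.Opens}
    (hP : L.i (f x) ∈ P) {Q : Y.Opens} (hQ : π x ∈ Q) :
    ∃ (W : L.St.affineOpens) (U' : Y.affineOpens),
      W.1 ≤ P ∧ U'.1 ≤ Q ∧ U'.1 ≤ g ⁻¹ᵁ (twistOpen p h (L.red W)).1 ∧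
      (preimageOpen sq U').1 ≤ O ∧ x ∈ (preimageOpen sq U').1 := by
  obtain ⟨W, hW, hxW, hWP⟩ := exists_isAffineOpen_mem_and_subset hP
  let W : L.St.affineOpens := ⟨W, hW⟩
  have hx1 : π x ∈ g ⁻¹ᵁ (twistOpen p h (L.red W)).1 := by
    have h1 : x ∈ f ⁻¹ᵁ (L.red W).1 := hxW
    rw [← f_preimage_twistOpen sq (L.red W)] at h1
    exact h1
  obtain ⟨U, hU, hxU, hUQ⟩ := exists_isAffineOpen_mem_and_subset
    (U := Q ⊓ g ⁻¹ᵁ (twistOpen p h (L.red W)).1) (x := π x) ⟨hQ, hx1⟩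
  let U : Y.affineOpens := ⟨U, hU⟩
  have hxpre : x ∈ (preimageOpen sq U).1 := hxU
  have hUg : U.1 ≤ g ⁻¹ᵁ (twistOpen p h (L.red W)).1 := fun y hy => (hUQ hy).2
  obtain ⟨c, hcO, hxc⟩ := (preimageOpen sq U).2.exists_basicOpen_le ⟨x, hO⟩ hxpre
  obtain ⟨b, hb⟩ := exists_pow_eq_piSharp sq (L.red W) U hUg c
  have hpre : π ⁻¹ᵁ Y.basicOpen b = X.basicOpen c := by
    rw [Scheme.preimage_basicOpen]
    refine Eq.trans ?_ (X.basicOpen_pow c hp.out.pos)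
    exact congrArg X.basicOpen hb
  refine ⟨W, ⟨Y.basicOpen b, hU.basicOpen b⟩, hWP, fun y hy => ?_, fun y hy => ?_, ?_, ?_⟩
  · exact (hUQ (Y.basicOpen_le b hy)).1
  · exact (hUQ (Y.basicOpen_le b hy)).2
  · change π ⁻¹ᵁ Y.basicOpen b ≤ O
    rw [hpre]
    exact hcO
  · change x ∈ π ⁻¹ᵁ Y.basicOpen b
    rw [hpre]
    exact hxc

omit [PerfectRing k p] in
theorem exists_preimage_le (V : S.Opens) {s : S} (hs : s ∈ V) :
    ∃ P : L.St.Opens, L.i s ∈ P ∧ L.i ⁻¹ᵁ P ≤ V := by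
  obtain ⟨P, hP, e⟩ := L.i.isClosedEmbedding.isInducing.isOpen_iff.mp V.2
  refine ⟨⟨P, hP⟩, ?_, fun x hx => ?_⟩
  · have h1 : s ∈ (L.i : S → L.St) ⁻¹' P := e.symm ▸ hs
    exact h1
  · have h1 : x ∈ (L.i : S → L.St) ⁻¹' P := hx
    rw [e] at h1
    exact h1

omit [PerfectRing k p] in
/-- Sections over `U ⊆ f⁻¹(V)` agree if they agree on all small opens over which the deformed
connection is given by its formula. -/
theorem eq_of_res_preimageOpen_eq {V : S.Opens} {U : X.Opens} (hUV : U ≤ f ⁻¹ᵁ V) (Q : Y.Opens)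
    (hQ : U ≤ π ⁻¹ᵁ Q) {s t : Γ(X, U)}
    (hst : ∀ (W : L.St.affineOpens) (U' : Y.affineOpens)
      (_ : U'.1 ≤ g ⁻¹ᵁ (twistOpen p h (L.red W)).1) (_ : (L.red W).1 ≤ V) (_ : U'.1 ≤ Q)
      (hU : (preimageOpen sq U').1 ≤ U), res X hU s = res X hU t) : s = t := by
  refine eq_of_res_eq fun x hx => ?_
  obtain ⟨P, hP, hPV⟩ := exists_preimage_le L V (hUV hx)
  obtain ⟨W, U', hWP, hU'Q, hU', hU'U, hxU'⟩ := exists_mem_preimageOpen L sq hx hP (hQ hx)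
  exact ⟨_, hU'U, hxU', hst W U' hU' (fun y hy => hPV (hWP hy)) hU'Q hU'U⟩

end Basis

/-! ### The deformed connection -/

section Restriction

variable {X : Scheme.{u}}

theorem resDer_resDer {U₁ U₂ U₃ : X.affineOpens} (h₁ : U₁.1 ≤ U₂.1) (h₂ : U₂.1 ≤ U₃.1)
    (D : Derivation ℤ Γ(X, U₃.1) Γ(X, U₃.1)) :
    resDer h₁ (resDer h₂ D) = resDer (h₁.trans h₂) D :=
  eq_resDer _ _ _ fun a => by rw [← res_res h₁ h₂, resDer_res, resDer_res, res_res]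

theorem resDer_self {U : X.affineOpens} (h : U.1 ≤ U.1) (D : Derivation ℤ Γ(X, U.1) Γ(X, U.1)) :
    resDer h D = D :=
  (eq_resDer h D D fun a => by rw [res_self, res_self]).symm

theorem resDer_add {U₁ U₂ : X.affineOpens} (h : U₁.1 ≤ U₂.1)
    (D E : Derivation ℤ Γ(X, U₂.1) Γ(X, U₂.1)) :
    resDer h (D + E) = resDer h D + resDer h E :=
  (eq_resDer h _ _ fun a => by
    rw [Derivation.add_apply, Derivation.add_apply, resDer_res, resDer_res, map_add]).symm

theorem resDer_smul {U₁ U₂ : X.affineOpens} (h : U₁.1 ≤ U₂.1) (b : Γ(X, U₂.1))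
    (D : Derivation ℤ Γ(X, U₂.1) Γ(X, U₂.1)) :
    resDer h (b • D) = res X h b • resDer h D :=
  (eq_resDer h _ _ fun a => by
    rw [Derivation.smul_apply, Derivation.smul_apply, resDer_res, smul_eq_mul, smul_eq_mul,
      map_mul]).symm

theorem resDer_lie {U₁ U₂ : X.affineOpens} (h : U₁.1 ≤ U₂.1)
    (D E : Derivation ℤ Γ(X, U₂.1) Γ(X, U₂.1)) :
    resDer h ⁅D, E⁆ = ⁅resDer h D, resDer h E⁆ :=
  (eq_resDer h _ _ fun a => by
    rw [Derivation.commutator_apply, Derivation.commutator_apply, resDer_res, resDer_res,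
      resDer_res, resDer_res, map_sub]).symm

theorem resDer_derivationPow {p : ℕ} [Fact p.Prime] {U₁ U₂ : X.affineOpens} (h : U₁.1 ≤ U₂.1)
    (h0 : (p : Γ(X, U₂.1)) = 0) (h0' : (p : Γ(X, U₁.1)) = 0)
    (D : Derivation ℤ Γ(X, U₂.1) Γ(X, U₂.1)) :
    resDer h (derivationPow p h0 D) = derivationPow p h0' (resDer h D) :=
  (eq_resDer h _ _ (derivationPow_comp h0 h0' (res X h) (resDer_res h D))).symm

end Restriction

/-! ### Gluing of the deformed connection, its integrability and its `p`-curvature -/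

section Global

variable {k : Type u} [Field k] {p : ℕ} [hp : Fact p.Prime] [CharP k p] [PerfectRing k p]
  {S : Scheme.{u}} {h : S ⟶ Spec (.of k)} (L : FrobeniusLifting p h) {Y X : Scheme.{u}}
  {g : Y ⟶ frobTwist p h} {π : X ⟶ Y} {f : X ⟶ S} (sq : IsPullback π f g (relFrobenius p h))
  (θ : LambdaConnection (frobTwistStr p h) g 0)

/-- The vector field `E` on `U ⊆ f⁻¹(V)` is the value of the deformed connection at `D`. -/
def IsNabla (V : S.affineOpens) (U : X.affineOpens) (D : Derivation ℤ Γ(S, V.1) Γ(S, V.1))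
    (E : Derivation ℤ Γ(X, U.1) Γ(X, U.1)) : Prop :=
  ∀ (W : L.St.affineOpens) (U' : Y.affineOpens)
    (hU' : U'.1 ≤ g ⁻¹ᵁ (twistOpen p h (L.red W)).1) (hV : (L.red W).1 ≤ V.1)
    (hU : (preimageOpen sq U').1 ≤ U.1) (b : Γ(X, U.1)),
    res X hU (E b) = localNabla L sq θ W U' hU' (resDer hV D) (res X hU b)

variable {L sq θ} in
theorem IsNabla.unique {V : S.affineOpens} {U : X.affineOpens} (hUV : U.1 ≤ f ⁻¹ᵁ V.1)
    {D : Derivation ℤ Γ(S, V.1) Γ(S, V.1)} {E E' : Derivation ℤ Γ(X, U.1) Γ(X, U.1)}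
    (hE : IsNabla L sq θ V U D E) (hE' : IsNabla L sq θ V U D E') : E = E' :=
  Derivation.ext fun b => eq_of_res_preimageOpen_eq L sq hUV ⊤ le_top
    fun W U' hU' hV _ hU => (hE W U' hU' hV hU b).trans (hE' W U' hU' hV hU b).symm

section

variable [IsIntegral S] [Smooth h] {θ} (hθ : θ.IsHiggsField) (hnil : θ.IsNilpotent p)

include hθ hnil

/-- The local fields are glued over all small pairs `(W, U')`. Around each point, two such pairs
contain a common smaller pair, where `localNabla_res` gives agreement. -/
theorem exists_isNabla (V : S.affineOpens) (U : X.affineOpens) (hUV : U.1 ≤ f ⁻¹ᵁ V.1)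
    (D : Derivation ℤ Γ(S, V.1) Γ(S, V.1)) : ∃ E, IsNabla L sq θ V U D E := by
  let ι : Type u := {i : L.St.affineOpens × Y.affineOpens //
    i.2.1 ≤ g ⁻¹ᵁ (twistOpen p h (L.red i.1)).1 ∧ (L.red i.1).1 ≤ V.1 ∧
      (preimageOpen sq i.2).1 ≤ U.1}
  obtain ⟨E, hE⟩ := exists_glued_derivation (U := U.1) (ι := ι)
    (fun i => (preimageOpen sq i.1.2).1) (fun i => i.2.2.2)
    (fun x hx => by
      obtain ⟨P, hP, hPV⟩ := exists_preimage_le L V.1 (hUV hx)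
      obtain ⟨W, U', hWP, -, hU', hU'U, hxU'⟩ :=
        exists_mem_preimageOpen L sq hx hP (Q := ⊤) trivial
      exact ⟨⟨⟨W, U'⟩, hU', fun y hy => hPV (hWP hy), hU'U⟩, hxU'⟩)
    (fun i => localNabla L sq θ i.1.1 i.1.2 i.2.1 (resDer i.2.2.1 D))
    (by
      rintro ⟨⟨W₁, U₁⟩, h₁, hV₁, hU₁⟩ ⟨⟨W₂, U₂⟩, h₂, hV₂, hU₂⟩ x hx₁ hx₂
      obtain ⟨W, U', hW, hU, hU', -, hx⟩ := exists_mem_preimageOpen L sq (O := ⊤)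
        (P := W₁.1 ⊓ W₂.1) (Q := U₁.1 ⊓ U₂.1) (x := x) trivial
        ⟨preimageOpen_le sq h₁ hx₁, preimageOpen_le sq h₂ hx₂⟩ ⟨hx₁, hx₂⟩
      have hW₁ : W.1 ≤ W₁.1 := hW.trans inf_le_left
      have hW₂ : W.1 ≤ W₂.1 := hW.trans inf_le_right
      have hr₁ : (L.red W).1 ≤ (L.red W₁).1 := fun _ hy => hW₁ hy
      have hr₂ : (L.red W).1 ≤ (L.red W₂).1 := fun _ hy => hW₂ hy
      refine ⟨⟨⟨W, U'⟩, hU', hr₁.trans hV₁,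
        (preimageOpen_mono sq (hU.trans inf_le_left)).trans hU₁⟩, hx,
        preimageOpen_mono sq (hU.trans inf_le_left),
        preimageOpen_mono sq (hU.trans inf_le_right), fun b => ?_, fun b => ?_⟩
      · refine localNabla_res L sq hθ hnil hW₁ (hU.trans inf_le_left) hU' h₁ hr₁ (fun a => ?_) b
        rw [← resDer_resDer hr₁ hV₁, resDer_res]
      · refine localNabla_res L sq hθ hnil hW₂ (hU.trans inf_le_right) hU' h₂ hr₂ (fun a => ?_) b
        rw [← resDer_resDer hr₂ hV₂, resDer_res])
  exact ⟨E, fun W U' hU' hV hU b => hE ⟨⟨W, U'⟩, hU', hV, hU⟩ b⟩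

theorem isNabla_add {V : S.affineOpens} {U : X.affineOpens}
    {D₁ D₂ : Derivation ℤ Γ(S, V.1) Γ(S, V.1)} {E₁ E₂ : Derivation ℤ Γ(X, U.1) Γ(X, U.1)}
    (h₁ : IsNabla L sq θ V U D₁ E₁) (h₂ : IsNabla L sq θ V U D₂ E₂) :
    IsNabla L sq θ V U (D₁ + D₂) (E₁ + E₂) := by
  intro W U' hU' hV hU b
  rw [resDer_add, localNabla_add L sq hθ hnil, Derivation.add_apply, Derivation.add_apply, map_add,
    h₁ W U' hU' hV hU, h₂ W U' hU' hV hU]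

omit [PerfectRing k p] [IsIntegral S] [Smooth h] hθ hnil in
theorem fSharp_res_appLE {V : S.affineOpens} {U : X.affineOpens} (hUV : U.1 ≤ f ⁻¹ᵁ V.1)
    {V₁ : S.affineOpens} {U' : Y.affineOpens} (hU' : U'.1 ≤ g ⁻¹ᵁ (twistOpen p h V₁).1)
    (hV : V₁.1 ≤ V.1) (hU : (preimageOpen sq U').1 ≤ U.1) (a : Γ(S, V.1)) :
    fSharp sq V₁ U' hU' (res S hV a) = res X hU ((f.appLE V.1 U.1 hUV).hom a) := by
  have h3 : S.presheaf.map (homOfLE hV).op ≫ f.appLE _ _ (preimageOpen_le sq hU') =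
      f.appLE V.1 U.1 hUV ≫ X.presheaf.map (homOfLE hU).op :=
    (Scheme.Hom.map_appLE ..).trans (Scheme.Hom.appLE_map ..).symm
  exact congr($(h3).hom a)

theorem isNabla_smul {V : S.affineOpens} {U : X.affineOpens} (hUV : U.1 ≤ f ⁻¹ᵁ V.1)
    (a : Γ(S, V.1)) {D : Derivation ℤ Γ(S, V.1) Γ(S, V.1)}
    {E : Derivation ℤ Γ(X, U.1) Γ(X, U.1)} (hE : IsNabla L sq θ V U D E) :
    IsNabla L sq θ V U (a • D) ((f.appLE V.1 U.1 hUV).hom a • E) := by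
  intro W U' hU' hV hU b
  rw [resDer_smul, localNabla_smul L sq hθ hnil, Derivation.smul_apply, Derivation.smul_apply,
    smul_eq_mul, smul_eq_mul, map_mul, hE W U' hU' hV hU, fSharp_res_appLE sq hUV hU' hV hU]

theorem isNabla_apply {V : S.affineOpens} {U : X.affineOpens} (hUV : U.1 ≤ f ⁻¹ᵁ V.1)
    {D : Derivation ℤ Γ(S, V.1) Γ(S, V.1)} {E : Derivation ℤ Γ(X, U.1) Γ(X, U.1)}
    (hE : IsNabla L sq θ V U D E) (a : Γ(S, V.1)) :
    E ((f.appLE V.1 U.1 hUV).hom a) = (f.appLE V.1 U.1 hUV).hom (D a) := by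
  refine eq_of_res_preimageOpen_eq L sq hUV ⊤ le_top fun W U' hU' hV _ hU => ?_
  rw [hE W U' hU' hV hU, ← fSharp_res_appLE sq hUV hU' hV hU, localNabla_fSharp L sq hθ hnil,
    resDer_res, fSharp_res_appLE sq hUV hU' hV hU]

theorem isNabla_lie {V : S.affineOpens} {U : X.affineOpens}
    {D₁ D₂ : Derivation ℤ Γ(S, V.1) Γ(S, V.1)} {E₁ E₂ : Derivation ℤ Γ(X, U.1) Γ(X, U.1)}
    (h₁ : IsNabla L sq θ V U D₁ E₁) (h₂ : IsNabla L sq θ V U D₂ E₂) :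
    IsNabla L sq θ V U ⁅D₁, D₂⁆ ⁅E₁, E₂⁆ := by
  intro W U' hU' hV hU b
  rw [resDer_lie, ← localNabla_lie L sq hθ hnil, Derivation.commutator_apply,
    Derivation.commutator_apply, map_sub, h₁ W U' hU' hV hU, h₂ W U' hU' hV hU,
    h₂ W U' hU' hV hU, h₁ W U' hU' hV hU]

/-- The `p`-th power commutes with restriction, so the identity follows from `localNabla_pow` on the
basis of small opens. -/
theorem derivationPow_of_isNabla {V : S.affineOpens} {U' : Y.affineOpens}
    (hU' : U'.1 ≤ g ⁻¹ᵁ (twistOpen p h V).1) {D : Derivation ℤ Γ(S, V.1) Γ(S, V.1)}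
    {E E' : Derivation ℤ Γ(X, (preimageOpen sq U').1) Γ(X, (preimageOpen sq U').1)}
    (hE : IsNabla L sq θ V (preimageOpen sq U') D E)
    (hE' : IsNabla L sq θ V (preimageOpen sq U') (derivationPow p (natCast_eq_zero p h _) D) E') :
    derivationPow p (natCast_eq_zero p (f ≫ h) _) E = E' + pullbackDer sq V U' hU' θ D := by
  refine Derivation.ext fun b => eq_of_res_preimageOpen_eq L sq (preimageOpen_le sq hU') U'.1 le_rfl
    fun W U₁ hU₁ hV hle hU => ?_
  rw [Derivation.add_apply, map_add, hE' W U₁ hU₁ hV hU, ← derivationPow_comp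
    (natCast_eq_zero p (f ≫ h) _) (natCast_eq_zero p (f ≫ h) _) (res X hU)
    (fun c => (hE W U₁ hU₁ hV hU c).symm), localNabla_pow L sq hθ hnil, Derivation.add_apply,
    resDer_derivationPow hV (natCast_eq_zero p h _) (natCast_eq_zero p h _)]
  exact congrArg _ (pullbackDer_res sq hV hle hU₁ hU' (resDer_res hV D) θ b)

/-- The deformed connection. -/
def nablaOf : LambdaConnection h f 1 where
  toFun V U hUV D := vecOf p (f ≫ h) U.1 (exists_isNabla L sq hθ hnil V U hUV D.1).choose
  map_add V U hUV D₁ D₂ := Subtype.ext <|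
    (exists_isNabla L sq hθ hnil V U hUV (D₁ + D₂).1).choose_spec.unique hUV
      (isNabla_add L sq hθ hnil (exists_isNabla L sq hθ hnil V U hUV D₁.1).choose_spec
        (exists_isNabla L sq hθ hnil V U hUV D₂.1).choose_spec)
  map_smul V U hUV a D := Subtype.ext <|
    (exists_isNabla L sq hθ hnil V U hUV (a • D).1).choose_spec.unique hUV
      (isNabla_smul L sq hθ hnil hUV a (exists_isNabla L sq hθ hnil V U hUV D.1).choose_spec)
  lifts V U hUV D a := by
    rw [map_one, one_mul]
    exact isNabla_apply L sq hθ hnil hUV (exists_isNabla L sq hθ hnil V U hUV D.1).choose_spec a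
  map_res V₁ V₂ U₁ U₂ hV hU h₁ h₂ D₁ D₂ hD b := by
    refine eq_of_res_preimageOpen_eq L sq h₁ ⊤ le_top fun W U' hU' hV' _ hle => ?_
    rw [res_res]
    refine ((exists_isNabla L sq hθ hnil V₁ U₁ h₁ D₁.1).choose_spec W U' hU' hV' hle _).trans ?_
    refine Eq.trans ?_ ((exists_isNabla L sq hθ hnil V₂ U₂ h₂ D₂.1).choose_spec W U' hU'
      (hV'.trans hV) (hle.trans hU) b).symm
    rw [res_res, eq_resDer hV D₂.1 D₁.1 hD, resDer_resDer]

theorem isNabla_nablaOf (V : S.affineOpens) (U : X.affineOpens) (hUV : U.1 ≤ f ⁻¹ᵁ V.1)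
    (D : Vec h V.1) :
    IsNabla L sq θ V U D.1 ((nablaOf L sq hθ hnil).toFun V U hUV D).1 :=
  (exists_isNabla L sq hθ hnil V U hUV D.1).choose_spec

theorem isDeformation_nablaOf : IsDeformation L sq θ (nablaOf L sq hθ hnil) := by
  intro W U' hU' D
  refine Subtype.ext (Derivation.ext fun b => ?_)
  have h1 := isNabla_nablaOf L sq hθ hnil _ _ (preimageOpen_le sq hU') D W U' hU' le_rfl le_rfl b
  rw [res_self, res_self, resDer_self] at h1
  exact h1

end

variable {L sq θ}

/-- Compatibility with restriction propagates the formula from the basic opens to all values of the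
connection; this is what makes it unique. -/
theorem IsDeformation.isNabla {nabla : LambdaConnection h f 1}
    (hd : IsDeformation L sq θ nabla) (V : S.affineOpens) (U : X.affineOpens)
    (hUV : U.1 ≤ f ⁻¹ᵁ V.1) (D : Vec h V.1) :
    IsNabla L sq θ V U D.1 (nabla.toFun V U hUV D).1 := by
  intro W U' hU' hV hU b
  have h1 := nabla.map_res (L.red W) V (preimageOpen sq U') U hV hU (preimageOpen_le sq hU') hUV
    (vecOf p h _ (resDer hV D.1)) D (resDer_res hV D.1) b
  rw [hd W U' hU'] at h1
  exact h1.symm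

theorem IsDeformation.unique {nabla nabla' : LambdaConnection h f 1}
    (hd : IsDeformation L sq θ nabla) (hd' : IsDeformation L sq θ nabla') : nabla = nabla' := by
  refine LambdaConnection.ext ?_
  funext V U hUV D
  exact Subtype.ext ((hd.isNabla V U hUV D).unique hUV (hd'.isNabla V U hUV D))

variable [IsIntegral S] [Smooth h] (hθ : θ.IsHiggsField) (hnil : θ.IsNilpotent p)
  {nabla : LambdaConnection h f 1} (hd : IsDeformation L sq θ nabla)

include hθ hnil hd

theorem IsDeformation.lie_toFun (V : S.affineOpens) (U : X.affineOpens) (hUV : U.1 ≤ f ⁻¹ᵁ V.1)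
    (D E : Vec h V.1) :
    ⁅(nabla.toFun V U hUV D).1, (nabla.toFun V U hUV E).1⁆ =
      (nabla.toFun V U hUV (vecOf p h _ ⁅D.1, E.1⁆)).1 :=
  (isNabla_lie L sq hθ hnil (hd.isNabla V U hUV D) (hd.isNabla V U hUV E)).unique hUV
    (hd.isNabla V U hUV (vecOf p h _ ⁅D.1, E.1⁆))

theorem IsDeformation.isIntegrable : nabla.IsIntegrable := by
  intro V U hUV G₁ h₁ G₂ h₂
  refine ⟨vecOf p (f ≫ h) _ ⁅G₁.1, G₂.1⁆, ?_, rfl⟩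
  have hsmul : ∀ (D E : Vec (f ≫ h) U.1) (c : Γ(X, U.1)), vecOf p (f ≫ h) _ ⁅D.1, (c • E).1⁆ =
      D.1 c • E + c • vecOf p (f ≫ h) _ ⁅D.1, E.1⁆ := fun D E c =>
    Subtype.ext (lie_smul_derivation D.1 E.1 c)
  have hadd : ∀ D E E' : Vec (f ≫ h) U.1, vecOf p (f ≫ h) _ ⁅D.1, (E + E').1⁆ =
      vecOf p (f ≫ h) _ ⁅D.1, E.1⁆ + vecOf p (f ≫ h) _ ⁅D.1, E'.1⁆ := fun D E E' =>
    Subtype.ext (lie_add D.1 E.1 E'.1)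
  have hzero : ∀ D : Vec (f ≫ h) U.1, vecOf p (f ≫ h) _ ⁅D.1, (0 : Vec (f ≫ h) U.1).1⁆ = 0 :=
    fun D => Subtype.ext (lie_zero D.1)
  have hskew : ∀ D E : Vec (f ≫ h) U.1,
      vecOf p (f ≫ h) _ ⁅D.1, E.1⁆ = -vecOf p (f ≫ h) _ ⁅E.1, D.1⁆ := fun D E =>
    Subtype.ext (lie_skew D.1 E.1).symm
  -- By Leibniz, bracketing with a fixed field preserves the foliation if it sends the generators
  -- into it. Skew-symmetry allows this to be applied to each of the two arguments in turn.
  have key : ∀ D : Vec (f ≫ h) U.1, (∀ E, vecOf p (f ≫ h) _ ⁅D.1, (nabla.toFun V U hUV E).1⁆ ∈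
      nabla.foliation V U hUV) → ∀ G ∈ nabla.foliation V U hUV,
      vecOf p (f ≫ h) _ ⁅D.1, G.1⁆ ∈ nabla.foliation V U hUV := by
    intro D hD G hG
    induction hG using Submodule.span_induction with
    | mem G hG =>
      obtain ⟨E, rfl⟩ := hG
      exact hD E
    | zero => rw [hzero]; exact zero_mem _
    | add G G' _ _ hG hG' => rw [hadd]; exact add_mem hG hG'
    | smul c G hG' hG =>
      rw [hsmul]
      exact add_mem (Submodule.smul_mem _ _ hG') (Submodule.smul_mem _ _ hG)
  refine key G₁ (fun E => ?_) G₂ h₂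
  rw [hskew]
  refine neg_mem (key _ (fun E' => ?_) G₁ h₁)
  refine Submodule.subset_span ⟨vecOf p h _ ⁅E.1, E'.1⁆, Subtype.ext ?_⟩
  exact (hd.lie_toFun hθ hnil V U hUV E E').symm

/-- Modulo the integrable foliation the `p`-th power is additive and `p`-linear, which reduces the
claim to single fields: the `p`-th power of `∇(D)` is `∇(D^p)`, which lies in the foliation, plus
the pulled back Higgs field at `D`. -/
theorem IsDeformation.pCurvature_eq (V : S.affineOpens) (U' : Y.affineOpens)
    (hU' : U'.1 ≤ g ⁻¹ᵁ (twistOpen p h V).1) (m : ℕ) (b : Fin m → Γ(X, (preimageOpen sq U').1))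
    (D : Fin m → Vec h V.1) :
    nabla.pCurvature p V (preimageOpen sq U') (preimageOpen_le sq hU') b D =
      Submodule.Quotient.mk (∑ j, b j ^ p • pullbackHiggs sq θ V U' hU' (D j)) := by
  refine (Submodule.Quotient.eq _).mpr ?_
  let U := preimageOpen sq U'
  have hUV : U.1 ≤ f ⁻¹ᵁ V.1 := preimageOpen_le sq hU'
  -- The foliation as a submodule of all derivations, the form required by
  -- `derivationPow_sum_smul_sub_mem`.
  let F : Submodule Γ(X, U.1) (Derivation ℤ Γ(X, U.1) Γ(X, U.1)) :=
    (nabla.foliation V U hUV).map (tangentSections (f ≫ h) U.1).subtype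
  have hF : ∀ D ∈ F, ∀ E ∈ F, ⁅D, E⁆ ∈ F := by
    rintro _ ⟨D, hD, rfl⟩ _ ⟨E, hE, rfl⟩
    obtain ⟨G, hG, e⟩ := hd.isIntegrable hθ hnil V U hUV D hD E hE
    exact ⟨G, hG, e⟩
  have hnab : ∀ D : Vec h V.1, nabla.toFun V U hUV D ∈ nabla.foliation V U hUV := fun D =>
    Submodule.subset_span ⟨D, rfl⟩
  have h1 := derivationPow_sum_smul_sub_mem (natCast_eq_zero p (f ≫ h) U.1) F hF Finset.univ b
    (fun j => (nabla.toFun V U hUV (D j)).1) fun j => ⟨_, hnab (D j), rfl⟩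
  obtain ⟨G, hG, e⟩ := h1
  have h2 : ∀ j, derivationPow p (natCast_eq_zero p (f ≫ h) U.1) (nabla.toFun V U hUV (D j)).1 =
      (nabla.toFun V U hUV (Vec.pPow p (D j))).1 + (pullbackHiggs sq θ V U' hU' (D j)).1 :=
    fun j => derivationPow_of_isNabla L sq hθ hnil hU' (hd.isNabla V U hUV (D j))
      (hd.isNabla V U hUV (Vec.pPow p (D j)))
  have h3 : Vec.pPow p (nabla.onPullback V U hUV b D) -
      ∑ j, b j ^ p • pullbackHiggs sq θ V U' hU' (D j) =
      G + ∑ j, b j ^ p • nabla.toFun V U hUV (Vec.pPow p (D j)) := by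
    refine Subtype.ext ?_
    have h4 : (nabla.onPullback V U hUV b D).1 = ∑ j, b j • (nabla.toFun V U hUV (D j)).1 :=
      AddSubmonoidClass.coe_finsetSum _ _
    have h5 : ∀ E : Fin m → Vec (f ≫ h) U.1,
        (∑ j, b j ^ p • E j).1 = ∑ j, b j ^ p • (E j).1 := fun E =>
      AddSubmonoidClass.coe_finsetSum _ _
    have h6 : G.1 = _ := e
    change derivationPow p (natCast_eq_zero p (f ≫ h) U.1) (nabla.onPullback V U hUV b D).1 -
      (∑ j, b j ^ p • pullbackHiggs sq θ V U' hU' (D j)).1 =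
      G.1 + (∑ j, b j ^ p • nabla.toFun V U hUV (Vec.pPow p (D j))).1
    rw [h4, h5, h5, h6]
    simp only [h2, smul_add, Finset.sum_add_distrib]
    abel
  rw [h3]
  exact add_mem hG (sum_mem fun j _ => Submodule.smul_mem _ _ (hnab _))

end Global

end

end NonlinearHodge

open NonlinearHodge in
theorem lemma4p8 (p : ℕ) [Fact p.Prime] (k : Type u) [Field k] [CharP k p] [PerfectRing k p]
    {S : Scheme.{u}} (h : S ⟶ Spec (.of k)) (hS : IsVariety h) (hsm : Smooth h)
    (L : FrobeniusLifting p h)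
    {Y : Scheme.{u}} (g : Y ⟶ frobTwist p h) (hY : IsVariety (g ≫ frobTwistStr p h))
    {X : Scheme.{u}} (π : X ⟶ Y) (f : X ⟶ S) (sq : IsPullback π f g (relFrobenius p h))
    (θ : LambdaConnection (frobTwistStr p h) g 0) (hθ : θ.IsHiggsField)
    (hnil : θ.IsNilpotent p) :
    (∃! nabla : LambdaConnection h f 1, IsDeformation L sq θ nabla) ∧
    ∀ nabla : LambdaConnection h f 1, IsDeformation L sq θ nabla →
      nabla.IsIntegrable ∧
      ∀ (V : S.affineOpens) (U' : Y.affineOpens) (hU' : U'.1 ≤ g ⁻¹ᵁ (twistOpen p h V).1)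
        (m : ℕ) (b : Fin m → Γ(X, (preimageOpen sq U').1)) (D : Fin m → Vec h V.1),
        nabla.pCurvature p V (preimageOpen sq U') (preimageOpen_le sq hU') b D =
          Submodule.Quotient.mk (∑ j, b j ^ p • pullbackHiggs sq θ V U' hU' (D j)) := by
  have := hS.isIntegral
  exact ⟨⟨nablaOf L sq hθ hnil, isDeformation_nablaOf L sq hθ hnil, fun _ hd =>
    hd.unique (isDeformation_nablaOf L sq hθ hnil)⟩, fun _ hd =>
    ⟨hd.isIntegrable hθ hnil, hd.pCurvature_eq hθ hnil⟩⟩
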